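/- Notation. For a set $A_{XY}\subset\mathbb R^3$ let $A_{YZ}$, $A_{ZX}$ be obtained by cycling the coordinates, and let $D_r(p)$, $D_r^o(p)$ be the closed and open disk of radius $r$ about $p\in\mathbb R^2$. Put $$O_{XY}=\Big([-1,1]^2-\bigcup D^o_{2/3}(\pm1,\pm1)\Big)\times\{0\},\qquad D_{XY}=D_{2/3}(1,-1)\times\{0\},$$ $$A_{XY}=\big(D_{4/3}(1,-1)-D^o_{2/3}(1,-1)\big)\times\{0\},\qquad B_{XY}=\partial D_1(1,-1)\times[-\tfrac13,\tfrac13],$$ $$Q_{XY}=\{(x,y,t)\in A_{XY}\cup B_{XY}:\max(|x|,|y|)\ge1\},$$ and let $M$ be the union of $O_{XY},Q_{XY},D_{XY}$ and their cyclic images. Let $M^*$ be the identification space obtained from the six rectangles $$M_{XY}=O_{XY}\cup(A_{XY}\cap Q_{XY})\cup D_{XY},\qquad B'_{XY}=B_{XY}\cap Q_{XY},$$ and their cyclic images, by gluing consecutive rectangles of the cycle $M_{XY},B'_{YZ},M_{ZX},B'_{XY},M_{YZ},B'_{ZX}$ along their common straight edges. Let $\partial M$ be the union of the following nine roads and nine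 bridges: the roads are the circular arcs of radius $2/3$ in the boundary of $O_{XY}$ about the corners $(1,1),(-1,1),(-1,-1)$ and their cyclic images; the bridges are the parts with $\max(|x|,|y|)\ge 1$ of the circle of radius $4/3$ about $(1,-1)$ at height $0$ and of the circles of radius $1$ about $(1,-1)$ at heights $\pm\frac13$, and their cyclic images. Let $S^3=\mathbb R^3\cup\{\infty\}$, and for $S\subset\mathbb R^3$ let $\mathrm{Cone}(S)=\{tp:p\in S,\ t\ge1\}\cup\{\infty\}\subset S^3$. Put $P=\mathrm{Cone}(\partial M)$. A topological immersion is a continuous map that is locally an embedding. Theorem. 1. $M^*$ is homeomorphic to a Möbius band. The obvious map $M^*\to\mathbb R^3$ is a topological immersion with image $M$. The preimage of $\partial M$ is exactly the boundary circle of $M^*$, and the map is injective there. 2. $\partial M$ is cone-friendly: each ray from the origin meets it at most once. $P$ is an embedded closed disk in $S^3$ with boundary circle $\partial M$, and $M\cap P=\partial M$. 3. The 18 roads and bridges can be labelled cyclically $e_i$, $i\in\mathbb Z/18$, with roads and bridges alternating, and there are points $v_i$ such that $P$ is the union of the slices $T_i=\mathrm{Cone}(e_i)$ and the following holds. Each $T_i$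 is a topological triangle with vertices $\infty,v_i,v_{i+1}$ and opposite sides $e_i,\mathrm{Cone}(v_{i+1}),\mathrm{Cone}(v_i)$. Moreover $T_i\cap T_{i+1}=\mathrm{Cone}(v_{i+1})$, and any two distinct non-consecutive slices meet only in $\infty$. Exactly 12 of the slices lie in coordinate planes (together with $\infty$). Each of the other 6 lies, apart from $\infty$, in an elliptical cone with apex at the origin, and these cones lie in six different closed orthants. 4. The surface obtained from $M^*$ by attaching $P$ along $\partial M$ is homeomorphic to the real projective plane, and the obvious map from it to $S^3$ is a topological immersion with image $M\cup P$. Thus $M\cup P$ is an immersed real projective plane. 5. The maps $(X,Y,Z)\mapsto(Y,Z,X)$, $(-Y,-X,-Z)$, $(-X,-Z,-Y)$, $(-Z,-Y,-X)$ generate a group of 6 isometries of $\mathbb R^3$. Each of them, extended by $\infty\mapsto\infty$, preserves $M$, $P$ and $M\cup P$. -/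

import Mathlib

noncomputable section

namespace Boy

/-- Euclidean space `ℝ³`, with coordinates `X = p 0`, `Y = p 1`, `Z = p 2`. -/
abbrev R3 : Type := EuclideanSpace ℝ (Fin 3)

/-- The 3-sphere, modelled as `ℝ³ ∪ {∞}`. -/
abbrev S3 : Type := OnePoint R3

/-- Cycling the coordinates: if `A` is a set `A_XY`, then `cycled 0 A = A_XY`, `cycled 1 A = A_YZ`
and `cycled 2 A = A_ZX`. -/
def cycled (k : Fin 3) (A : Set R3) : Set R3 := {p | !₂[p k, p (k + 1), p (k + 2)] ∈ A}

/-! ### The pieces of the Möbius band -/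

/-- `O_XY`: the square `[-1,1]²` minus the open disks of radius `2/3` about its four corners. -/
def octagon : Set R3 :=
  {p | |p 0| ≤ 1 ∧ |p 1| ≤ 1 ∧ p 2 = 0 ∧
    ∀ s ∈ ({1, -1} : Set ℝ), ∀ t ∈ ({1, -1} : Set ℝ),
      (2 / 3 : ℝ) ^ 2 ≤ (p 0 - s) ^ 2 + (p 1 - t) ^ 2}

/-- The octacross `O_XYZ`. -/
def octacross : Set R3 := ⋃ k : Fin 3, cycled k octagon

/-- The planar annulus `A_XY`. -/
def annulusA : Set R3 :=
  {p | p 2 = 0 ∧ (2 / 3 : ℝ) ^ 2 ≤ (p 0 - 1) ^ 2 + (p 1 + 1) ^ 2 ∧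
    (p 0 - 1) ^ 2 + (p 1 + 1) ^ 2 ≤ (4 / 3 : ℝ) ^ 2}

/-- The cylindrical annulus `B_XY`. -/
def annulusB : Set R3 := {p | |p 2| ≤ 1 / 3 ∧ (p 0 - 1) ^ 2 + (p 1 + 1) ^ 2 = 1}

/-- The region `max(|x|,|y|) ≥ 1`. -/
def outside : Set R3 := {p | 1 ≤ max |p 0| |p 1|}

/-- The crossbridge `Q_XY`. -/
def crossbridge : Set R3 := (annulusA ∪ annulusB) ∩ outside

/-- The round disk `D_XY`. -/
def roundDisk : Set R3 := {p | p 2 = 0 ∧ (p 0 - 1) ^ 2 + (p 1 + 1) ^ 2 ≤ (2 / 3 : ℝ) ^ 2}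

/-- The set `M`, the union of the octacross, three crossbridges and three round disks. -/
def M : Set R3 := octacross ∪ (⋃ k : Fin 3, cycled k crossbridge) ∪ ⋃ k : Fin 3, cycled k roundDisk

/-! ### The boundary of `M`: nine roads and nine bridges -/

/-- The road of `O_XY` (curved side) at the corner `(s,t)`. -/
def road (s t : ℝ) : Set R3 :=
  {p | |p 0| ≤ 1 ∧ |p 1| ≤ 1 ∧ p 2 = 0 ∧ (p 0 - s) ^ 2 + (p 1 - t) ^ 2 = (2 / 3 : ℝ) ^ 2}

/-- The outer bridge (curved side) of the planar part of `Q_XY`. -/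
def outerBridge : Set R3 :=
  {p | p 2 = 0 ∧ (p 0 - 1) ^ 2 + (p 1 + 1) ^ 2 = (4 / 3 : ℝ) ^ 2} ∩ outside

/-- The bridge (curved side) of the cylindrical part of `Q_XY` at height `s/3`. -/
def sideBridge (s : ℝ) : Set R3 :=
  {p | p 2 = s / 3 ∧ (p 0 - 1) ^ 2 + (p 1 + 1) ^ 2 = 1} ∩ outside

/-- The nine boundary roads: in each coordinate plane, the road at the corner `(1,-1)`, where the
round disk is glued in, is not on the boundary. -/
def boundaryRoads : Set (Set R3) :=
  {e | ∃ k : Fin 3, ∃ s ∈ ({1, -1} : Set ℝ), ∃ t ∈ ({1, -1} : Set ℝ),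
    ¬ (s = 1 ∧ t = -1) ∧ e = cycled k (road s t)}

/-- The nine boundary bridges: the inner bridge of each crossbridge, where the round disk is
glued in, is not on the boundary. -/
def boundaryBridges : Set (Set R3) :=
  {e | ∃ k : Fin 3, e = cycled k outerBridge ∨
    ∃ s ∈ ({1, -1} : Set ℝ), e = cycled k (sideBridge s)}

/-- The boundary curve `∂M`. -/
def bdM : Set R3 := ⋃₀ (boundaryRoads ∪ boundaryBridges)

/-! ### Coning to infinity -/

/-- The cone `{tp : p ∈ S, t ≥ 1} ∪ {∞}` in the 3-sphere. -/
def coneToInfinity (S : Set R3) : Set S3 :=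
  (fun p : R3 => (p : S3)) '' {q | ∃ p ∈ S, ∃ t : ℝ, 1 ≤ t ∧ q = t • p} ∪ {OnePoint.infty}

/-- A subset of `ℝ³`, regarded as a subset of the 3-sphere. -/
def inS3 (S : Set R3) : Set S3 := (fun p : R3 => (p : S3)) '' S

/-- The pizza. -/
def P : Set S3 := coneToInfinity bdM

/-- Each ray from the origin meets `S` at most once. -/
def ConeFriendly (S : Set R3) : Prop :=
  ∀ u : R3, u ≠ 0 → ({q | ∃ t : ℝ, 0 ≤ t ∧ q = t • u} ∩ S).Subsingleton

/-- `T` (minus `∞`) lies in a coordinate plane. -/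
def InCoordinatePlane (T : Set S3) : Prop :=
  ∃ k : Fin 3, T ⊆ inS3 {p | p k = 0} ∪ {OnePoint.infty}

/-- An elliptical cone (one nappe, apex at the origin): the preimage of the round cone
`x² + y² = z²`, `z ≥ 0` under a linear automorphism of `ℝ³`. -/
def IsEllipticalCone (C : Set R3) : Prop :=
  ∃ L : R3 ≃ₗ[ℝ] R3, C = {p | L p 0 ^ 2 + L p 1 ^ 2 = L p 2 ^ 2 ∧ 0 ≤ L p 2}

/-- The closed orthant with the given signs. -/
def orthant (σ : Fin 3 → ℤˣ) : Set R3 := {p | ∀ k, 0 ≤ ((σ k : ℤ) : ℝ) * p k}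

/-! ### Topological notions -/

/-- A topological immersion: a continuous map that is locally an embedding. -/
def IsTopologicalImmersion {X Y : Type} [TopologicalSpace X] [TopologicalSpace Y]
    (f : X → Y) : Prop :=
  Continuous f ∧ ∀ x, ∃ U ∈ nhds x, Topology.IsEmbedding (U.domRestrict f)

/-- `T` is an embedded triangle with vertices `vert j`, the side opposite to `vert j` being
`side j`. -/
def IsTopologicalTriangle {X : Type} [TopologicalSpace X] (T : Set X)
    (vert : Fin 3 → X) (side : Fin 3 → Set X) : Prop :=
  ∃ φ : stdSimplex ℝ (Fin 3) → X, Topology.IsEmbedding φ ∧ Set.range φ = T ∧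
    (∀ (x : stdSimplex ℝ (Fin 3)) (j : Fin 3), (x : Fin 3 → ℝ) j = 1 → φ x = vert j) ∧
    ∀ j : Fin 3, φ '' {x | (x : Fin 3 → ℝ) j = 0} = side j

/-- `T` is an embedded closed disk with boundary circle `c`. -/
def IsEmbeddedDisk {X : Type} [TopologicalSpace X] (T c : Set X) : Prop :=
  ∃ φ : Metric.closedBall (0 : EuclideanSpace ℝ (Fin 2)) 1 → X,
    Topology.IsEmbedding φ ∧ Set.range φ = T ∧
      φ '' {x | ‖(x : EuclideanSpace ℝ (Fin 2))‖ = 1} = c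

/-- The Möbius band `[0,1] × [-1,1] / (0,t) ∼ (1,-t)`. -/
abbrev MobiusBand : Type :=
  Quot fun a b : Set.Icc (0 : ℝ) 1 × Set.Icc (-1 : ℝ) 1 =>
    (a.1 : ℝ) = 0 ∧ (b.1 : ℝ) = 1 ∧ (b.2 : ℝ) = -(a.2 : ℝ)

/-- The boundary circle of the Möbius band. -/
def MobiusBand.boundary : Set MobiusBand :=
  Quot.mk _ '' {a | |(a.2 : ℝ)| = 1}

/-- The real projective plane: the unit sphere of `ℝ³` modulo the antipodal map. -/
abbrev RP2 : Type :=
  Quot fun x y : Metric.sphere (0 : R3) 1 => (y : R3) = -(x : R3)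

/-! ### The abstract surfaces -/

/-- The planar rectangle `M_XY`: octagon, planar part of the crossbridge, and round disk. -/
def flatPiece : Set R3 := octagon ∪ (annulusA ∩ outside) ∪ roundDisk

/-- The `B`-part of the crossbridge `Q_XY`. -/
def bandPiece : Set R3 := annulusB ∩ outside

/-- The six rectangles: `inl k` for the planar ones `M_XY`, `M_YZ`, `M_ZX` and `inr k` for the
`B`-parts of `Q_XY`, `Q_YZ`, `Q_ZX`. -/
def piece : Fin 3 ⊕ Fin 3 → Set R3 :=
  Sum.elim (fun k => cycled k flatPiece) (fun k => cycled k bandPiece)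

/-- The gluing of adjacent rectangles along their common straight edge. In the cycle
`M_XY, B_YZ, M_ZX, B_XY, M_YZ, B_ZX` of rectangles, a planar rectangle is adjacent to a `B`-part
exactly if they have different indices, and then their intersection is the common edge. -/
def Glue (a b : Σ i : Fin 3 ⊕ Fin 3, piece i) : Prop :=
  (∃ k l : Fin 3, a.1 = Sum.inl k ∧ b.1 = Sum.inr l ∧ k ≠ l) ∧ (a.2 : R3) = (b.2 : R3)

/-- The abstract band `M*`: the identification space of the six rectangles. -/
abbrev MStar : Type := Quot Glue

/-- The obvious map `M* → M ⊆ ℝ³`. -/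
def mapM : MStar → R3 := Quot.lift (fun a => (a.2 : R3)) (fun _ _ h => h.2)

/-- The gluing of the pizza to `M*` along `∂M`. -/
def Attach : MStar ⊕ P → MStar ⊕ P → Prop
  | Sum.inl x, Sum.inr q => mapM x ∈ bdM ∧ (mapM x : S3) = (q : S3)
  | _, _ => False

/-- The abstract closed surface: `M*` with the pizza attached along `∂M`. -/
abbrev BoyStar : Type := Quot Attach

/-- The obvious map from the abstract surface onto `M ∪ P ⊆ S³`. -/
def boyMap : BoyStar → S3 :=
  Quot.lift (Sum.elim (fun x => (mapM x : S3)) (fun q => (q : S3))) (by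
    rintro (x | q) (y | r) h
    · exact h.elim
    · exact h.2
    · exact h.elim
    · exact h.elim)

/-! ### Symmetries -/

/-- The symmetries `(X,Y,Z) ↦ (Y,Z,X)`, `(-Y,-X,-Z)`, `(-X,-Z,-Y)`, `(-Z,-Y,-X)`. -/
def symmetryGenerators : Set (R3 ≃ₗᵢ[ℝ] R3) :=
  {g | (∀ p, g p = !₂[p 1, p 2, p 0]) ∨ (∀ p, g p = !₂[-p 1, -p 0, -p 2]) ∨
    (∀ p, g p = !₂[-p 0, -p 2, -p 1]) ∨ (∀ p, g p = !₂[-p 2, -p 1, -p 0])}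

end Boy

end

noncomputable section

namespace Boy

/-! ### The gauge of the flat piece -/

/-! The proof works in explicit coordinates. Compactness turns continuous bijections onto Hausdorff
spaces into homeomorphisms, and local injectivity into immersion.

Each flat rectangle is star-shaped about the origin, hence the unit ball `flatGauge ≤ 1` of a
positively homogeneous function glued together from the gauges of circles and lines
(`flatGauge_le_one`). Stretching it radially gives a convex pentagon, and the pencil of lines
through a point above the pentagon gives a rectangle whose two vertical sides are the straight
edges, parametrized affinely. The cylindrical bands get a rational parametrization of the circle and
their height. In these charts the transverse coordinate is kept on passing from a flat piece to the
next band and reversed on passing from a band to the next flat piece. A cycle of six pieces has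
three reversals, an odd number, so `MStar` is a Möbius band, with boundary where the transverse
coordinate is `±1`. That curve is mapped injectively onto `bdM`, and no other point of `MStar` maps
there (`mem_bdM_iff_of_mem_piece`, `mapM_injOn_bd`). Pieces that meet in `MStar` are glued along all
their common points in space, so `mapM` is locally injective.

The decisive fact about the pizza is `eq_one_of_smul_bdM_mem_M`: a point of `bdM` pushed outwards
along its ray leaves `M` at once. Since `bdM ⊆ M`, this gives both cone-friendliness and `M ∩ P =
∂M`. The cone on the boundary circle then has the same fibres as polar coordinates on a disk, so `P`
is a disk.

In the projective plane, the zone of the sphere at height at most `1/2` is a Möbius band and the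
remaining cap is a disk. The function `t * exp (π i s)` on the strip serves as coordinate on both
boundary circles, so `MStar` and `P` fit together as zone and cap (`attach_iff`). As `M` and `P`
meet only where they are glued, local injectivity survives.

For the slices, linear inequalities locate each boundary arc well enough to find all intersections,
and cone-friendliness transfers these to the cones. Homogenizing the circle equation of a side
bridge gives its elliptical cone; all other arcs are planar. The symmetry group is the symmetric
group on the coordinates, each permutation being multiplied by its sign. -/

/-- Gauge of the region cut out by the four disks of radius `2/3` about the corners. -/
def roadGauge (x y : ℝ) : ℝ :=
  9 / 14 * ((|x| + |y|) + √((|x| + |y|) ^ 2 - 14 / 9 * (x ^ 2 + y ^ 2)))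

/-- Gauge of the disk of radius `4/3` about `(1,-1)`, seen from the origin. -/
def outerGauge (x y : ℝ) : ℝ :=
  9 / 2 * ((x - y) - √((x - y) ^ 2 - 2 / 9 * (x ^ 2 + y ^ 2)))

/-- Gauge of the octagon. -/
def octGauge (x y : ℝ) : ℝ :=
  if |x| ≤ 3 * |y| then if |y| ≤ 3 * |x| then roadGauge x y else |y| else |x|

/-- Gauge of the flat piece. -/
def flatGauge (x y : ℝ) : ℝ :=
  if max (3 * y - x) (y - 3 * x) ≤ 0 then outerGauge x y else octGauge x y

lemma sqrt_sq_mul {t : ℝ} (ht : 0 ≤ t) (a : ℝ) : √(t ^ 2 * a) = t * √a := by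
  rw [Real.sqrt_mul (by positivity), Real.sqrt_sq ht]

lemma roadGauge_smul {t : ℝ} (ht : 0 ≤ t) (x y : ℝ) :
    roadGauge (t * x) (t * y) = t * roadGauge x y := by
  unfold roadGauge
  rw [abs_mul, abs_mul, abs_of_nonneg ht,
    show (t * |x| + t * |y|) ^ 2 - 14 / 9 * ((t * x) ^ 2 + (t * y) ^ 2) =
      t ^ 2 * ((|x| + |y|) ^ 2 - 14 / 9 * (x ^ 2 + y ^ 2)) by ring, sqrt_sq_mul ht]
  ring

lemma outerGauge_smul {t : ℝ} (ht : 0 ≤ t) (x y : ℝ) :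
    outerGauge (t * x) (t * y) = t * outerGauge x y := by
  unfold outerGauge
  rw [show (t * x - t * y) ^ 2 - 2 / 9 * ((t * x) ^ 2 + (t * y) ^ 2) =
      t ^ 2 * ((x - y) ^ 2 - 2 / 9 * (x ^ 2 + y ^ 2)) by ring, sqrt_sq_mul ht]
  ring

lemma octGauge_smul {t : ℝ} (ht : 0 < t) (x y : ℝ) :
    octGauge (t * x) (t * y) = t * octGauge x y := by
  unfold octGauge
  rw [roadGauge_smul ht.le, abs_mul, abs_mul, abs_of_pos ht]
  have h1 : t * |x| ≤ 3 * (t * |y|) ↔ |x| ≤ 3 * |y| := by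
    rw [mul_left_comm]; exact mul_le_mul_iff_right₀ ht
  have h2 : t * |y| ≤ 3 * (t * |x|) ↔ |y| ≤ 3 * |x| := by
    rw [mul_left_comm]; exact mul_le_mul_iff_right₀ ht
  simp only [h1, h2]
  split_ifs <;> rfl

@[simp] lemma flatGauge_zero : flatGauge 0 0 = 0 := by
  simp [flatGauge, outerGauge]

lemma flatGauge_smul {t : ℝ} (ht : 0 ≤ t) (x y : ℝ) :
    flatGauge (t * x) (t * y) = t * flatGauge x y := by
  rcases ht.eq_or_lt with rfl | ht
  · simp
  unfold flatGauge
  rw [octGauge_smul ht, outerGauge_smul ht.le]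
  have h1 : max (3 * (t * y) - t * x) (t * y - 3 * (t * x)) ≤ 0 ↔
      max (3 * y - x) (y - 3 * x) ≤ 0 := by
    rw [show 3 * (t * y) - t * x = t * (3 * y - x) by ring,
      show t * y - 3 * (t * x) = t * (y - 3 * x) by ring, ← mul_max_of_nonneg _ _ ht.le]
    constructor
    · intro h; by_contra h'; push Not at h'; nlinarith [mul_pos ht h']
    · intro h; nlinarith
  simp only [h1]
  split_ifs <;> rfl

/-- On the rays through the ends of the roads, the road gauge is the sup norm. -/
lemma roadGauge_of_eq {x y : ℝ} (h : |x| = 3 * |y|) : roadGauge x y = |x| := by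
  unfold roadGauge
  rw [← sq_abs x, ← sq_abs y, h,
    show (3 * |y| + |y|) ^ 2 - 14 / 9 * ((3 * |y|) ^ 2 + |y| ^ 2) = (2 / 3 * |y|) ^ 2 by ring,
    Real.sqrt_sq (by positivity)]
  ring

lemma roadGauge_comm (x y : ℝ) : roadGauge x y = roadGauge y x := by
  unfold roadGauge; rw [add_comm |x|, add_comm (x ^ 2)]

lemma outerGauge_of_eq_left {x y : ℝ} (h : x = 3 * y) (hy : 0 ≤ y) : outerGauge x y = x := by
  unfold outerGauge
  rw [h, show (3 * y - y) ^ 2 - 2 / 9 * ((3 * y) ^ 2 + y ^ 2) = (4 / 3 * y) ^ 2 by ring,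
    Real.sqrt_sq (by positivity)]
  ring

lemma outerGauge_of_eq_right {x y : ℝ} (h : y = 3 * x) (hx : x ≤ 0) : outerGauge x y = -y := by
  unfold outerGauge
  rw [h, show (x - 3 * x) ^ 2 - 2 / 9 * (x ^ 2 + (3 * x) ^ 2) = (4 / 3 * -x) ^ 2 by ring,
    Real.sqrt_sq (by linarith)]
  ring

lemma octGauge_of_eq_left {x y : ℝ} (h : x = 3 * y) (hy : 0 ≤ y) : octGauge x y = x := by
  have h' : |x| = 3 * |y| := by rw [h, abs_mul]; norm_num
  unfold octGauge
  rw [if_pos h'.le, if_pos (by rw [h']; nlinarith [abs_nonneg y]), roadGauge_of_eq h',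
    abs_of_nonneg (by linarith)]

lemma octGauge_of_eq_right {x y : ℝ} (h : y = 3 * x) (hx : x ≤ 0) : octGauge x y = -y := by
  have h' : |y| = 3 * |x| := by rw [h, abs_mul]; norm_num
  unfold octGauge
  rw [if_pos (by rw [h']; nlinarith [abs_nonneg x]), if_pos h'.le, roadGauge_comm,
    roadGauge_of_eq h', abs_of_nonpos (by linarith)]

/-- The circle of radius `4/3` passes through `(1, 1/3)` and `(-1/3, -1)`, where two roads end. So
on the two rays bounding the outer sector both gauges are the sup norm, and the glued function is
continuous. -/
lemma outerGauge_eq_octGauge {x y : ℝ} (h : max (3 * y - x) (y - 3 * x) = 0) :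
    outerGauge x y = octGauge x y := by
  rcases max_choice (3 * y - x) (y - 3 * x) with h' | h'
  · have h1 : x = 3 * y := by linarith
    have h2 : y - 3 * x ≤ 0 := h ▸ le_max_right _ _
    rw [outerGauge_of_eq_left h1 (by linarith), octGauge_of_eq_left h1 (by linarith)]
  · have h1 : y = 3 * x := by linarith
    have h2 : 3 * y - x ≤ 0 := h ▸ le_max_left _ _
    rw [outerGauge_of_eq_right h1 (by linarith), octGauge_of_eq_right h1 (by linarith)]

lemma continuous_roadGauge : Continuous fun p : ℝ × ℝ => roadGauge p.1 p.2 := by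
  unfold roadGauge; fun_prop

lemma continuous_outerGauge : Continuous fun p : ℝ × ℝ => outerGauge p.1 p.2 := by
  unfold outerGauge; fun_prop

lemma continuous_octGauge : Continuous fun p : ℝ × ℝ => octGauge p.1 p.2 := by
  unfold octGauge
  refine Continuous.if_le (Continuous.if_le continuous_roadGauge (by fun_prop) (by fun_prop)
    (by fun_prop) ?_) (by fun_prop) (by fun_prop) (by fun_prop) ?_
  · intro p h
    rw [roadGauge_comm, roadGauge_of_eq h]
  · intro p h
    rw [if_pos (by rw [h]; nlinarith [abs_nonneg p.2]), roadGauge_of_eq h]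

lemma continuous_flatGauge : Continuous fun p : ℝ × ℝ => flatGauge p.1 p.2 := by
  unfold flatGauge
  refine Continuous.if_le continuous_outerGauge continuous_octGauge (by fun_prop)
    (by fun_prop) fun p h => outerGauge_eq_octGauge h

/-! Sectors -/

lemma flatGauge_eq_outerGauge {x y : ℝ} (h1 : 3 * y ≤ x) (h2 : y ≤ 3 * x) :
    flatGauge x y = outerGauge x y := by
  unfold flatGauge; rw [if_pos (max_le (by linarith) (by linarith))]

lemma flatGauge_eq_octGauge {x y : ℝ} (h : x ≤ 3 * y ∨ 3 * x ≤ y) :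
    flatGauge x y = octGauge x y := by
  unfold flatGauge
  split_ifs with h'
  · have h1 := (le_max_left _ _).trans h'
    have h2 := (le_max_right _ _).trans h'
    apply outerGauge_eq_octGauge
    apply le_antisymm h'
    rcases h with h | h
    · exact le_max_of_le_left (by linarith)
    · exact le_max_of_le_right (by linarith)
  · rfl

lemma octGauge_eq_roadGauge {x y : ℝ} (h1 : |x| ≤ 3 * |y|) (h2 : |y| ≤ 3 * |x|) :
    octGauge x y = roadGauge x y := by
  unfold octGauge; rw [if_pos h1, if_pos h2]

lemma octGauge_eq_left {x y : ℝ} (h : 3 * |y| ≤ |x|) : octGauge x y = |x| := by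
  unfold octGauge
  split_ifs with h1 h2
  · exact roadGauge_of_eq (le_antisymm h1 h)
  · have := abs_nonneg x; have := abs_nonneg y; linarith
  · rfl

lemma octGauge_eq_right {x y : ℝ} (h : 3 * |x| ≤ |y|) : octGauge x y = |y| := by
  unfold octGauge
  split_ifs with h1 h2
  · rw [roadGauge_comm]; exact roadGauge_of_eq (le_antisymm h2 h)
  · rfl
  · have := abs_nonneg x; have := abs_nonneg y; linarith

/-! Sublevel sets -/

/-- Nine times this discriminant is `9/5 * (3b - a) * (3a - b) + 2/5 * (a² + b²)`. -/
lemma roadDisc_nonneg {a b : ℝ} (h1 : a ≤ 3 * b) (h2 : b ≤ 3 * a) :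
    0 ≤ (a + b) ^ 2 - 14 / 9 * (a ^ 2 + b ^ 2) := by
  nlinarith [mul_nonneg (sub_nonneg.2 h1) (sub_nonneg.2 h2)]

/-- That `(x, y) / g` lies on a corner circle means `14/9 g² - 2 (|x| + |y|) g + (x² + y²) = 0`. The
gauge is the larger root, which belongs to the arc nearer to the origin. -/
lemma roadGauge_le_one {x y : ℝ} (h1 : |x| ≤ 3 * |y|) (h2 : |y| ≤ 3 * |x|) :
    roadGauge x y ≤ 1 ↔ |x| ≤ 1 ∧ |y| ≤ 1 ∧ (2 / 3 : ℝ) ^ 2 ≤ (|x| - 1) ^ 2 + (|y| - 1) ^ 2 := by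
  unfold roadGauge
  rw [← sq_abs x, ← sq_abs y]
  have ha := abs_nonneg x
  have hb := abs_nonneg y
  generalize |x| = a at *
  generalize |y| = b at *
  have hD := roadDisc_nonneg h1 h2
  rw [show 9 / 14 * (a + b + √((a + b) ^ 2 - 14 / 9 * (a ^ 2 + b ^ 2))) ≤ 1 ↔
    √((a + b) ^ 2 - 14 / 9 * (a ^ 2 + b ^ 2)) ≤ 14 / 9 - (a + b) by
      constructor <;> intro h <;> linarith, Real.sqrt_le_iff]
  constructor
  · rintro ⟨h3, h4⟩
    refine ⟨?_, ?_, by nlinarith⟩ <;> by_contra! h5 <;> nlinarith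
  · rintro ⟨h3, h4, h5⟩
    refine ⟨?_, by nlinarith⟩
    by_contra! h6
    nlinarith

lemma roadGauge_eq_one {x y : ℝ} (h1 : |x| ≤ 3 * |y|) (h2 : |y| ≤ 3 * |x|) :
    roadGauge x y = 1 ↔ |x| ≤ 1 ∧ |y| ≤ 1 ∧ (|x| - 1) ^ 2 + (|y| - 1) ^ 2 = (2 / 3 : ℝ) ^ 2 := by
  unfold roadGauge
  rw [← sq_abs x, ← sq_abs y]
  have ha := abs_nonneg x
  have hb := abs_nonneg y
  generalize |x| = a at *
  generalize |y| = b at *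
  have hD := roadDisc_nonneg h1 h2
  rw [show 9 / 14 * (a + b + √((a + b) ^ 2 - 14 / 9 * (a ^ 2 + b ^ 2))) = 1 ↔
    √((a + b) ^ 2 - 14 / 9 * (a ^ 2 + b ^ 2)) = 14 / 9 - (a + b) by
      constructor <;> intro h <;> linarith]
  constructor
  · intro h
    have h3 : 0 ≤ 14 / 9 - (a + b) := h ▸ Real.sqrt_nonneg _
    rw [Real.sqrt_eq_iff_eq_sq hD h3] at h
    refine ⟨?_, ?_, by nlinarith⟩ <;> by_contra! h5 <;> nlinarith
  · rintro ⟨h3, h4, h5⟩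
    have h6 : 0 ≤ 14 / 9 - (a + b) := by
      by_contra! h6
      nlinarith
    rw [Real.sqrt_eq_iff_eq_sq hD h6]
    nlinarith

lemma outerDisc_nonneg {x y : ℝ} (h1 : 3 * y ≤ x) (h2 : y ≤ 3 * x) :
    0 ≤ (x - y) ^ 2 - 2 / 9 * (x ^ 2 + y ^ 2) := by
  nlinarith [mul_nonneg (sub_nonneg.2 h1) (sub_nonneg.2 h2), sq_nonneg (x + y)]

/-- Here the quadratic is `2/9 g² - 2 (x - y) g + (x² + y²) = 0`, and the smaller root picks the far
arc. The line `x - y = 2/9` is the polar of the origin: it joins the two points of tangency and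
separates the near arc from the far one. -/
lemma outerGauge_le_one {x y : ℝ} (h1 : 3 * y ≤ x) (h2 : y ≤ 3 * x) :
    outerGauge x y ≤ 1 ↔ x - y ≤ 2 / 9 ∨ (x - 1) ^ 2 + (y + 1) ^ 2 ≤ (4 / 3 : ℝ) ^ 2 := by
  unfold outerGauge
  have hD := outerDisc_nonneg h1 h2
  rw [show 9 / 2 * (x - y - √((x - y) ^ 2 - 2 / 9 * (x ^ 2 + y ^ 2))) ≤ 1 ↔
    x - y - 2 / 9 ≤ √((x - y) ^ 2 - 2 / 9 * (x ^ 2 + y ^ 2)) by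
      constructor <;> intro h <;> linarith]
  rcases le_or_gt (x - y) (2 / 9) with h | h
  · exact ⟨fun _ => Or.inl h, fun _ => by
      have := Real.sqrt_nonneg ((x - y) ^ 2 - 2 / 9 * (x ^ 2 + y ^ 2)); linarith⟩
  · rw [Real.le_sqrt' (by linarith)]
    constructor
    · intro h3; right; nlinarith
    · rintro (h3 | h3) <;> nlinarith

lemma outerGauge_eq_one {x y : ℝ} (h1 : 3 * y ≤ x) (h2 : y ≤ 3 * x) :
    outerGauge x y = 1 ↔ 2 / 9 ≤ x - y ∧ (x - 1) ^ 2 + (y + 1) ^ 2 = (4 / 3 : ℝ) ^ 2 := by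
  unfold outerGauge
  have hD := outerDisc_nonneg h1 h2
  rw [show 9 / 2 * (x - y - √((x - y) ^ 2 - 2 / 9 * (x ^ 2 + y ^ 2))) = 1 ↔
    √((x - y) ^ 2 - 2 / 9 * (x ^ 2 + y ^ 2)) = x - y - 2 / 9 by
      constructor <;> intro h <;> linarith]
  constructor
  · intro h
    have h3 : 0 ≤ x - y - 2 / 9 := h ▸ Real.sqrt_nonneg _
    rw [Real.sqrt_eq_iff_eq_sq hD h3] at h
    exact ⟨by linarith, by nlinarith⟩
  · rintro ⟨h3, h4⟩
    rw [Real.sqrt_eq_iff_eq_sq hD (by linarith)]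
    nlinarith

/-- The nearest corner is the one with the signs of `x` and `y`, so the four disk conditions fold
into one. -/
lemma forall_corner_iff {x y : ℝ} :
    (∀ s ∈ ({1, -1} : Set ℝ), ∀ t ∈ ({1, -1} : Set ℝ),
      (2 / 3 : ℝ) ^ 2 ≤ (x - s) ^ 2 + (y - t) ^ 2) ↔
    (2 / 3 : ℝ) ^ 2 ≤ (|x| - 1) ^ 2 + (|y| - 1) ^ 2 := by
  have hx : ∀ s ∈ ({1, -1} : Set ℝ), ∀ x : ℝ, (|x| - 1) ^ 2 ≤ (x - s) ^ 2 := by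
    rintro s (rfl | rfl) x <;> cases abs_cases x <;> nlinarith
  have hx' : ∀ x : ℝ, ∃ s ∈ ({1, -1} : Set ℝ), (|x| - 1) ^ 2 = (x - s) ^ 2 := by
    intro x
    rcases abs_cases x with ⟨h, -⟩ | ⟨h, -⟩
    · exact ⟨1, by simp, by rw [h]⟩
    · exact ⟨-1, by simp, by rw [h]; ring⟩
  constructor
  · intro h
    obtain ⟨s, hs, e1⟩ := hx' x
    obtain ⟨t, ht, e2⟩ := hx' y
    rw [e1, e2]; exact h s hs t ht
  · intro h s hs t ht
    exact h.trans (add_le_add (hx s hs x) (hx t ht y))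

lemma octGauge_le_one {x y : ℝ} :
    octGauge x y ≤ 1 ↔ |x| ≤ 1 ∧ |y| ≤ 1 ∧ (2 / 3 : ℝ) ^ 2 ≤ (|x| - 1) ^ 2 + (|y| - 1) ^ 2 := by
  by_cases h1 : |x| ≤ 3 * |y|
  · by_cases h2 : |y| ≤ 3 * |x|
    · rw [octGauge_eq_roadGauge h1 h2, roadGauge_le_one h1 h2]
    · rw [octGauge_eq_right (by linarith)]
      exact ⟨fun h => ⟨by linarith [abs_nonneg x], h, by nlinarith [abs_nonneg x]⟩, fun h => h.2.1⟩
  · rw [octGauge_eq_left (by linarith)]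
    exact ⟨fun h => ⟨h, by linarith [abs_nonneg y], by nlinarith [abs_nonneg y]⟩, fun h => h.1⟩

lemma far_disk_of_le {x y : ℝ} (h1 : 3 * y ≤ x) (h2 : y ≤ 3 * x) (h3 : x ≤ 1) (h4 : -1 ≤ y)
    (h : 2 / 9 ≤ x - y) : (x - 1) ^ 2 + (y + 1) ^ 2 ≤ (4 / 3 : ℝ) ^ 2 := by
  -- Coordinates adapted to the sector: `(x, y) = a (3, 1) + b (-1, -3)`, so the sector is the
  -- quadrant `a, b ≥ 0`.
  obtain ⟨a, ha⟩ : ∃ a, a = (3 * x - y) / 8 := ⟨_, rfl⟩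
  obtain ⟨b, hb⟩ : ∃ b, b = (x - 3 * y) / 8 := ⟨_, rfl⟩
  obtain rfl : x = 3 * a - b := by linarith
  obtain rfl : y = a - 3 * b := by linarith
  have ha : 0 ≤ a := by linarith
  have hb : 0 ≤ b := by linarith
  nlinarith [mul_nonneg ha hb, mul_nonneg ha (sub_nonneg.2 h3), mul_nonneg hb (sub_nonneg.2 h4),
    mul_nonneg (sub_nonneg.2 h3) (sub_nonneg.2 h4), mul_nonneg ha (sub_nonneg.2 h4),
    mul_nonneg hb (sub_nonneg.2 h3), mul_nonneg ha (sub_nonneg.2 h), mul_nonneg hb (sub_nonneg.2 h)]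

lemma one_le_max_abs {x y : ℝ} (h1 : 3 * y ≤ x) (h2 : y ≤ 3 * x)
    (h : 2 / 9 ≤ x - y) (h' : (x - 1) ^ 2 + (y + 1) ^ 2 = (4 / 3 : ℝ) ^ 2) :
    1 ≤ max |x| |y| := by
  by_contra! hc
  rw [max_lt_iff, abs_lt, abs_lt] at hc
  obtain ⟨⟨-, h3⟩, h4, -⟩ := hc
  obtain ⟨a, ha⟩ : ∃ a, a = (3 * x - y) / 8 := ⟨_, rfl⟩
  obtain ⟨b, hb⟩ : ∃ b, b = (x - 3 * y) / 8 := ⟨_, rfl⟩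
  obtain rfl : x = 3 * a - b := by linarith
  obtain rfl : y = a - 3 * b := by linarith
  have ha : 0 ≤ a := by linarith
  have hb : 0 ≤ b := by linarith
  nlinarith [mul_nonneg ha hb, mul_nonneg ha (sub_nonneg.2 h3.le),
    mul_nonneg hb (sub_nonneg.2 h4.le),
    mul_nonneg (sub_nonneg.2 h3.le) (sub_nonneg.2 h4.le), mul_nonneg ha (sub_nonneg.2 h4.le),
    mul_nonneg hb (sub_nonneg.2 h3.le), mul_nonneg ha (sub_nonneg.2 h),
    mul_nonneg hb (sub_nonneg.2 h)]

/-- The disk lies in `x ≥ -1/3`, `y ≤ 1/3`, so it leaves the square only through the right or the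
bottom side. -/
lemma one_le_max_abs_iff {x y : ℝ} (h : (x - 1) ^ 2 + (y + 1) ^ 2 ≤ (4 / 3 : ℝ) ^ 2) :
    1 ≤ max |x| |y| ↔ 1 ≤ x ∨ y ≤ -1 := by
  rw [le_max_iff, le_abs, le_abs]
  constructor
  · rintro ((h1 | h1) | h1 | h1)
    · exact Or.inl h1
    · nlinarith
    · nlinarith
    · right; linarith
  · rintro (h1 | h1)
    · exact Or.inl (Or.inl h1)
    · right; right; linarith

/-- The part of the disk of radius `4/3` about `(1,-1)` outside of the square lies in the outer
sector. -/
lemma outer_sector {x y : ℝ} (h : (x - 1) ^ 2 + (y + 1) ^ 2 ≤ (4 / 3 : ℝ) ^ 2)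
    (h' : 1 ≤ max |x| |y|) : 3 * y ≤ x ∧ y ≤ 3 * x := by
  rw [one_le_max_abs_iff h] at h'
  have hy : y ≤ 1 / 3 := by nlinarith [sq_nonneg (x - 1)]
  have hx : -1 / 3 ≤ x := by nlinarith [sq_nonneg (y + 1)]
  rcases h' with h' | h' <;> constructor <;> linarith

/-- The three alternatives are the octagon, the planar part of the crossbridge and the round disk.
In the outer sector, the part of the disk of radius `4/3` beyond the square is crossbridge or round
disk, while the triangle cut off by `x - y ≤ 2/9` lies in the octagon. Outside the sector only the
octagon occurs. -/
lemma flatGauge_le_one {x y : ℝ} :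
    flatGauge x y ≤ 1 ↔
      (|x| ≤ 1 ∧ |y| ≤ 1 ∧ (2 / 3 : ℝ) ^ 2 ≤ (|x| - 1) ^ 2 + (|y| - 1) ^ 2) ∨
      ((2 / 3 : ℝ) ^ 2 ≤ (x - 1) ^ 2 + (y + 1) ^ 2 ∧
        (x - 1) ^ 2 + (y + 1) ^ 2 ≤ (4 / 3 : ℝ) ^ 2 ∧ 1 ≤ max |x| |y|) ∨
      (x - 1) ^ 2 + (y + 1) ^ 2 ≤ (2 / 3 : ℝ) ^ 2 := by
  by_cases hs : 3 * y ≤ x ∧ y ≤ 3 * x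
  · obtain ⟨h1, h2⟩ := hs
    rw [flatGauge_eq_outerGauge h1 h2, outerGauge_le_one h1 h2]
    constructor
    · rintro (h | h)
      · left
        have hx := abs_le.2 (show -(1 / 3) ≤ x ∧ x ≤ 1 / 3 by constructor <;> linarith)
        have hy := abs_le.2 (show -(1 / 3) ≤ y ∧ y ≤ 1 / 3 by constructor <;> linarith)
        exact ⟨by linarith, by linarith, by nlinarith⟩
      · rcases le_total ((x - 1) ^ 2 + (y + 1) ^ 2) ((2 / 3 : ℝ) ^ 2) with h3 | h3
        · exact Or.inr (Or.inr h3)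
        · by_cases h4 : 1 ≤ max |x| |y|
          · exact Or.inr (Or.inl ⟨h3, h, h4⟩)
          · left
            rw [not_le, max_lt_iff] at h4
            refine ⟨h4.1.le, h4.2.le, ?_⟩
            have hx := abs_lt.1 h4.1
            have hy := abs_lt.1 h4.2
            rcases abs_cases x with ⟨ex, hx'⟩ | ⟨ex, hx'⟩ <;>
              rcases abs_cases y with ⟨ey, hy'⟩ | ⟨ey, hy'⟩ <;> rw [ex, ey] <;> nlinarith
    · rintro (⟨h3, h4, -⟩ | ⟨-, h3, -⟩ | h3)
      · rw [abs_le] at h3 h4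
        rcases le_total (x - y) (2 / 9) with h | h
        · exact Or.inl h
        · exact Or.inr (far_disk_of_le h1 h2 h3.2 h4.1 h)
      · exact Or.inr h3
      · right; norm_num at h3 ⊢; linarith
  · rw [flatGauge_eq_octGauge (by by_contra! h; exact hs ⟨h.1.le, h.2.le⟩), octGauge_le_one]
    refine ⟨Or.inl, ?_⟩
    rintro (h | ⟨-, h, h'⟩ | h)
    · exact h
    · exact (hs (outer_sector h h')).elim
    · have hx : 1 / 3 ≤ x := by nlinarith [sq_nonneg (y + 1)]
      have hy : y ≤ -1 / 3 := by nlinarith [sq_nonneg (x - 1)]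
      refine (hs ⟨?_, ?_⟩).elim <;> linarith

lemma flatGauge_pos {x y : ℝ} (h : ¬ (x = 0 ∧ y = 0)) : 0 < flatGauge x y := by
  have hxy : 0 < |x| + |y| := by
    by_contra! h'
    have hx := abs_nonneg x
    have hy := abs_nonneg y
    exact h ⟨abs_eq_zero.1 (by linarith), abs_eq_zero.1 (by linarith)⟩
  by_cases hs : 3 * y ≤ x ∧ y ≤ 3 * x
  · obtain ⟨h1, h2⟩ := hs
    rw [flatGauge_eq_outerGauge h1 h2]
    unfold outerGauge
    have h3 : 0 < x - y := by
      by_contra! h'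
      exact h ⟨by linarith, by linarith⟩
    have h4 : √((x - y) ^ 2 - 2 / 9 * (x ^ 2 + y ^ 2)) < x - y := by
      rw [Real.sqrt_lt' h3]
      have : 0 < x ^ 2 + y ^ 2 := by
        rw [← sq_abs x, ← sq_abs y]
        nlinarith [abs_nonneg x, abs_nonneg y, sq_nonneg (|x| - |y|)]
      linarith
    linarith
  · rw [flatGauge_eq_octGauge (by by_contra! h; exact hs ⟨h.1.le, h.2.le⟩)]
    unfold octGauge
    split_ifs with h1 h2
    · unfold roadGauge
      have := Real.sqrt_nonneg ((|x| + |y|) ^ 2 - 14 / 9 * (x ^ 2 + y ^ 2))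
      linarith
    · linarith [abs_nonneg x]
    · linarith [abs_nonneg y]

/-! ### Roads and outer bridges as arcs of level curves -/

/-- A road is an arc of the level set of the road gauge, cut out by a sector. -/
lemma road_iff_roadGauge {s t x y : ℝ} (hs : s ∈ ({1, -1} : Set ℝ)) (ht : t ∈ ({1, -1} : Set ℝ)) :
    (|x| ≤ 1 ∧ |y| ≤ 1 ∧ (x - s) ^ 2 + (y - t) ^ 2 = (2 / 3 : ℝ) ^ 2) ↔
      s * x ≤ 3 * (t * y) ∧ t * y ≤ 3 * (s * x) ∧ roadGauge x y = 1 := by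
  -- Multiplying the coordinates by `s` and `t` moves the corner to `(1, 1)`; in its sector both
  -- products are nonnegative and hence equal the absolute values used in `roadGauge`.
  have key : ∀ {a b : ℝ}, a ≤ 3 * b → b ≤ 3 * a → |a| = a ∧ |b| = b := fun h1 h2 =>
    ⟨abs_of_nonneg (by linarith), abs_of_nonneg (by linarith)⟩
  have habs : ∀ {s x : ℝ}, s ∈ ({1, -1} : Set ℝ) → |s * x| = |x| := by
    rintro s x (rfl | rfl) <;> simp
  have hsq : ∀ {s x : ℝ}, s ∈ ({1, -1} : Set ℝ) → (x - s) ^ 2 = (s * x - 1) ^ 2 := by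
    rintro s x (rfl | rfl) <;> ring
  rw [hsq hs, hsq ht]
  constructor
  · rintro ⟨h1, h2, h3⟩
    have h4 := (abs_le.1 ((habs hs).trans_le h1)).2
    have h5 := (abs_le.1 ((habs ht).trans_le h2)).2
    have h6 : s * x ≤ 3 * (t * y) := by nlinarith [sq_nonneg (s * x - 1)]
    have h7 : t * y ≤ 3 * (s * x) := by nlinarith [sq_nonneg (t * y - 1)]
    obtain ⟨h8, h9⟩ := key h6 h7
    rw [habs hs] at h8
    rw [habs ht] at h9
    refine ⟨h6, h7, ?_⟩
    rw [roadGauge_eq_one (by rwa [h8, h9]) (by rwa [h8, h9])]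
    exact ⟨h1, h2, by rwa [h8, h9]⟩
  · rintro ⟨h6, h7, h⟩
    obtain ⟨h8, h9⟩ := key h6 h7
    rw [habs hs] at h8
    rw [habs ht] at h9
    rw [roadGauge_eq_one (by rwa [h8, h9]) (by rwa [h8, h9])] at h
    exact ⟨h.1, h.2.1, by rw [← h8, ← h9]; exact h.2.2⟩

lemma flatGauge_eq_roadGauge {s t x y : ℝ} (hs : s ∈ ({1, -1} : Set ℝ))
    (ht : t ∈ ({1, -1} : Set ℝ)) (hst : ¬ (s = 1 ∧ t = -1))
    (h1 : s * x ≤ 3 * (t * y)) (h2 : t * y ≤ 3 * (s * x)) : flatGauge x y = roadGauge x y := by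
  have habs : ∀ {s x : ℝ}, s ∈ ({1, -1} : Set ℝ) → |s * x| = |x| := by
    rintro s x (rfl | rfl) <;> simp
  have ex : |x| = s * x := by rw [← habs hs, abs_of_nonneg (by linarith)]
  have ey : |y| = t * y := by rw [← habs ht, abs_of_nonneg (by linarith)]
  rw [flatGauge_eq_octGauge, octGauge_eq_roadGauge]
  · rwa [ex, ey]
  · rwa [ex, ey]
  · rcases hs with rfl | rfl <;> rcases ht with rfl | rfl
    · left; linarith
    · exact (hst ⟨rfl, rfl⟩).elim
    · left; linarith
    · right; linarith

lemma road_iff_flatGauge {s t x y : ℝ} (hs : s ∈ ({1, -1} : Set ℝ)) (ht : t ∈ ({1, -1} : Set ℝ))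
    (hst : ¬ (s = 1 ∧ t = -1)) :
    (|x| ≤ 1 ∧ |y| ≤ 1 ∧ (x - s) ^ 2 + (y - t) ^ 2 = (2 / 3 : ℝ) ^ 2) ↔
      s * x ≤ 3 * (t * y) ∧ t * y ≤ 3 * (s * x) ∧ flatGauge x y = 1 := by
  rw [road_iff_roadGauge hs ht]
  constructor
  · rintro ⟨h1, h2, h⟩
    exact ⟨h1, h2, (flatGauge_eq_roadGauge hs ht hst h1 h2).trans h⟩
  · rintro ⟨h1, h2, h⟩
    exact ⟨h1, h2, (flatGauge_eq_roadGauge hs ht hst h1 h2).symm.trans h⟩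

lemma outerBridge_iff_flatGauge {x y : ℝ} :
    ((x - 1) ^ 2 + (y + 1) ^ 2 = (4 / 3 : ℝ) ^ 2 ∧ 1 ≤ max |x| |y|) ↔
      3 * y ≤ x ∧ y ≤ 3 * x ∧ flatGauge x y = 1 := by
  constructor
  · rintro ⟨h1, h2⟩
    obtain ⟨h3, h4⟩ := outer_sector h1.le h2
    refine ⟨h3, h4, ?_⟩
    rw [flatGauge_eq_outerGauge h3 h4, outerGauge_eq_one h3 h4]
    refine ⟨?_, h1⟩
    rcases (one_le_max_abs_iff h1.le).1 h2 with h | h <;> linarith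
  · rintro ⟨h3, h4, h⟩
    rw [flatGauge_eq_outerGauge h3 h4, outerGauge_eq_one h3 h4] at h
    exact ⟨h.2, one_le_max_abs h3 h4 h.1 h.2⟩

/-! ### The flat piece is a rectangle -/

/-- Gauge of the convex pentagon with vertices `(±1,2)`, `(±2,1)`, `(0,-1)`. -/
def pentGauge (u v : ℝ) : ℝ := max (max (v / 2) ((|u| + v) / 3)) (|u| - v)

lemma pentGauge_le {u v r : ℝ} :
    pentGauge u v ≤ r ↔ v ≤ 2 * r ∧ |u| + v ≤ 3 * r ∧ |u| - v ≤ r := by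
  unfold pentGauge
  rw [max_le_iff, max_le_iff, and_assoc, div_le_iff₀ (by norm_num), div_le_iff₀ (by norm_num),
    mul_comm r, mul_comm r]

lemma pentGauge_bounds (u v : ℝ) :
    v ≤ 2 * pentGauge u v ∧ |u| + v ≤ 3 * pentGauge u v ∧ |u| - v ≤ pentGauge u v :=
  pentGauge_le.1 le_rfl

lemma pentGauge_smul {t : ℝ} (ht : 0 ≤ t) (u v : ℝ) :
    pentGauge (t * u) (t * v) = t * pentGauge u v := by
  unfold pentGauge
  rw [mul_max_of_nonneg _ _ ht, mul_max_of_nonneg _ _ ht, abs_mul, abs_of_nonneg ht]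
  ring_nf

lemma abs_le_pentGauge (u v : ℝ) : |u| ≤ 2 * pentGauge u v ∧ |v| ≤ 2 * pentGauge u v := by
  obtain ⟨h1, h2, h3⟩ := pentGauge_bounds u v
  have := abs_nonneg u
  refine ⟨by linarith, abs_le.2 ⟨by linarith, h1⟩⟩

lemma pentGauge_nonneg (u v : ℝ) : 0 ≤ pentGauge u v := by
  have := (abs_le_pentGauge u v).1
  have := abs_nonneg u
  linarith

lemma pentGauge_pos {u v : ℝ} (h : ¬ (u = 0 ∧ v = 0)) : 0 < pentGauge u v := by
  obtain ⟨h1, h2⟩ := abs_le_pentGauge u v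
  by_contra! h'
  exact h ⟨abs_nonpos_iff.1 (by linarith), abs_nonpos_iff.1 (by linarith)⟩

lemma continuous_pentGauge : Continuous fun p : ℝ × ℝ => pentGauge p.1 p.2 := by
  unfold pentGauge; fun_prop

/-- First coordinate of the linear change of variables used for the flat piece. -/
def xi (x y : ℝ) : ℝ := 3 / 2 * (x + y)

/-- Second coordinate of the linear change of variables used for the flat piece. -/
def eta (x y : ℝ) : ℝ := 3 / 2 * (y - x)

/-- The factor by which the flat piece is stretched radially to become the pentagon. -/
def stretch (x y : ℝ) : ℝ := flatGauge x y / pentGauge (xi x y) (eta x y)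

lemma xi_smul (t x y : ℝ) : xi (t * x) (t * y) = t * xi x y := by unfold xi; ring

lemma eta_smul (t x y : ℝ) : eta (t * x) (t * y) = t * eta x y := by unfold eta; ring

lemma xi_eta_eq_zero {x y : ℝ} : (xi x y = 0 ∧ eta x y = 0) ↔ x = 0 ∧ y = 0 := by
  unfold xi eta; constructor <;> rintro ⟨h1, h2⟩ <;> constructor <;> linarith

lemma stretch_pos {x y : ℝ} (h : ¬ (x = 0 ∧ y = 0)) : 0 < stretch x y :=
  div_pos (flatGauge_pos h) (pentGauge_pos (xi_eta_eq_zero.not.2 h))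

/-- The radial map from the flat piece to the pentagon. -/
def toPent (p : ℝ × ℝ) : ℝ × ℝ :=
  (stretch p.1 p.2 * xi p.1 p.2, stretch p.1 p.2 * eta p.1 p.2)

lemma pentGauge_toPent (p : ℝ × ℝ) :
    pentGauge (toPent p).1 (toPent p).2 = flatGauge p.1 p.2 := by
  by_cases h : p.1 = 0 ∧ p.2 = 0
  · obtain ⟨h1, h2⟩ := h
    simp [toPent, h1, h2, stretch, pentGauge]
  · unfold toPent
    dsimp only
    rw [pentGauge_smul (stretch_pos h).le]
    unfold stretch
    exact div_mul_cancel₀ _ (pentGauge_pos (xi_eta_eq_zero.not.2 h)).ne'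

/-- The inverse of the radial map. -/
def ofPent (q : ℝ × ℝ) : ℝ × ℝ :=
  let x := (q.1 - q.2) / 3
  let y := (q.1 + q.2) / 3
  (pentGauge q.1 q.2 / flatGauge x y * x, pentGauge q.1 q.2 / flatGauge x y * y)

lemma ofPent_toPent (p : ℝ × ℝ) : ofPent (toPent p) = p := by
  obtain ⟨x, y⟩ := p
  by_cases h : x = 0 ∧ y = 0
  · obtain ⟨rfl, rfl⟩ := h
    simp [ofPent, toPent, xi, eta]
  · have h1 := stretch_pos h
    have h2 := flatGauge_pos h
    unfold ofPent
    rw [pentGauge_toPent]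
    have ex : ((toPent (x, y)).1 - (toPent (x, y)).2) / 3 = stretch x y * x := by
      unfold toPent xi eta; ring
    have ey : ((toPent (x, y)).1 + (toPent (x, y)).2) / 3 = stretch x y * y := by
      unfold toPent xi eta; ring
    simp only [ex, ey, flatGauge_smul h1.le]
    ext <;> field_simp

lemma toPent_ofPent (q : ℝ × ℝ) : toPent (ofPent q) = q := by
  obtain ⟨u, v⟩ := q
  by_cases h : u = 0 ∧ v = 0
  · obtain ⟨rfl, rfl⟩ := h
    simp [ofPent, toPent, xi, eta]
  · have hx : xi ((u - v) / 3) ((u + v) / 3) = u := by unfold xi; ring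
    have hy : eta ((u - v) / 3) ((u + v) / 3) = v := by unfold eta; ring
    have h0 : ¬ ((u - v) / 3 = 0 ∧ (u + v) / 3 = 0) := by rw [← xi_eta_eq_zero, hx, hy]; exact h
    have h1 := pentGauge_pos h
    have h2 := flatGauge_pos h0
    have h3 : 0 < pentGauge u v / flatGauge ((u - v) / 3) ((u + v) / 3) := div_pos h1 h2
    unfold toPent ofPent stretch
    simp only [xi_smul, eta_smul, flatGauge_smul h3.le, pentGauge_smul h3.le, hx, hy]
    ext <;> field_simp

/-- Needed at the origin, where the stretching factor has no limit. The gauge tends to `0` there,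
and the remaining quotient, homogeneous of degree `0`, stays bounded. -/
lemma continuous_mul_of_bounded {X : Type*} [TopologicalSpace X] {g h : X → ℝ} {C : ℝ}
    (hg : Continuous g) (hh : ∀ x, g x ≠ 0 → ContinuousAt h x) (hb : ∀ x, |h x| ≤ C) :
    Continuous fun x => g x * h x := by
  rw [continuous_iff_continuousAt]
  intro x
  by_cases h0 : g x = 0
  · have h1 : Filter.Tendsto (fun y => |g y| * C) (nhds x) (nhds 0) := by
      have : ContinuousAt (fun y => |g y| * C) x := by fun_prop
      simpa [ContinuousAt, h0] using this
    rw [ContinuousAt, show g x * h x = 0 by rw [h0, zero_mul]]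
    refine squeeze_zero_norm (fun y => ?_) h1
    rw [Real.norm_eq_abs, abs_mul]
    exact mul_le_mul_of_nonneg_left (hb y) (abs_nonneg _)
  · exact hg.continuousAt.mul (hh x h0)

lemma continuous_toPent : Continuous toPent := by
  have key : ∀ f : ℝ × ℝ → ℝ, Continuous f →
      (∀ p, |f p| ≤ 2 * pentGauge (xi p.1 p.2) (eta p.1 p.2)) →
      Continuous fun p : ℝ × ℝ => stretch p.1 p.2 * f p := by
    intro f hf hb
    have hp : Continuous fun p : ℝ × ℝ => pentGauge (xi p.1 p.2) (eta p.1 p.2) :=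
      continuous_pentGauge.comp (f := fun p : ℝ × ℝ => (xi p.1 p.2, eta p.1 p.2))
        (by unfold xi eta; fun_prop)
    have := continuous_mul_of_bounded (g := fun p : ℝ × ℝ => flatGauge p.1 p.2)
      (h := fun p => f p / pentGauge (xi p.1 p.2) (eta p.1 p.2)) (C := 2) continuous_flatGauge
      ?_ ?_
    · refine this.congr fun p => ?_
      unfold stretch
      ring
    · intro p h0
      refine hf.continuousAt.div hp.continuousAt (pentGauge_pos (xi_eta_eq_zero.not.2 ?_)).ne'
      rintro ⟨h1, h2⟩
      exact h0 (by rw [h1, h2, flatGauge_zero])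
    · intro p
      rw [abs_div, abs_of_nonneg (pentGauge_nonneg _ _)]
      exact div_le_of_le_mul₀ (pentGauge_nonneg _ _) (by norm_num) (hb p)
  exact (key _ (by unfold xi; fun_prop) fun p => (abs_le_pentGauge _ _).1).prodMk
    (key _ (by unfold eta; fun_prop) fun p => (abs_le_pentGauge _ _).2)

/-! ### From the pentagon to the rectangle -/

/-- Coordinates on the pentagon: slope and normalized depth as seen from the point `(0,3)`. -/
def pentCoord (q : ℝ × ℝ) : ℝ × ℝ :=
  (q.1 / (3 - q.2), 1 - 2 * (2 - q.2) * (1 + |q.1 / (3 - q.2)|) / (3 - |q.1 / (3 - q.2)|))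

/-- The inverse of `pentCoord`. -/
def pentCoordInv (w : ℝ × ℝ) : ℝ × ℝ :=
  let d := 1 + (1 - w.2) * (3 - |w.1|) / (2 * (1 + |w.1|))
  (w.1 * d, 3 - d)

/-- The slanted edges `|u| + v = 3` lie on lines through `(0, 3)` and have slope `±1`. The line of
slope `m` enters the pentagon at depth `3 - v = 1` on the side `v = 2` and leaves it at depth `4 /
(1 + |m|)` on `|u| - v = 1`; `pentCoord` rescales this segment to `[-1, 1]`. -/
lemma pentCoord_slope {q : ℝ × ℝ} (h : pentGauge q.1 q.2 ≤ 1) :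
    0 < 3 - q.2 ∧ |q.1 / (3 - q.2)| ≤ 1 := by
  obtain ⟨h1, h2, h3⟩ := pentGauge_le.1 h
  have h4 : 0 < 3 - q.2 := by linarith
  refine ⟨h4, ?_⟩
  rw [abs_div, abs_of_pos h4, div_le_one h4]
  linarith

lemma continuousOn_pentCoord : ContinuousOn pentCoord {q | pentGauge q.1 q.2 ≤ 1} := by
  have h1 : ContinuousOn (fun q : ℝ × ℝ => q.1 / (3 - q.2)) {q | pentGauge q.1 q.2 ≤ 1} :=
    ContinuousOn.div (by fun_prop) (by fun_prop) fun q hq => (pentCoord_slope hq).1.ne'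
  unfold pentCoord
  refine h1.prodMk (continuousOn_const.sub (ContinuousOn.div ?_ ?_ fun q hq => ?_))
  · exact ContinuousOn.mul (by fun_prop) (continuousOn_const.add h1.abs)
  · exact continuousOn_const.sub h1.abs
  · have := (pentCoord_slope hq).2
    linarith

lemma pentCoordInv_pentCoord {q : ℝ × ℝ} (h : pentGauge q.1 q.2 ≤ 1) :
    pentCoordInv (pentCoord q) = q := by
  obtain ⟨h1, h2⟩ := pentCoord_slope h
  have h3 := abs_nonneg (q.1 / (3 - q.2))
  have hd : 1 + (1 - (pentCoord q).2) * (3 - |(pentCoord q).1|) / (2 * (1 + |(pentCoord q).1|)) =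
      3 - q.2 := by
    unfold pentCoord
    generalize |q.1 / (3 - q.2)| = a at *
    have : (3 - a) ≠ 0 := by linarith
    have : (1 + a) ≠ 0 := by linarith
    field_simp
    ring
  unfold pentCoordInv
  simp only [hd]
  ext
  · exact div_mul_cancel₀ _ h1.ne'
  · ring

lemma pentCoord_pentCoordInv {w : ℝ × ℝ} (h1 : |w.1| ≤ 1) (h2 : |w.2| ≤ 1) :
    pentCoord (pentCoordInv w) = w ∧
      pentGauge (pentCoordInv w).1 (pentCoordInv w).2 ≤ 1 := by
  obtain ⟨m, t⟩ := w
  dsimp only at h1 h2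
  rw [abs_le] at h2
  have h3 := abs_nonneg m
  have hd1 : 0 ≤ (1 - t) * (3 - |m|) / (2 * (1 + |m|)) :=
    div_nonneg (mul_nonneg (by linarith) (by linarith)) (by linarith)
  have hd2 : (1 - t) * (3 - |m|) / (2 * (1 + |m|)) * (1 + |m|) ≤ 3 - |m| := by
    rw [div_mul_eq_mul_div, div_le_iff₀ (by linarith)]
    nlinarith [mul_nonneg (show 0 ≤ 3 - |m| by linarith) (show 0 ≤ 1 + |m| by linarith)]
  have hd3 : t = 1 - 2 * ((1 - t) * (3 - |m|) / (2 * (1 + |m|))) * (1 + |m|) / (3 - |m|) := by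
    have : (3 - |m|) ≠ 0 := by linarith
    have : (1 + |m|) ≠ 0 := by linarith
    field_simp
    ring
  unfold pentCoordInv
  dsimp only
  generalize (1 - t) * (3 - |m|) / (2 * (1 + |m|)) = d at *
  constructor
  · have hm : m * (1 + d) / (3 - (3 - (1 + d))) = m := by
      rw [sub_sub_cancel, mul_div_assoc, div_self (by linarith), mul_one]
    unfold pentCoord
    simp only [hm]
    ext
    · rfl
    · dsimp only
      rw [hd3]; ring
  · rw [pentGauge_le, abs_mul, abs_of_nonneg (show 0 ≤ 1 + d by linarith)]
    refine ⟨by linarith, by nlinarith, by nlinarith⟩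

lemma pentCoord_mem {q : ℝ × ℝ} (h : pentGauge q.1 q.2 ≤ 1) :
    |(pentCoord q).1| ≤ 1 ∧ |(pentCoord q).2| ≤ 1 := by
  obtain ⟨h4, h5⟩ := pentCoord_slope h
  obtain ⟨h1, h2, h3⟩ := pentGauge_le.1 h
  refine ⟨h5, ?_⟩
  unfold pentCoord
  have h6 := abs_nonneg (q.1 / (3 - q.2))
  have h7 : |q.1| = |q.1 / (3 - q.2)| * (3 - q.2) := by
    rw [abs_div, abs_of_pos h4, div_mul_cancel₀ _ h4.ne']
  dsimp only
  generalize |q.1 / (3 - q.2)| = a at *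
  have h8 : 0 ≤ 2 * (2 - q.2) * (1 + a) / (3 - a) :=
    div_nonneg (mul_nonneg (by linarith) (by linarith)) (by linarith)
  have h9 : 2 * (2 - q.2) * (1 + a) / (3 - a) ≤ 2 := by
    rw [div_le_iff₀ (by linarith)]; nlinarith
  rw [abs_le]; constructor <;> linarith

lemma pentCoord_snd_eq {q : ℝ × ℝ} (h : pentGauge q.1 q.2 ≤ 1) :
    |(pentCoord q).2| = 1 ↔ q.2 = 2 ∨ |q.1| - q.2 = 1 := by
  obtain ⟨h4, h5⟩ := pentCoord_slope h
  unfold pentCoord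
  have h6 := abs_nonneg (q.1 / (3 - q.2))
  have h7 : |q.1| = |q.1 / (3 - q.2)| * (3 - q.2) := by
    rw [abs_div, abs_of_pos h4, div_mul_cancel₀ _ h4.ne']
  dsimp only
  rw [h7]
  generalize |q.1 / (3 - q.2)| = a at *
  have h8 : (0 : ℝ) < 3 - a := by linarith
  rw [abs_eq (by norm_num)]
  refine or_congr ?_ ?_
  · rw [sub_eq_self, div_eq_zero_iff]
    constructor
    · rintro (h | h)
      · rcases mul_eq_zero.1 h with h | h <;> linarith
      · linarith
    · intro h; left; rw [h]; ring
  · rw [show (1 - 2 * (2 - q.2) * (1 + a) / (3 - a) = -1 ↔ 2 * (2 - q.2) * (1 + a) / (3 - a) = 2)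
      by constructor <;> intro h <;> linarith, div_eq_iff h8.ne']
    constructor <;> intro h <;> nlinarith

/-- Coordinates identifying the flat piece with the rectangle `[-1,1] × [-1,1]`. -/
def flatCoord (p : ℝ × ℝ) : ℝ × ℝ := pentCoord (toPent p)

lemma continuousOn_flatCoord : ContinuousOn flatCoord {p | flatGauge p.1 p.2 ≤ 1} :=
  continuousOn_pentCoord.comp continuous_toPent.continuousOn fun p hp =>
    (pentGauge_toPent p).trans_le hp

lemma flatCoord_mem {p : ℝ × ℝ} (h : flatGauge p.1 p.2 ≤ 1) :
    |(flatCoord p).1| ≤ 1 ∧ |(flatCoord p).2| ≤ 1 :=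
  pentCoord_mem ((pentGauge_toPent p).trans_le h)

lemma flatCoord_injOn : Set.InjOn flatCoord {p | flatGauge p.1 p.2 ≤ 1} := by
  intro p hp q hq h
  have h1 := pentCoordInv_pentCoord ((pentGauge_toPent p).trans_le hp)
  have h2 := pentCoordInv_pentCoord ((pentGauge_toPent q).trans_le hq)
  unfold flatCoord at h
  rw [h, h2] at h1
  rw [← ofPent_toPent p, ← h1, ofPent_toPent]

lemma flatCoord_surj {w : ℝ × ℝ} (h1 : |w.1| ≤ 1) (h2 : |w.2| ≤ 1) :
    ∃ p : ℝ × ℝ, flatGauge p.1 p.2 ≤ 1 ∧ flatCoord p = w := by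
  obtain ⟨h3, h4⟩ := pentCoord_pentCoordInv h1 h2
  refine ⟨ofPent (pentCoordInv w), ?_, ?_⟩
  · rwa [← pentGauge_toPent, toPent_ofPent]
  · rw [flatCoord, toPent_ofPent, h3]

/-- On a straight edge both gauges are `1`, so nothing is stretched and `toPent` is the linear map
`(xi, eta)`. The factor `3/2` there is chosen so that straight edges become slanted edges of the
pentagon. -/
lemma flatCoord_left {y : ℝ} (hy : |y| ≤ 1 / 3) :
    flatCoord (-1, y) = (-1, 3 * y) ∧ flatGauge (-1) y = 1 := by
  have hy' := abs_le.1 hy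
  have hg : flatGauge (-1) y = 1 := by
    rw [flatGauge_eq_octGauge (by by_contra! h; linarith), octGauge_eq_left] <;> norm_num
    linarith
  have hx : xi (-1) y = 3 / 2 * (y - 1) := by unfold xi; ring
  have he : eta (-1) y = 3 / 2 * (y + 1) := by unfold eta; ring
  have hp : pentGauge (xi (-1) y) (eta (-1) y) = 1 := by
    have habs : |3 / 2 * (y - 1)| = 3 / 2 * (1 - y) := by
      rw [abs_of_nonpos (by linarith)]; ring
    rw [hx, he]
    apply le_antisymm
    · rw [pentGauge_le, habs]; refine ⟨?_, ?_, ?_⟩ <;> linarith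
    · have := (pentGauge_bounds (3 / 2 * (y - 1)) (3 / 2 * (y + 1))).2.1
      rw [habs] at this; linarith
  have ht : toPent (-1, y) = (3 / 2 * (y - 1), 3 / 2 * (y + 1)) := by
    simp only [toPent, stretch]; rw [hg, hp, hx, he]; norm_num
  refine ⟨?_, hg⟩
  unfold flatCoord pentCoord
  have hm : 3 / 2 * (y - 1) / (3 - 3 / 2 * (y + 1)) = -1 := by
    rw [div_eq_iff (by linarith)]; ring
  simp only [ht, hm]
  ext <;> norm_num
  ring

lemma flatCoord_top {x : ℝ} (hx : |x| ≤ 1 / 3) :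
    flatCoord (x, 1) = (1, -(3 * x)) ∧ flatGauge x 1 = 1 := by
  have hx' := abs_le.1 hx
  have hg : flatGauge x 1 = 1 := by
    rw [flatGauge_eq_octGauge (by by_contra! h; linarith), octGauge_eq_right] <;> norm_num
    linarith
  have h1 : xi x 1 = 3 / 2 * (1 + x) := by unfold xi; ring
  have he : eta x 1 = 3 / 2 * (1 - x) := by unfold eta; ring
  have hp : pentGauge (xi x 1) (eta x 1) = 1 := by
    have habs : |3 / 2 * (1 + x)| = 3 / 2 * (1 + x) := abs_of_nonneg (by linarith)
    rw [h1, he]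
    apply le_antisymm
    · rw [pentGauge_le, habs]; refine ⟨?_, ?_, ?_⟩ <;> linarith
    · have := (pentGauge_bounds (3 / 2 * (1 + x)) (3 / 2 * (1 - x))).2.1
      rw [habs] at this; linarith
  have ht : toPent (x, 1) = (3 / 2 * (1 + x), 3 / 2 * (1 - x)) := by
    simp only [toPent, stretch]; rw [hg, hp, h1, he]; norm_num
  refine ⟨?_, hg⟩
  unfold flatCoord pentCoord
  have hm : 3 / 2 * (1 + x) / (3 - 3 / 2 * (1 - x)) = 1 := by
    rw [div_eq_iff (by linarith)]; ring
  simp only [ht, hm]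
  ext <;> norm_num
  ring

/-- The sides `t = ±1` of the rectangle are the curved sides of the flat piece. -/
lemma flatCoord_snd_eq {x y : ℝ} (h : flatGauge x y ≤ 1) :
    |(flatCoord (x, y)).2| = 1 ↔
      flatGauge x y = 1 ∧ (2 * |xi x y| ≤ eta x y ∨ 2 * eta x y ≤ |xi x y|) := by
  have hg := pentGauge_toPent (x, y)
  dsimp only at hg
  unfold flatCoord
  rw [pentCoord_snd_eq (hg.trans_le h)]
  by_cases h0 : x = 0 ∧ y = 0
  · obtain ⟨rfl, rfl⟩ := h0
    simp [toPent, stretch]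
  have hs := stretch_pos h0
  obtain ⟨h1, h2, h3⟩ := pentGauge_le.1 (hg.trans_le h)
  obtain ⟨b1, b2, b3⟩ := pentGauge_bounds (toPent (x, y)).1 (toPent (x, y)).2
  have ex : |(toPent (x, y)).1| = stretch x y * |xi x y| := by
    unfold toPent; rw [abs_mul, abs_of_pos hs]
  have ey : (toPent (x, y)).2 = stretch x y * eta x y := rfl
  -- Sector conditions are homogeneous, so the radial stretching does not affect them. In the
  -- pentagon they decide which of the linear forms in `pentGauge` attains the maximum.
  have e1 : 2 * |xi x y| ≤ eta x y ↔ 2 * |(toPent (x, y)).1| ≤ (toPent (x, y)).2 := by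
    rw [ex, ey, mul_left_comm]; exact (mul_le_mul_iff_right₀ hs).symm
  have e2 : 2 * eta x y ≤ |xi x y| ↔ 2 * (toPent (x, y)).2 ≤ |(toPent (x, y)).1| := by
    rw [ex, ey, mul_left_comm]; exact (mul_le_mul_iff_right₀ hs).symm
  rw [e1, e2]
  have hdef : pentGauge (toPent (x, y)).1 (toPent (x, y)).2 =
    max (max ((toPent (x, y)).2 / 2) ((|(toPent (x, y)).1| + (toPent (x, y)).2) / 3))
      (|(toPent (x, y)).1| - (toPent (x, y)).2) := rfl
  rw [hg] at b1 b2 b3 hdef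
  have ha := abs_nonneg (toPent (x, y)).1
  generalize |(toPent (x, y)).1| = a at *
  generalize (toPent (x, y)).2 = b at *
  constructor
  · rintro (h4 | h4)
    · exact ⟨by linarith, Or.inl (by linarith)⟩
    · exact ⟨by linarith, Or.inr (by linarith)⟩
  · rintro ⟨h4, h5 | h5⟩
    · left
      rw [h4, max_eq_left (by rw [max_eq_left] <;> linarith), max_eq_left (by linarith)] at hdef
      linarith
    · right
      rw [h4, max_eq_right] at hdef
      · linarith
      · apply max_le <;> linarith

/-! ### The three-quarter circle -/

/-- First coordinate of the rational parametrization of the unit circle. -/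
def arcU (τ : ℝ) : ℝ := (-3 * τ ^ 2 + 8 * τ + 3) / (5 * (τ ^ 2 + 1))

/-- Second coordinate of the rational parametrization of the unit circle. -/
def arcV (τ : ℝ) : ℝ := (4 * τ ^ 2 + 6 * τ - 4) / (5 * (τ ^ 2 + 1))

/-- The parameter of a point of the unit circle about `(1,-1)`. -/
def arcParam (x y : ℝ) : ℝ := (4 * (x - 1) + 3 * (y + 1)) / (5 + 3 * (x - 1) - 4 * (y + 1))

lemma continuous_arcU : Continuous arcU := by
  unfold arcU
  exact Continuous.div (by fun_prop) (by fun_prop) fun τ => by positivity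

lemma continuous_arcV : Continuous arcV := by
  unfold arcV
  exact Continuous.div (by fun_prop) (by fun_prop) fun τ => by positivity

lemma arc_circle (τ : ℝ) : arcU τ ^ 2 + arcV τ ^ 2 = 1 := by
  unfold arcU arcV
  have : τ ^ 2 + 1 ≠ 0 := by positivity
  field_simp
  ring

/-- `arcParam` is stereographic projection from `(-3/5, 4/5)`, relative to the centre of the circle.
This point lies in the missing quarter, so the denominator is positive on the arc that is used. The
parameter runs from `3` at `(1, 0)` to `-2` at `(0, -1)`. -/
lemma arcParam_arc (τ : ℝ) : arcParam (1 + arcU τ) (-1 + arcV τ) = τ := by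
  have h : (0 : ℝ) < τ ^ 2 + 1 := by positivity
  have hd : 5 + 3 * (1 + arcU τ - 1) - 4 * (-1 + arcV τ + 1) = 10 / (τ ^ 2 + 1) := by
    unfold arcU arcV; field_simp; ring
  have hn : 4 * (1 + arcU τ - 1) + 3 * (-1 + arcV τ + 1) = 10 * τ / (τ ^ 2 + 1) := by
    unfold arcU arcV; field_simp; ring
  unfold arcParam
  rw [hd, hn]
  field_simp

lemma arcParam_denom_pos {x y : ℝ} (h : (x - 1) ^ 2 + (y + 1) ^ 2 = 1) (h' : 1 ≤ x ∨ y ≤ -1) :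
    0 < 5 + 3 * (x - 1) - 4 * (y + 1) := by
  rcases h' with h' | h' <;> nlinarith [sq_nonneg (x - 1), sq_nonneg (y + 1)]

lemma arc_arcParam {x y : ℝ} (h : (x - 1) ^ 2 + (y + 1) ^ 2 = 1) (h' : 1 ≤ x ∨ y ≤ -1) :
    1 + arcU (arcParam x y) = x ∧ -1 + arcV (arcParam x y) = y := by
  have hd := arcParam_denom_pos h h'
  obtain ⟨u, rfl⟩ : ∃ u, x = 1 + u := ⟨x - 1, by ring⟩
  obtain ⟨v, rfl⟩ : ∃ v, y = -1 + v := ⟨y + 1, by ring⟩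
  have h1 : u ^ 2 + v ^ 2 = 1 := by nlinarith
  have hd : 0 < 5 + 3 * u - 4 * v := by linarith
  have ht : arcParam (1 + u) (-1 + v) = (4 * u + 3 * v) / (5 + 3 * u - 4 * v) := by
    unfold arcParam; ring_nf
  -- With `N = 4u + 3v` and `D = 5 + 3u - 4v`, the unit circle becomes `N² + (D - 5)² = 25`.
  have hN : (4 * u + 3 * v) ^ 2 = 10 * (5 + 3 * u - 4 * v) - (5 + 3 * u - 4 * v) ^ 2 := by
    linear_combination 25 * h1
  have hu : u = (4 * (4 * u + 3 * v) + 3 * (5 + 3 * u - 4 * v) - 15) / 25 := by ring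
  have hv : v = (3 * (4 * u + 3 * v) - 4 * (5 + 3 * u - 4 * v) + 20) / 25 := by ring
  rw [ht]
  generalize 4 * u + 3 * v = N at *
  generalize 5 + 3 * u - 4 * v = D at *
  have hs : (N / D) ^ 2 = 10 / D - 1 := by
    rw [div_pow, hN]; field_simp
  unfold arcU arcV
  rw [hs, hu, hv]
  constructor <;> field_simp <;> ring

lemma arc_outside_iff (τ : ℝ) : (1 ≤ 1 + arcU τ ∨ -1 + arcV τ ≤ -1) ↔ -2 ≤ τ ∧ τ ≤ 3 := by
  have h : (0 : ℝ) < 5 * (τ ^ 2 + 1) := by positivity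
  have h1 : 1 ≤ 1 + arcU τ ↔ 0 ≤ -3 * τ ^ 2 + 8 * τ + 3 := by
    unfold arcU; rw [le_add_iff_nonneg_right, div_nonneg_iff]
    constructor
    · rintro (h' | h') <;> linarith
    · intro h'; left; exact ⟨h', h.le⟩
  have h2 : -1 + arcV τ ≤ -1 ↔ 4 * τ ^ 2 + 6 * τ - 4 ≤ 0 := by
    unfold arcV; rw [add_le_iff_nonpos_right, div_nonpos_iff]
    constructor
    · rintro (h' | h') <;> linarith
    · intro h'; right; exact ⟨h', h.le⟩
  rw [h1, h2]
  constructor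
  · rintro (h3 | h3) <;> constructor <;> nlinarith
  · rintro ⟨h3, h4⟩
    -- The first quadratic is nonnegative on `[-1/3, 3]`, the second nonpositive on `[-2, 1/2]`; the
    -- intervals overlap around `0`.
    rcases le_total τ 0 with h5 | h5
    · right; nlinarith
    · left; nlinarith

lemma arcParam_mem {x y : ℝ} (h : (x - 1) ^ 2 + (y + 1) ^ 2 = 1) (h' : 1 ≤ x ∨ y ≤ -1) :
    -2 ≤ arcParam x y ∧ arcParam x y ≤ 3 := by
  rw [← arc_outside_iff]
  obtain ⟨h1, h2⟩ := arc_arcParam h h'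
  rwa [h1, h2]

@[simp] lemma arcU_three : arcU 3 = 0 := by norm_num [arcU]
@[simp] lemma arcV_three : arcV 3 = 1 := by norm_num [arcV]
@[simp] lemma arcU_neg_two : arcU (-2) = -1 := by norm_num [arcU]
@[simp] lemma arcV_neg_two : arcV (-2) = 0 := by norm_num [arcV]

/-! ### Frames -/

/-- The coordinates of a point, read off cyclically from the `k`-th one on. -/
def frame (k : Fin 3) (p : R3) : R3 := !₂[p k, p (k + 1), p (k + 2)]

lemma mem_cycled {k : Fin 3} {A : Set R3} {p : R3} : p ∈ cycled k A ↔ frame k p ∈ A := Iff.rfl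

@[simp] lemma frame_zero_apply (k : Fin 3) (p : R3) : frame k p 0 = p k := rfl
@[simp] lemma frame_one_apply (k : Fin 3) (p : R3) : frame k p 1 = p (k + 1) := rfl
@[simp] lemma frame_two_apply (k : Fin 3) (p : R3) : frame k p 2 = p (k + 2) := rfl

lemma frame_apply (k j : Fin 3) (p : R3) : frame k p j = p (k + j) := by
  fin_cases j <;> simp

lemma frame_frame (k j : Fin 3) (p : R3) : frame j (frame k p) = frame (k + j) p := by
  ext i; simp only [frame_apply, add_assoc]

@[simp] lemma frame_zero (p : R3) : frame 0 p = p := by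
  ext i; rw [frame_apply, zero_add]

@[simp] lemma frame_neg_frame (k : Fin 3) (p : R3) : frame (-k) (frame k p) = p := by
  rw [frame_frame, add_neg_cancel, frame_zero]

@[simp] lemma frame_frame_neg (k : Fin 3) (p : R3) : frame k (frame (-k) p) = p := by
  rw [frame_frame, neg_add_cancel, frame_zero]

lemma frame_injective (k : Fin 3) : Function.Injective (frame k) := fun p q h => by
  rw [← frame_neg_frame k p, h, frame_neg_frame]

lemma continuous_frame (k : Fin 3) : Continuous (frame k) := by
  have : frame k = fun p => WithLp.toLp 2 (fun j => p (k + j)) := by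
    ext p j; rw [frame_apply]
  rw [this]
  fun_prop

lemma ext3 {p q : R3} (h0 : p 0 = q 0) (h1 : p 1 = q 1) (h2 : p 2 = q 2) : p = q := by
  ext i; fin_cases i <;> assumption

/-! ### The pieces in coordinates -/

lemma mem_octagon {p : R3} : p ∈ octagon ↔ p 2 = 0 ∧ |p 0| ≤ 1 ∧ |p 1| ≤ 1 ∧
    (2 / 3 : ℝ) ^ 2 ≤ (|p 0| - 1) ^ 2 + (|p 1| - 1) ^ 2 := by
  rw [← forall_corner_iff]
  unfold octagon
  exact ⟨fun ⟨a, b, c, d⟩ => ⟨c, a, b, d⟩, fun ⟨c, a, b, d⟩ => ⟨a, b, c, d⟩⟩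

lemma mem_flatPiece {p : R3} : p ∈ flatPiece ↔ p 2 = 0 ∧ flatGauge (p 0) (p 1) ≤ 1 := by
  rw [flatGauge_le_one]
  unfold flatPiece
  rw [Set.mem_union, Set.mem_union, mem_octagon]
  simp only [annulusA, outside, roundDisk, Set.mem_inter_iff, Set.mem_ofPred_eq]
  tauto

lemma mem_bandPiece {p : R3} : p ∈ bandPiece ↔
    |p 2| ≤ 1 / 3 ∧ (p 0 - 1) ^ 2 + (p 1 + 1) ^ 2 = 1 ∧ (1 ≤ p 0 ∨ p 1 ≤ -1) := by
  unfold bandPiece annulusB outside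
  simp only [Set.mem_inter_iff, Set.mem_ofPred_eq, and_assoc]
  refine and_congr_right fun _ => and_congr_right fun h => ?_
  exact one_le_max_abs_iff (by rw [h]; norm_num)

lemma mem_road {s t : ℝ} (hs : s ∈ ({1, -1} : Set ℝ)) (ht : t ∈ ({1, -1} : Set ℝ))
    (hst : ¬ (s = 1 ∧ t = -1)) {p : R3} : p ∈ road s t ↔ p 2 = 0 ∧
      s * p 0 ≤ 3 * (t * p 1) ∧ t * p 1 ≤ 3 * (s * p 0) ∧ flatGauge (p 0) (p 1) = 1 := by
  rw [← road_iff_flatGauge hs ht hst]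
  unfold road
  simp only [Set.mem_ofPred_eq]
  tauto

lemma mem_outerBridge {p : R3} : p ∈ outerBridge ↔ p 2 = 0 ∧
      3 * p 1 ≤ p 0 ∧ p 1 ≤ 3 * p 0 ∧ flatGauge (p 0) (p 1) = 1 := by
  rw [← outerBridge_iff_flatGauge]
  unfold outerBridge outside
  simp only [Set.mem_inter_iff, Set.mem_ofPred_eq]
  tauto

lemma mem_sideBridge {s : ℝ} {p : R3} : p ∈ sideBridge s ↔
    p 2 = s / 3 ∧ (p 0 - 1) ^ 2 + (p 1 + 1) ^ 2 = 1 ∧ (1 ≤ p 0 ∨ p 1 ≤ -1) := by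
  unfold sideBridge outside
  simp only [Set.mem_inter_iff, Set.mem_ofPred_eq, and_assoc]
  refine and_congr_right fun _ => and_congr_right fun h => ?_
  exact one_le_max_abs_iff (by rw [h]; norm_num)

/-- The coordinates identifying each of the six pieces with `[0,1] × [-1,1]`. -/
def pieceCoord : Fin 3 ⊕ Fin 3 → R3 → ℝ × ℝ
  | Sum.inl k, p => (((flatCoord (p k, p (k + 1))).1 + 1) / 2, (flatCoord (p k, p (k + 1))).2)
  | Sum.inr k, p => ((3 - arcParam (p k) (p (k + 1))) / 5, -(3 * p (k + 2)))

lemma mem_piece_inl {k : Fin 3} {p : R3} : p ∈ piece (Sum.inl k) ↔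
    p (k + 2) = 0 ∧ flatGauge (p k) (p (k + 1)) ≤ 1 := mem_flatPiece (p := frame k p)

lemma mem_piece_inr {k : Fin 3} {p : R3} : p ∈ piece (Sum.inr k) ↔
    |p (k + 2)| ≤ 1 / 3 ∧ (p k - 1) ^ 2 + (p (k + 1) + 1) ^ 2 = 1 ∧ (1 ≤ p k ∨ p (k + 1) ≤ -1) :=
  mem_bandPiece (p := frame k p)

lemma continuousOn_pieceCoord (i : Fin 3 ⊕ Fin 3) : ContinuousOn (pieceCoord i) (piece i) := by
  rcases i with k | k
  · have h : ContinuousOn (fun p : R3 => flatCoord (p k, p (k + 1))) (piece (Sum.inl k)) :=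
      continuousOn_flatCoord.comp (by fun_prop) fun p hp => (mem_piece_inl.1 hp).2
    unfold pieceCoord
    exact ((h.fst.add continuousOn_const).div_const _).prodMk h.snd
  · unfold pieceCoord arcParam
    refine ContinuousOn.prodMk (ContinuousOn.div_const (continuousOn_const.sub
      (ContinuousOn.div (by fun_prop) (by fun_prop) fun p hp => ?_)) _) (by fun_prop)
    have h := mem_piece_inr.1 hp
    exact (arcParam_denom_pos h.2.1 h.2.2).ne'

lemma pieceCoord_mem {i : Fin 3 ⊕ Fin 3} {p : R3} (hp : p ∈ piece i) :
    (pieceCoord i p).1 ∈ Set.Icc (0 : ℝ) 1 ∧ (pieceCoord i p).2 ∈ Set.Icc (-1 : ℝ) 1 := by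
  rcases i with k | k
  · obtain ⟨h1, h2⟩ := flatCoord_mem (p := (p k, p (k + 1))) (mem_piece_inl.1 hp).2
    rw [abs_le] at h1 h2
    unfold pieceCoord
    exact ⟨⟨by dsimp only; linarith, by dsimp only; linarith⟩, h2⟩
  · obtain ⟨h1, h2, h3⟩ := mem_piece_inr.1 hp
    obtain ⟨h4, h5⟩ := arcParam_mem h2 h3
    rw [abs_le] at h1
    unfold pieceCoord
    simp only [Set.mem_Icc]
    refine ⟨⟨?_, ?_⟩, ?_, ?_⟩ <;> linarith

/-- Indices `k`, `k + 1`, `k + 2` exhaust the coordinates. -/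
lemma ext_frame (k : Fin 3) {p q : R3} (h0 : p k = q k) (h1 : p (k + 1) = q (k + 1))
    (h2 : p (k + 2) = q (k + 2)) : p = q :=
  frame_injective k (ext3 h0 h1 h2)

lemma pieceCoord_injOn (i : Fin 3 ⊕ Fin 3) : Set.InjOn (pieceCoord i) (piece i) := by
  rcases i with k | k
  · intro p hp q hq h
    rw [mem_piece_inl] at hp hq
    unfold pieceCoord at h
    have h' : flatCoord (p k, p (k + 1)) = flatCoord (q k, q (k + 1)) := by
      obtain ⟨h1, h2⟩ := Prod.mk.inj h
      exact Prod.ext (by linarith) h2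
    have h3 := Prod.mk.inj (flatCoord_injOn (by exact hp.2) (by exact hq.2) h')
    exact ext_frame k h3.1 h3.2 (hp.1.trans hq.1.symm)
  · intro p hp q hq h
    rw [mem_piece_inr] at hp hq
    unfold pieceCoord at h
    obtain ⟨h1, h2⟩ := Prod.mk.inj h
    have h3 : arcParam (p k) (p (k + 1)) = arcParam (q k) (q (k + 1)) := by linarith
    obtain ⟨h4, h5⟩ := arc_arcParam hp.2.1 hp.2.2
    obtain ⟨h6, h7⟩ := arc_arcParam hq.2.1 hq.2.2
    rw [h3] at h4 h5
    exact ext_frame k (h4.symm.trans h6) (h5.symm.trans h7) (by linarith)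

lemma pieceCoord_surj (i : Fin 3 ⊕ Fin 3) {w : ℝ × ℝ} (h1 : w.1 ∈ Set.Icc (0 : ℝ) 1)
    (h2 : w.2 ∈ Set.Icc (-1 : ℝ) 1) : ∃ p ∈ piece i, pieceCoord i p = w := by
  have hk0 : ∀ k : Fin 3, -k + (k + 1) = 1 := by decide
  have hk1 : ∀ k : Fin 3, -k + (k + 2) = 2 := by decide
  rw [Set.mem_Icc] at h1 h2
  rcases i with k | k
  · obtain ⟨⟨x, y⟩, h3, h4⟩ := flatCoord_surj (w := (2 * w.1 - 1, w.2))
      (abs_le.2 (by constructor <;> dsimp only <;> linarith)) (abs_le.2 h2)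
    refine ⟨frame (-k) !₂[x, y, 0], mem_piece_inl.2 ?_, ?_⟩
    · simpa [frame_apply, hk0, hk1] using h3
    · simp only [pieceCoord, frame_apply, neg_add_cancel, hk0]
      simp [h4]
  · have h3 := (arc_outside_iff (3 - 5 * w.1)).2 (by constructor <;> linarith)
    refine ⟨frame (-k) !₂[1 + arcU (3 - 5 * w.1), -1 + arcV (3 - 5 * w.1), -w.2 / 3],
      mem_piece_inr.2 ?_, ?_⟩
    · simp only [frame_apply, neg_add_cancel, hk0, hk1]
      refine ⟨?_, ?_, h3⟩
      · simp only [Matrix.cons_val]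
        rw [abs_le]; constructor <;> linarith
      · simpa using arc_circle (3 - 5 * w.1)
    · simp only [pieceCoord, frame_apply, neg_add_cancel, hk0, hk1,
        Matrix.cons_val, arcParam_arc]
      ext
      · dsimp only; ring
      · dsimp only; ring

lemma fin3_11 (k : Fin 3) : k + 1 + 1 = k + 2 := by revert k; decide
lemma fin3_12 (k : Fin 3) : k + 1 + 2 = k := by revert k; decide
lemma fin3_21 (k : Fin 3) : k + 2 + 1 = k := by revert k; decide
lemma fin3_22 (k : Fin 3) : k + 2 + 2 = k + 1 := by revert k; decide

/-! ### Straight edges of the pieces -/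

/-- Leaving a flat piece through its end `s = 1` preserves the transverse coordinate. The next lemma
shows that leaving a band reverses it. This asymmetry produces the twist. -/
lemma flat_coord_of_mem_band_succ {k : Fin 3} {p : R3} (h : p ∈ piece (Sum.inl k))
    (h' : p ∈ piece (Sum.inr (k + 1))) :
    pieceCoord (Sum.inl k) p = (1, -(3 * p k)) ∧
      pieceCoord (Sum.inr (k + 1)) p = (0, -(3 * p k)) := by
  rw [mem_piece_inl] at h
  rw [mem_piece_inr, fin3_11, fin3_12] at h'
  obtain ⟨h1, -⟩ := h
  obtain ⟨h3, h4, -⟩ := h'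
  have h5 : p (k + 1) = 1 := by rw [h1] at h4; nlinarith
  constructor
  · simp only [pieceCoord, h5, (flatCoord_top h3).1]; norm_num
  · simp only [pieceCoord, h5, h1, fin3_11, fin3_12, arcParam]; norm_num

lemma flat_coord_of_mem_band_pred {k : Fin 3} {p : R3} (h : p ∈ piece (Sum.inl k))
    (h' : p ∈ piece (Sum.inr (k + 2))) :
    pieceCoord (Sum.inl k) p = (0, 3 * p (k + 1)) ∧
      pieceCoord (Sum.inr (k + 2)) p = (1, -(3 * p (k + 1))) := by
  rw [mem_piece_inl] at h
  rw [mem_piece_inr, fin3_21, fin3_22] at h'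
  obtain ⟨h1, -⟩ := h
  obtain ⟨h3, h4, -⟩ := h'
  have h5 : p k = -1 := by rw [h1] at h4; nlinarith
  constructor
  · simp only [pieceCoord, h5, (flatCoord_left h3).1]; norm_num
  · simp only [pieceCoord, h5, h1, fin3_21, fin3_22, arcParam]; norm_num

/-- The explicit edge point with the same transverse coordinate has the same image, so injectivity
of `flatCoord` identifies the two. -/
lemma flat_left {k : Fin 3} {p : R3} (h : p ∈ piece (Sum.inl k))
    (h0 : (pieceCoord (Sum.inl k) p).1 = 0) :
    p k = -1 ∧ p (k + 1) = (pieceCoord (Sum.inl k) p).2 / 3 ∧ p (k + 2) = 0 := by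
  have ht := (pieceCoord_mem h).2
  rw [mem_piece_inl] at h
  unfold pieceCoord at h0 ht ⊢
  dsimp only at h0 ht ⊢
  rw [Set.mem_Icc] at ht
  have h3 : |(flatCoord (p k, p (k + 1))).2 / 3| ≤ 1 / 3 := by
    rw [abs_le]; constructor <;> linarith
  obtain ⟨h4, h5⟩ := flatCoord_left h3
  have h6 : (-1, (flatCoord (p k, p (k + 1))).2 / 3) = (p k, p (k + 1)) :=
    flatCoord_injOn (by exact h5.le) (by exact h.2) (by
      rw [h4]; ext
      · dsimp only; linarith
      · dsimp only; ring)
  obtain ⟨h7, h8⟩ := Prod.mk.inj h6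
  exact ⟨h7.symm, h8.symm, h.1⟩

lemma flat_right {k : Fin 3} {p : R3} (h : p ∈ piece (Sum.inl k))
    (h0 : (pieceCoord (Sum.inl k) p).1 = 1) :
    p k = -(pieceCoord (Sum.inl k) p).2 / 3 ∧ p (k + 1) = 1 ∧ p (k + 2) = 0 := by
  have ht := (pieceCoord_mem h).2
  rw [mem_piece_inl] at h
  unfold pieceCoord at h0 ht ⊢
  dsimp only at h0 ht ⊢
  rw [Set.mem_Icc] at ht
  have h3 : |-(flatCoord (p k, p (k + 1))).2 / 3| ≤ 1 / 3 := by
    rw [abs_le]; constructor <;> linarith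
  obtain ⟨h4, h5⟩ := flatCoord_top h3
  have h6 : (-(flatCoord (p k, p (k + 1))).2 / 3, 1) = (p k, p (k + 1)) :=
    flatCoord_injOn (by exact h5.le) (by exact h.2) (by
      rw [h4]; ext
      · dsimp only; linarith
      · dsimp only; ring)
  obtain ⟨h7, h8⟩ := Prod.mk.inj h6
  exact ⟨h7.symm, h8.symm, h.1⟩

lemma band_left {k : Fin 3} {p : R3} (h : p ∈ piece (Sum.inr k))
    (h0 : (pieceCoord (Sum.inr k) p).1 = 0) :
    p k = 1 ∧ p (k + 1) = 0 ∧ p (k + 2) = -(pieceCoord (Sum.inr k) p).2 / 3 := by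
  rw [mem_piece_inr] at h
  unfold pieceCoord at h0 ⊢
  dsimp only at h0 ⊢
  have h1 : arcParam (p k) (p (k + 1)) = 3 := by linarith
  have h2 := arc_arcParam h.2.1 h.2.2
  rw [h1, arcU_three, arcV_three] at h2
  exact ⟨by linarith [h2.1], by linarith [h2.2], by ring⟩

lemma band_right {k : Fin 3} {p : R3} (h : p ∈ piece (Sum.inr k))
    (h0 : (pieceCoord (Sum.inr k) p).1 = 1) :
    p k = 0 ∧ p (k + 1) = -1 ∧ p (k + 2) = -(pieceCoord (Sum.inr k) p).2 / 3 := by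
  rw [mem_piece_inr] at h
  unfold pieceCoord at h0 ⊢
  dsimp only at h0 ⊢
  have h1 : arcParam (p k) (p (k + 1)) = -2 := by linarith
  have h2 := arc_arcParam h.2.1 h.2.2
  rw [h1, arcU_neg_two, arcV_neg_two] at h2
  exact ⟨by linarith [h2.1], by linarith [h2.2], by ring⟩

/-! ### The Möbius band is Hausdorff -/

/-- The map winding the boundary of the Möbius band around the unit circle. -/
def winding (a : Set.Icc (0 : ℝ) 1 × Set.Icc (-1 : ℝ) 1) : ℂ :=
  (a.2 : ℝ) * Complex.exp (((Real.pi * (a.1 : ℝ) : ℝ) : ℂ) * Complex.I)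

lemma continuous_winding : Continuous winding := by unfold winding; fun_prop

lemma norm_winding (a : Set.Icc (0 : ℝ) 1 × Set.Icc (-1 : ℝ) 1) : ‖winding a‖ = |(a.2 : ℝ)| := by
  unfold winding
  rw [norm_mul, Complex.norm_exp_ofReal_mul_I, mul_one, Complex.norm_real, Real.norm_eq_abs]

/-- The projection of the Möbius band to its core circle. -/
def core (a : Set.Icc (0 : ℝ) 1 × Set.Icc (-1 : ℝ) 1) : ℂ :=
  Complex.exp (((2 * Real.pi * (a.1 : ℝ) : ℝ) : ℂ) * Complex.I)

lemma continuous_core : Continuous core := by unfold core; fun_prop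

lemma winding_congr {a b : Set.Icc (0 : ℝ) 1 × Set.Icc (-1 : ℝ) 1}
    (h : (a.1 : ℝ) = 0 ∧ (b.1 : ℝ) = 1 ∧ (b.2 : ℝ) = -(a.2 : ℝ)) : winding a = winding b := by
  unfold winding
  rw [h.1, h.2.1, h.2.2]
  simp [Complex.exp_pi_mul_I]

lemma core_congr {a b : Set.Icc (0 : ℝ) 1 × Set.Icc (-1 : ℝ) 1}
    (h : (a.1 : ℝ) = 0 ∧ (b.1 : ℝ) = 1 ∧ (b.2 : ℝ) = -(a.2 : ℝ)) : core a = core b := by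
  unfold core
  rw [h.1, h.2.1]
  simp [Complex.exp_two_pi_mul_I]

/-- Two points of the strip have the same image in the Möbius band. -/
def StripRel (a b : Set.Icc (0 : ℝ) 1 × Set.Icc (-1 : ℝ) 1) : Prop :=
  a = b ∨ ((a.1 : ℝ) = 0 ∧ (b.1 : ℝ) = 1 ∧ (b.2 : ℝ) = -(a.2 : ℝ)) ∨
    ((b.1 : ℝ) = 0 ∧ (a.1 : ℝ) = 1 ∧ (a.2 : ℝ) = -(b.2 : ℝ))

/-- `core` determines `s` modulo `1`, so two values of `s` agree or are `0` and `1`. As `exp (π i) =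
-1`, `winding` then determines `t`, with a change of sign in the second case. -/
lemma stripRel_of_winding_core {a b : Set.Icc (0 : ℝ) 1 × Set.Icc (-1 : ℝ) 1}
    (h1 : winding a = winding b) (h2 : core a = core b) : StripRel a b := by
  obtain ⟨⟨s, hs⟩, ⟨t, ht⟩⟩ := a
  obtain ⟨⟨s', hs'⟩, ⟨t', ht'⟩⟩ := b
  unfold core at h2
  rw [Complex.exp_eq_exp_iff_exists_int] at h2
  obtain ⟨n, hn⟩ := h2
  have hn' : s = s' + n := by
    have h3 : ((2 * Real.pi * s : ℝ) : ℂ) = ((2 * Real.pi * (s' + n) : ℝ) : ℂ) := by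
      apply mul_right_cancel₀ Complex.I_ne_zero
      rw [hn]; push_cast; ring
    have h4 := Complex.ofReal_injective h3
    exact mul_left_cancel₀ (by positivity) h4
  have e1 : n ≤ 1 := by
    have : (n : ℝ) ≤ 1 := by linarith [hs.2, hs'.1]
    exact_mod_cast this
  have e2 : -1 ≤ n := by
    have : (-1 : ℝ) ≤ n := by linarith [hs.1, hs'.2]
    exact_mod_cast this
  obtain rfl | rfl | rfl : n = 0 ∨ n = 1 ∨ n = -1 := by omega
  · simp only [Int.cast_zero, add_zero] at hn'
    subst hn'
    left
    unfold winding at h1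
    have := Complex.ofReal_injective (mul_right_cancel₀ (Complex.exp_ne_zero _) h1)
    dsimp only at this
    subst this
    rfl
  · have e3 : s' = 0 := by push_cast at hn'; linarith [hs.2, hs'.1]
    have e4 : s = 1 := by push_cast at hn'; linarith [hs.2, hs'.1]
    subst e3 e4
    unfold winding at h1
    simp only [mul_one, mul_zero, Complex.exp_pi_mul_I, Complex.ofReal_zero, zero_mul,
      Complex.exp_zero] at h1
    right; right
    refine ⟨rfl, rfl, ?_⟩
    have : ((-t : ℝ) : ℂ) = (t' : ℂ) := by rw [← h1]; push_cast; ring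
    have := Complex.ofReal_injective this
    dsimp only; linarith
  · have e3 : s' = 1 := by push_cast at hn'; linarith [hs.1, hs'.2]
    have e4 : s = 0 := by push_cast at hn'; linarith [hs.1, hs'.2]
    subst e3 e4
    unfold winding at h1
    simp only [mul_one, mul_zero, Complex.exp_pi_mul_I, Complex.ofReal_zero, zero_mul,
      Complex.exp_zero] at h1
    right; left
    refine ⟨rfl, rfl, ?_⟩
    have : (t : ℂ) = ((-t' : ℝ) : ℂ) := by rw [h1]; push_cast; ring
    have := Complex.ofReal_injective this
    dsimp only; linarith

/-- The winding map on the Möbius band. -/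
def mobiusWinding : MobiusBand → ℂ := Quot.lift winding fun _ _ h => winding_congr h

/-- The core map on the Möbius band. -/
def mobiusCore : MobiusBand → ℂ := Quot.lift core fun _ _ h => core_congr h

lemma continuous_mobiusWinding : Continuous mobiusWinding :=
  continuous_quot_lift _ continuous_winding

lemma continuous_mobiusCore : Continuous mobiusCore :=
  continuous_quot_lift _ continuous_core

/-- No chains of identifications need to be followed: `winding` and `core` descend to the quotient,
and their values already force one of the three basic cases. -/
lemma mobius_mk_eq_iff {a b : Set.Icc (0 : ℝ) 1 × Set.Icc (-1 : ℝ) 1} :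
    (Quot.mk _ a : MobiusBand) = Quot.mk _ b ↔ StripRel a b := by
  constructor
  · intro h
    exact stripRel_of_winding_core (congrArg mobiusWinding h) (congrArg mobiusCore h)
  · rintro (h | h | h)
    · rw [h]
    · exact Quot.sound h
    · symm; exact Quot.sound h

instance : T2Space MobiusBand := by
  refine T2Space.of_injective_continuous (f := fun x => (mobiusWinding x, mobiusCore x)) ?_
    (continuous_mobiusWinding.prodMk continuous_mobiusCore)
  rintro ⟨a⟩ ⟨b⟩ h
  obtain ⟨h1, h2⟩ := Prod.mk.inj h
  exact mobius_mk_eq_iff.2 (stripRel_of_winding_core h1 h2)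

/-! ### `M*` is a Möbius band -/

/-- The position of a piece in the cycle of pieces. -/
def pos : Fin 3 ⊕ Fin 3 → Fin 6 := Sum.elim ![0, 4, 2] ![3, 1, 5]

/-- Whether the transverse direction of a piece is reversed in the Möbius band. -/
def orient : Fin 3 ⊕ Fin 3 → ℤ := Sum.elim ![1, 1, -1] ![-1, 1, 1]

lemma orient_cases (i : Fin 3 ⊕ Fin 3) : (orient i : ℝ) = 1 ∨ (orient i : ℝ) = -1 := by
  have : orient i = 1 ∨ orient i = -1 := by revert i; decide
  rcases this with h | h <;> rw [h] <;> norm_num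

lemma pos_injective : Function.Injective pos := by unfold Function.Injective; decide

lemma pos_surjective : Function.Surjective pos := by unfold Function.Surjective; decide

/-- Two pieces follow each other in the cycle. -/
def Consecutive (i j : Fin 3 ⊕ Fin 3) : Prop :=
  ∃ k : Fin 3, (i = Sum.inl k ∧ j = Sum.inr (k + 1)) ∨ (i = Sum.inr (k + 2) ∧ j = Sum.inl k)

instance (i j : Fin 3 ⊕ Fin 3) : Decidable (Consecutive i j) := by
  unfold Consecutive; infer_instance

lemma consecutive_iff (i j : Fin 3 ⊕ Fin 3) : Consecutive i j ↔ pos j = pos i + 1 := by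
  revert i j; decide

/-- The sign by which the transverse coordinate changes from a piece to the next one. -/
def flip (i : Fin 3 ⊕ Fin 3) : ℤ := Sum.elim (fun _ => 1) (fun _ => -1) i

lemma orient_succ {i j : Fin 3 ⊕ Fin 3} (h : Consecutive i j) (h' : (pos i : ℕ) ≠ 5) :
    orient i = flip i * orient j := by
  revert i j; decide

/-- Each of the three bands contributes a factor `-1`. Signs chosen along the cycle absorb all
transitions but the one closing it, and the sign left over there is the gluing `(0, t) ∼ (1, -t)`.
-/
lemma orient_last {i j : Fin 3 ⊕ Fin 3} (h : Consecutive i j) (h' : (pos i : ℕ) = 5) :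
    orient i = -(flip i * orient j) := by
  revert i j; decide

lemma flip_cases (i : Fin 3 ⊕ Fin 3) : (flip i : ℝ) = 1 ∨ (flip i : ℝ) = -1 := by
  rcases i with k | k <;> simp [flip]

lemma coord_of_mem_consecutive {i j : Fin 3 ⊕ Fin 3} (h : Consecutive i j) {p : R3}
    (hi : p ∈ piece i) (hj : p ∈ piece j) :
    (pieceCoord i p).1 = 1 ∧ (pieceCoord j p).1 = 0 ∧
      (pieceCoord j p).2 = flip i * (pieceCoord i p).2 := by
  obtain ⟨k, ⟨rfl, rfl⟩ | ⟨rfl, rfl⟩⟩ := h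
  · obtain ⟨h1, h2⟩ := flat_coord_of_mem_band_succ hi hj
    rw [h1, h2]; simp [flip]
  · obtain ⟨h1, h2⟩ := flat_coord_of_mem_band_pred hj hi
    rw [h1, h2]; simp [flip]

/-- Straight edges are explicit segments in space, so matching coordinates at the ends of
consecutive pieces give the same point of `ℝ³`, not merely the same point of the strip. -/
lemma eq_of_coord_consecutive {i j : Fin 3 ⊕ Fin 3} (h : Consecutive i j) {p q : R3}
    (hp : p ∈ piece i) (hq : q ∈ piece j) (h1 : (pieceCoord i p).1 = 1)
    (h0 : (pieceCoord j q).1 = 0) (ht : (pieceCoord j q).2 = flip i * (pieceCoord i p).2) :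
    p = q := by
  obtain ⟨k, ⟨rfl, rfl⟩ | ⟨rfl, rfl⟩⟩ := h
  · obtain ⟨a1, a2, a3⟩ := flat_right hp h1
    obtain ⟨b1, b2, b3⟩ := band_left hq h0
    rw [fin3_11] at b2
    rw [fin3_12] at b3
    refine ext_frame k ?_ (a2.trans b1.symm) (a3.trans b2.symm)
    rw [a1, b3, ht]; simp [flip]
  · obtain ⟨a1, a2, a3⟩ := band_right hp h1
    obtain ⟨b1, b2, b3⟩ := flat_left hq h0
    rw [fin3_21] at a2
    rw [fin3_22] at a3
    refine ext_frame k (a2.trans b1.symm) ?_ (a1.trans b3.symm)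
    rw [a3, b2, ht]; simp [flip]

/-- The union of the pieces, before gluing. -/
abbrev Pieces : Type := Σ i : Fin 3 ⊕ Fin 3, piece i

lemma glue_iff_consecutive {a b : Pieces} :
    Glue a b ∨ Glue b a ↔ (Consecutive a.1 b.1 ∨ Consecutive b.1 a.1) ∧ (a.2 : R3) = b.2 := by
  have key : ∀ i j : Fin 3 ⊕ Fin 3, ((∃ k l : Fin 3, i = Sum.inl k ∧ j = Sum.inr l ∧ k ≠ l) ∨
      (∃ k l : Fin 3, j = Sum.inl k ∧ i = Sum.inr l ∧ k ≠ l)) ↔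
      (Consecutive i j ∨ Consecutive j i) := by decide
  rw [← key]
  unfold Glue
  constructor
  · rintro (⟨h1, h2⟩ | ⟨h1, h2⟩)
    · exact ⟨Or.inl h1, h2⟩
    · exact ⟨Or.inr h1, h2.symm⟩
  · rintro ⟨h1 | h1, h2⟩
    · exact Or.inl ⟨h1, h2⟩
    · exact Or.inr ⟨h1, h2.symm⟩

/-- The map from the pieces to the strip `[0,1] × [-1,1]`. -/
def toStrip (a : Pieces) : Set.Icc (0 : ℝ) 1 × Set.Icc (-1 : ℝ) 1 :=
  (⟨(((pos a.1 : ℕ) : ℝ) + (pieceCoord a.1 a.2).1) / 6, by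
    have h := (pieceCoord_mem a.2.2).1
    have h6 : ((pos a.1 : ℕ) : ℝ) ≤ 5 := by
      have : (pos a.1 : ℕ) ≤ 5 := by omega
      exact_mod_cast this
    have h0 : (0 : ℝ) ≤ ((pos a.1 : ℕ) : ℝ) := Nat.cast_nonneg _
    rw [Set.mem_Icc] at h ⊢
    constructor <;> linarith⟩,
  ⟨orient a.1 * (pieceCoord a.1 a.2).2, by
    have h := (pieceCoord_mem a.2.2).2
    rw [Set.mem_Icc] at h ⊢
    rcases orient_cases a.1 with e | e <;> rw [e] <;> constructor <;> linarith⟩)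

lemma continuous_toStrip : Continuous toStrip := by
  rw [continuous_sigma_iff]
  intro i
  have h : Continuous fun p : piece i => pieceCoord i p :=
    continuousOn_iff_continuous_domRestrict.1 (continuousOn_pieceCoord i)
  unfold toStrip
  refine Continuous.prodMk (Continuous.subtype_mk ?_ _) (Continuous.subtype_mk ?_ _)
  · dsimp only; fun_prop
  · dsimp only; fun_prop

lemma stripRel_toStrip {a b : Pieces} (h : Consecutive a.1 b.1) (hab : (a.2 : R3) = b.2) :
    StripRel (toStrip a) (toStrip b) := by
  obtain ⟨i, p⟩ := a
  obtain ⟨j, q⟩ := b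
  dsimp only at h hab
  obtain ⟨h1, h2, h3⟩ := coord_of_mem_consecutive h p.2 (hab ▸ q.2)
  have hpos := (consecutive_iff i j).1 h
  unfold StripRel toStrip
  dsimp only
  by_cases h5 : (pos i : ℕ) = 5
  · right; right
    have h6 : (pos j : ℕ) = 0 := by rw [hpos, Fin.val_add, h5]; rfl
    have ho := orient_last h h5
    rw [← hab, h1, h2, h3, h5, h6, ho]
    refine ⟨by norm_num, by norm_num, ?_⟩
    push_cast
    ring
  · left
    have h6 : (pos j : ℕ) = pos i + 1 := by
      rw [hpos, Fin.val_add]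
      exact Nat.mod_eq_of_lt (by have := (pos i).isLt; change (pos i : ℕ) + 1 < 6; omega)
    have ho := orient_succ h h5
    ext
    · dsimp only; rw [← hab, h1, h2, h6]; push_cast; ring
    · dsimp only; rw [← hab, h3, ho]; push_cast
      rcases flip_cases i with e | e <;> rw [e] <;> ring

/-- The piece number is the integer part of `6s`, except at common ends, where only consecutive
pieces compete. Within one piece the chart is injective. -/
lemma glue_or_eq_of_stripRel {a b : Pieces} (h : StripRel (toStrip a) (toStrip b)) :
    a = b ∨ (Consecutive a.1 b.1 ∨ Consecutive b.1 a.1) ∧ (a.2 : R3) = b.2 := by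
  -- the cases in which `a` comes before `b`
  have key1 : ∀ a b : Pieces, toStrip a = toStrip b → (pos a.1 : ℕ) < pos b.1 →
      Consecutive a.1 b.1 ∧ (a.2 : R3) = b.2 := by
    rintro ⟨i, p⟩ ⟨j, q⟩ h hlt
    dsimp only at hlt ⊢
    obtain ⟨h1, h2⟩ := Prod.mk.inj h
    replace h1 := Subtype.mk.inj h1
    replace h2 := Subtype.mk.inj h2
    dsimp only at h1 h2
    obtain ⟨hp0, hp1⟩ := (pieceCoord_mem p.2).1
    obtain ⟨hq0, hq1⟩ := (pieceCoord_mem q.2).1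
    have hle : ((pos i : ℕ) : ℝ) + 1 ≤ (pos j : ℕ) := by exact_mod_cast hlt
    have e1 : (pieceCoord i p).1 = 1 := by linarith
    have e0 : (pieceCoord j q).1 = 0 := by linarith
    have e : (pos j : ℕ) = pos i + 1 := by
      have : ((pos j : ℕ) : ℝ) = (pos i : ℕ) + 1 := by linarith
      exact_mod_cast this
    have hc : Consecutive i j := by
      rw [consecutive_iff, Fin.ext_iff, Fin.val_add, e]
      exact (Nat.mod_eq_of_lt (by have := (pos j).isLt; change (pos i : ℕ) + 1 < 6; omega)).symm
    refine ⟨hc, eq_of_coord_consecutive hc p.2 q.2 e1 e0 ?_⟩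
    have ho := orient_succ hc (by have := (pos j).isLt; omega)
    rw [ho] at h2
    push_cast at h2
    rcases orient_cases j with e | e <;> rw [e] at h2 <;> linarith
  -- The ends of the strip: `b` must be at the start of piece `0` and `a` at the end of piece `5`.
  have key2 : ∀ a b : Pieces, ((toStrip b).1 : ℝ) = 0 → ((toStrip a).1 : ℝ) = 1 →
      ((toStrip a).2 : ℝ) = -((toStrip b).2 : ℝ) → Consecutive a.1 b.1 ∧ (a.2 : R3) = b.2 := by
    rintro ⟨i, p⟩ ⟨j, q⟩ h0 h1 h2
    unfold toStrip at h0 h1 h2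
    dsimp only at h0 h1 h2 ⊢
    obtain ⟨hp0, hp1⟩ := (pieceCoord_mem p.2).1
    obtain ⟨hq0, hq1⟩ := (pieceCoord_mem q.2).1
    have hj0 : (0 : ℝ) ≤ (pos j : ℕ) := Nat.cast_nonneg _
    have hi5 : ((pos i : ℕ) : ℝ) ≤ 5 := by
      have : (pos i : ℕ) ≤ 5 := by omega
      exact_mod_cast this
    have e0 : (pieceCoord j q).1 = 0 := by linarith
    have e1 : (pieceCoord i p).1 = 1 := by linarith
    have ej : (pos j : ℕ) = 0 := by
      have : ((pos j : ℕ) : ℝ) = 0 := by linarith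
      exact_mod_cast this
    have ei : (pos i : ℕ) = 5 := by
      have : ((pos i : ℕ) : ℝ) = 5 := by linarith
      exact_mod_cast this
    have hc : Consecutive i j := by
      rw [consecutive_iff, Fin.ext_iff, Fin.val_add, ei, ej]; rfl
    refine ⟨hc, eq_of_coord_consecutive hc p.2 q.2 e1 e0 ?_⟩
    rw [orient_last hc ei] at h2
    push_cast at h2
    rcases orient_cases j with e | e <;> rw [e] at h2 <;> linarith
  rcases h with h | ⟨h1, h2, h3⟩ | ⟨h1, h2, h3⟩
  · rcases lt_trichotomy (pos a.1 : ℕ) (pos b.1) with hlt | heq | hlt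
    · obtain ⟨h1, h2⟩ := key1 a b h hlt
      exact Or.inr ⟨Or.inl h1, h2⟩
    · left
      have hij := pos_injective (Fin.ext heq)
      obtain ⟨i, p⟩ := a
      obtain ⟨j, q⟩ := b
      dsimp only at hij
      subst hij
      obtain ⟨h1, h2⟩ := Prod.mk.inj h
      replace h1 := Subtype.mk.inj h1
      replace h2 := Subtype.mk.inj h2
      dsimp only at h1 h2
      have : pieceCoord i p = pieceCoord i q := by
        ext
        · linarith
        · rcases orient_cases i with e | e <;> rw [e] at h2 <;> linarith
      rw [Subtype.ext (pieceCoord_injOn i p.2 q.2 this)]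
    · obtain ⟨h1, h2⟩ := key1 b a h.symm hlt
      exact Or.inr ⟨Or.inr h1, h2.symm⟩
  · obtain ⟨h4, h5⟩ := key2 b a h1 h2 h3
    exact Or.inr ⟨Or.inr h4, h5.symm⟩
  · obtain ⟨h4, h5⟩ := key2 a b h1 h2 h3
    exact Or.inr ⟨Or.inl h4, h5⟩

lemma toStrip_surjective : Function.Surjective toStrip := by
  rintro ⟨⟨s, hs0, hs1⟩, ⟨t, ht0, ht1⟩⟩
  obtain ⟨n, x, hx0, hx1, hx⟩ : ∃ n : Fin 6, ∃ x : ℝ, 0 ≤ x ∧ x ≤ 1 ∧ 6 * s = (n : ℕ) + x := by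
    -- At `s = 1` the floor of `6s` would be `6`, so the end of the last piece is used instead.
    rcases hs1.eq_or_lt with rfl | hs1
    · exact ⟨5, 1, by norm_num, le_rfl, by norm_num⟩
    · refine ⟨⟨⌊6 * s⌋₊, ?_⟩, Int.fract (6 * s), Int.fract_nonneg _, (Int.fract_lt_one _).le, ?_⟩
      · rw [Nat.floor_lt (by linarith)]; push_cast; linarith
      · dsimp only
        rw [natCast_floor_eq_intCast_floor (by linarith), Int.floor_add_fract]
  obtain ⟨i, rfl⟩ := pos_surjective n
  have ho : (orient i : ℝ) * t ∈ Set.Icc (-1 : ℝ) 1 := by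
    rw [Set.mem_Icc]
    rcases orient_cases i with e | e <;> rw [e] <;> constructor <;> linarith
  obtain ⟨p, hp, hpc⟩ := pieceCoord_surj i (w := (x, orient i * t)) ⟨hx0, hx1⟩ ho
  refine ⟨⟨i, p, hp⟩, ?_⟩
  unfold toStrip
  ext
  · dsimp only; rw [hpc]; linarith
  · dsimp only; rw [hpc]
    rcases orient_cases i with e | e <;> rw [e] <;> ring

/-- The identification of `M*` with the Möbius band. -/
def toMobius : MStar → MobiusBand :=
  Quot.lift (fun a => Quot.mk _ (toStrip a)) fun a b h => mobius_mk_eq_iff.2 (by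
    obtain ⟨h1 | h1, h2⟩ := glue_iff_consecutive.1 (Or.inl h)
    · exact stripRel_toStrip h1 h2
    · rcases stripRel_toStrip h1 h2.symm with h | h | h
      · exact Or.inl h.symm
      · exact Or.inr (Or.inr h)
      · exact Or.inr (Or.inl h))

lemma continuous_toMobius : Continuous toMobius :=
  continuous_quot_lift _ (continuous_quot_mk.comp continuous_toStrip)

/-- The image in the Möbius band shows that two identified points are equal or related by a single
gluing step. -/
lemma mstar_mk_eq {a b : Pieces} (h : (Quot.mk Glue a : MStar) = Quot.mk Glue b) :
    a = b ∨ Glue a b ∨ Glue b a := by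
  rw [glue_iff_consecutive]
  exact glue_or_eq_of_stripRel (mobius_mk_eq_iff.1 (congrArg toMobius h))

lemma toMobius_injective : Function.Injective toMobius := by
  rintro ⟨a⟩ ⟨b⟩ h
  have := glue_or_eq_of_stripRel (mobius_mk_eq_iff.1 h)
  rw [← glue_iff_consecutive] at this
  rcases this with h | h | h
  · rw [h]
  · exact Quot.sound h
  · exact (Quot.sound h).symm

lemma toMobius_surjective : Function.Surjective toMobius := by
  rintro ⟨w⟩
  obtain ⟨a, rfl⟩ := toStrip_surjective w
  exact ⟨Quot.mk _ a, rfl⟩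

lemma isClosed_piece (i : Fin 3 ⊕ Fin 3) : IsClosed (piece i) := by
  rcases i with k | k
  · have : piece (Sum.inl k) = {p | p (k + 2) = 0} ∩ {p | flatGauge (p k) (p (k + 1)) ≤ 1} := by
      ext p; exact mem_piece_inl
    rw [this]
    refine (isClosed_eq (by fun_prop) (by fun_prop)).inter (isClosed_le ?_ (by fun_prop))
    exact continuous_flatGauge.comp (f := fun p : R3 => (p k, p (k + 1))) (by fun_prop)
  · have : piece (Sum.inr k) = {p | |p (k + 2)| ≤ 1 / 3} ∩
        {p | (p k - 1) ^ 2 + (p (k + 1) + 1) ^ 2 = 1} ∩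
        ({p | 1 ≤ p k} ∪ {p | p (k + 1) ≤ -1}) := by
      ext p; rw [mem_piece_inr]; exact and_assoc.symm
    rw [this]
    refine IsClosed.inter (IsClosed.inter ?_ ?_) (IsClosed.union ?_ ?_)
    · exact isClosed_le (by fun_prop) (by fun_prop)
    · exact isClosed_eq (by fun_prop) (by fun_prop)
    · exact isClosed_le (by fun_prop) (by fun_prop)
    · exact isClosed_le (by fun_prop) (by fun_prop)

lemma abs_le_of_mem_piece {i : Fin 3 ⊕ Fin 3} {p : R3} (h : p ∈ piece i) (j : Fin 3) :
    |p j| ≤ 3 := by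
  have key : ∀ k : Fin 3, |p k| ≤ 3 → |p (k + 1)| ≤ 3 → |p (k + 2)| ≤ 3 → |p j| ≤ 3 := by
    intro k h0 h1 h2
    have : ∀ k j : Fin 3, j = k ∨ j = k + 1 ∨ j = k + 2 := by decide
    rcases this k j with rfl | rfl | rfl <;> assumption
  have hdisk : ∀ x y : ℝ, (x - 1) ^ 2 + (y + 1) ^ 2 ≤ 2 → |x| ≤ 3 ∧ |y| ≤ 3 := by
    intro x y h
    refine ⟨abs_le.2 ?_, abs_le.2 ?_⟩ <;> constructor <;>
      nlinarith [sq_nonneg (x - 1), sq_nonneg (y + 1)]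
  rcases i with k | k
  · obtain ⟨h1, h2⟩ := mem_piece_inl.1 h
    rw [flatGauge_le_one] at h2
    obtain ⟨h3, h4⟩ : |p k| ≤ 3 ∧ |p (k + 1)| ≤ 3 := by
      rcases h2 with h | h | h
      · exact ⟨by linarith [h.1], by linarith [h.2.1]⟩
      · exact hdisk _ _ (h.2.1.trans (by norm_num))
      · exact hdisk _ _ (h.trans (by norm_num))
    exact key k h3 h4 (by rw [h1]; norm_num)
  · obtain ⟨h1, h2, -⟩ := mem_piece_inr.1 h
    obtain ⟨h3, h4⟩ := hdisk _ _ (h2.le.trans (by norm_num))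
    exact key k h3 h4 (by linarith)

lemma isCompact_piece (i : Fin 3 ⊕ Fin 3) : IsCompact (piece i) := by
  refine Metric.isCompact_of_isClosed_isBounded (isClosed_piece i) ?_
  refine (Metric.isBounded_closedBall (x := (0 : R3)) (r := 6)).subset fun p hp => ?_
  rw [mem_closedBall_zero_iff, EuclideanSpace.norm_eq, Real.sqrt_le_left (by norm_num),
    Fin.sum_univ_three]
  have := abs_le_of_mem_piece hp
  simp only [Real.norm_eq_abs]
  nlinarith [this 0, this 1, this 2, abs_nonneg (p 0), abs_nonneg (p 1), abs_nonneg (p 2)]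

instance (i : Fin 3 ⊕ Fin 3) : CompactSpace (piece i) :=
  isCompact_iff_compactSpace.1 (isCompact_piece i)

/-- `M*` is homeomorphic to the Möbius band. -/
def mobiusHomeo : MStar ≃ₜ MobiusBand :=
  Continuous.homeoOfEquivCompactToT2
    (f := Equiv.ofBijective toMobius ⟨toMobius_injective, toMobius_surjective⟩) continuous_toMobius

instance : T2Space MStar := mobiusHomeo.isEmbedding.t2Space

/-! ### Immersions of compact surfaces -/

/-- Shrink the neighbourhood to a compact one: an injective continuous map from a compact space to a
Hausdorff space is a closed embedding. -/
lemma isTopologicalImmersion_of_locally_injective {X Y : Type} [TopologicalSpace X]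
    [TopologicalSpace Y] [CompactSpace X] [T2Space X] [T2Space Y] {f : X → Y} (hf : Continuous f)
    (h : ∀ x, ∃ U ∈ nhds x, Set.InjOn f U) : IsTopologicalImmersion f := by
  refine ⟨hf, fun x => ?_⟩
  obtain ⟨U, hU, hinj⟩ := h x
  obtain ⟨K, hK, hKU, hKc⟩ := local_compact_nhds hU
  refine ⟨K, hK, ?_⟩
  have : CompactSpace K := isCompact_iff_compactSpace.1 hKc
  refine (Continuous.isClosedEmbedding ?_ ?_).isEmbedding
  · exact hf.comp continuous_subtype_val
  · exact Set.injOn_iff_injective.1 (hinj.mono hKU)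

lemma continuous_mapM : Continuous mapM :=
  continuous_quot_lift _ (continuous_sigma fun _ => continuous_subtype_val)

/-- The image of a piece in `M*`. -/
def pieceImage (i : Fin 3 ⊕ Fin 3) : Set MStar :=
  Set.range fun p : piece i => (Quot.mk Glue ⟨i, p⟩ : MStar)

lemma isClosed_pieceImage (i : Fin 3 ⊕ Fin 3) : IsClosed (pieceImage i) :=
  (isCompact_range (continuous_quot_mk.comp continuous_sigmaMk)).isClosed

/-- Pieces sharing the point `x` of `MStar` have the same index or are adjacent, and for adjacent
pieces `Glue` identifies all points that coincide in space. -/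
lemma eq_of_mem_pieceImage {i j : Fin 3 ⊕ Fin 3} {x y z : MStar} (hxi : x ∈ pieceImage i)
    (hxj : x ∈ pieceImage j) (hy : y ∈ pieceImage i) (hz : z ∈ pieceImage j)
    (h : mapM y = mapM z) : y = z := by
  obtain ⟨a, rfl⟩ := hxi
  obtain ⟨b, hb⟩ := hxj
  obtain ⟨p, rfl⟩ := hy
  obtain ⟨q, rfl⟩ := hz
  have hpq : (p : R3) = q := h
  rcases mstar_mk_eq hb with hb | hb | hb
  · obtain rfl : j = i := congrArg Sigma.fst hb
    rw [Subtype.ext hpq]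
  · exact (Quot.sound ⟨hb.1, hpq.symm⟩).symm
  · exact Quot.sound ⟨hb.1, hpq⟩

lemma exists_mem_pieceImage (x : MStar) : ∃ i, x ∈ pieceImage i := by
  obtain ⟨⟨i, p⟩⟩ := x
  exact ⟨i, p, rfl⟩

/-- Remove the finitely many closed piece images that miss `x`. What remains lies in pieces through
`x`, among which coincidences in space are identifications. -/
lemma mapM_locally_injective (x : MStar) : ∃ U ∈ nhds x, Set.InjOn mapM U := by
  refine ⟨⋂ i, {y | x ∉ pieceImage i → y ∉ pieceImage i}, ?_, ?_⟩
  · rw [Filter.iInter_mem]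
    intro i
    by_cases hx : x ∈ pieceImage i
    · simp [hx]
    · exact Filter.mem_of_superset ((isClosed_pieceImage i).isOpen_compl.mem_nhds hx)
        fun y hy _ => hy
  · intro y hy z hz h
    obtain ⟨i, hi⟩ := exists_mem_pieceImage y
    obtain ⟨j, hj⟩ := exists_mem_pieceImage z
    have hxi : x ∈ pieceImage i := by
      by_contra hx; exact Set.mem_iInter.1 hy i hx hi
    have hxj : x ∈ pieceImage j := by
      by_contra hx; exact Set.mem_iInter.1 hz j hx hj
    exact eq_of_mem_pieceImage hxi hxj hi hj h

lemma mapM_immersion : IsTopologicalImmersion mapM :=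
  isTopologicalImmersion_of_locally_injective continuous_mapM mapM_locally_injective

lemma M_eq_iUnion_piece : M = ⋃ i, piece i := by
  ext p
  simp only [M, octacross, crossbridge, Set.mem_union, Set.mem_iUnion, mem_cycled, Sum.exists,
    piece, Sum.elim_inl, Sum.elim_inr, flatPiece, bandPiece, Set.mem_inter_iff]
  constructor
  · rintro ((⟨k, h⟩ | ⟨k, h | h, h'⟩) | ⟨k, h⟩)
    · exact Or.inl ⟨k, Or.inl (Or.inl h)⟩
    · exact Or.inl ⟨k, Or.inl (Or.inr ⟨h, h'⟩)⟩
    · exact Or.inr ⟨k, h, h'⟩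
    · exact Or.inl ⟨k, Or.inr h⟩
  · rintro (⟨k, (h | h) | h⟩ | ⟨k, h⟩)
    · exact Or.inl (Or.inl ⟨k, h⟩)
    · exact Or.inl (Or.inr ⟨k, Or.inl h.1, h.2⟩)
    · exact Or.inr ⟨k, h⟩
    · exact Or.inl (Or.inr ⟨k, Or.inr h.1, h.2⟩)

lemma range_mapM : Set.range mapM = M := by
  rw [M_eq_iUnion_piece]
  ext p
  rw [Set.mem_iUnion]
  constructor
  · rintro ⟨⟨i, p, hp⟩, rfl⟩
    exact ⟨i, hp⟩
  · rintro ⟨i, hp⟩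
    exact ⟨Quot.mk _ ⟨i, p, hp⟩, rfl⟩

/-! ### The boundary curve in coordinates -/

/-- The curved sides of the `k`-th flat piece. -/
def planarBd (k : Fin 3) : Set R3 :=
  {p | p (k + 2) = 0 ∧ flatGauge (p k) (p (k + 1)) = 1 ∧
    (-p k ≤ 3 * p (k + 1) ∧ p (k + 1) ≤ -(3 * p k) ∨ p (k + 1) ≤ 3 * p k ∨ 3 * p (k + 1) ≤ p k)}

/-- The curved sides of the `k`-th band piece. -/
def sideBd (k : Fin 3) : Set R3 :=
  {p | |p (k + 2)| = 1 / 3 ∧ (p k - 1) ^ 2 + (p (k + 1) + 1) ^ 2 = 1 ∧ (1 ≤ p k ∨ p (k + 1) ≤ -1)}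

lemma one_mem_signs : (1 : ℝ) ∈ ({1, -1} : Set ℝ) := Or.inl rfl

lemma neg_one_mem_signs : (-1 : ℝ) ∈ ({1, -1} : Set ℝ) := Or.inr rfl

lemma mem_bdM {p : R3} : p ∈ bdM ↔ ∃ k, p ∈ planarBd k ∨ p ∈ sideBd k := by
  unfold bdM
  rw [Set.mem_sUnion]
  constructor
  · rintro ⟨e, ⟨k, s, hs, t, ht, hst, rfl⟩ | ⟨k, rfl | ⟨s, hs, rfl⟩⟩, hp⟩
    · refine ⟨k, Or.inl ?_⟩
      rw [mem_cycled, mem_road hs ht hst] at hp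
      obtain ⟨h1, h2, h3, h4⟩ := hp
      refine ⟨h1, h4, ?_⟩
      simp only [frame_zero_apply, frame_one_apply] at h2 h3
      rcases hs with rfl | rfl <;> rcases ht with rfl | rfl
      · right; left; linarith
      · exact (hst ⟨rfl, rfl⟩).elim
      · left; constructor <;> linarith
      · right; right; linarith
    · refine ⟨k, Or.inl ?_⟩
      rw [mem_cycled, mem_outerBridge] at hp
      exact ⟨hp.1, hp.2.2.2, Or.inr (Or.inl hp.2.2.1)⟩
    · refine ⟨k, Or.inr ?_⟩
      rw [mem_cycled, mem_sideBridge] at hp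
      refine ⟨?_, hp.2⟩
      have h1 : p (k + 2) = s / 3 := hp.1
      rw [h1]
      rcases hs with rfl | rfl <;> norm_num [abs_div]
  · rintro ⟨k, ⟨h1, h2, h3⟩ | ⟨h1, h2⟩⟩
    · by_cases ha : p (k + 1) ≤ 3 * p k
      · by_cases hb : 3 * p (k + 1) ≤ p k
        · exact ⟨_, Or.inr ⟨k, Or.inl rfl⟩, mem_outerBridge.2 ⟨h1, hb, ha, h2⟩⟩
        · refine ⟨_, Or.inl ⟨k, 1, one_mem_signs, 1, one_mem_signs, by norm_num, rfl⟩, ?_⟩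
          rw [mem_cycled, mem_road one_mem_signs one_mem_signs (by norm_num)]
          refine ⟨h1, ?_, ?_, h2⟩ <;> simp only [frame_zero_apply, frame_one_apply] <;> linarith
      · by_cases hb : 3 * p (k + 1) ≤ p k
        · refine ⟨_, Or.inl ⟨k, -1, neg_one_mem_signs, -1, neg_one_mem_signs, by norm_num, rfl⟩, ?_⟩
          rw [mem_cycled, mem_road neg_one_mem_signs neg_one_mem_signs (by norm_num)]
          refine ⟨h1, ?_, ?_, h2⟩ <;> simp only [frame_zero_apply, frame_one_apply] <;> linarith
        · have h3 : -p k ≤ 3 * p (k + 1) ∧ p (k + 1) ≤ -(3 * p k) := by tauto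
          refine ⟨_, Or.inl ⟨k, -1, neg_one_mem_signs, 1, one_mem_signs, by norm_num, rfl⟩, ?_⟩
          rw [mem_cycled, mem_road neg_one_mem_signs one_mem_signs (by norm_num)]
          refine ⟨h1, ?_, ?_, h2⟩ <;> simp only [frame_zero_apply, frame_one_apply] <;>
            linarith [h3.1, h3.2]
    · rw [abs_eq (by norm_num)] at h1
      rcases h1 with h1 | h1
      · exact ⟨_, Or.inr ⟨k, Or.inr ⟨1, one_mem_signs, rfl⟩⟩, mem_sideBridge.2 ⟨h1, h2⟩⟩
      · refine ⟨_, Or.inr ⟨k, Or.inr ⟨-1, neg_one_mem_signs, rfl⟩⟩, mem_sideBridge.2 ⟨?_, h2⟩⟩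
        change p (k + 2) = -1 / 3
        rw [h1]; norm_num

lemma flatGauge_axis_fst {x : ℝ} (h : flatGauge x 0 ≤ 1) : -1 ≤ x := by
  by_contra! hx
  rw [flatGauge_eq_octGauge (Or.inl (by linarith)), octGauge_eq_left (by simp),
    abs_of_neg (by linarith)] at h
  linarith

lemma flatGauge_axis_snd {y : ℝ} (h : flatGauge 0 y ≤ 1) : y ≤ 1 := by
  by_contra! hy
  rw [flatGauge_eq_octGauge (Or.inl (by linarith)), octGauge_eq_right (by simp),
    abs_of_pos (by linarith)] at h
  linarith

lemma planarBd_axis_fst {k : Fin 3} {p : R3} (h : p ∈ planarBd k) (h0 : p (k + 1) = 0) :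
    1 < p k := by
  obtain ⟨-, h2, h3⟩ := h
  rw [h0] at h2 h3
  have hx : 0 ≤ p k := by
    rcases h3 with ⟨h, h'⟩ | h | h <;> linarith
  obtain ⟨h4, h5⟩ := outerBridge_iff_flatGauge.2 ⟨by linarith, by linarith, h2⟩
  rw [one_le_max_abs_iff h4.le] at h5
  rcases h5 with h5 | h5 <;> nlinarith

lemma planarBd_axis_snd {k : Fin 3} {p : R3} (h : p ∈ planarBd k) (h0 : p k = 0) :
    p (k + 1) < -1 := by
  obtain ⟨-, h2, h3⟩ := h
  rw [h0] at h2 h3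
  have hx : p (k + 1) ≤ 0 := by
    rcases h3 with ⟨h, h'⟩ | h | h <;> linarith
  obtain ⟨h4, h5⟩ := outerBridge_iff_flatGauge.2 ⟨by linarith, by linarith, h2⟩
  rw [one_le_max_abs_iff h4.le] at h5
  rcases h5 with h5 | h5 <;> nlinarith

lemma sideBd_bounds {k : Fin 3} {p : R3} (h : p ∈ sideBd k) :
    0 ≤ p k ∧ p (k + 1) ≤ 0 ∧ (p k = 0 → p (k + 1) = -1) ∧ (p (k + 1) = 0 → p k = 1) := by
  obtain ⟨-, h2, -⟩ := h
  refine ⟨by nlinarith [sq_nonneg (p (k + 1) + 1)], by nlinarith [sq_nonneg (p k - 1)],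
    fun h => ?_, fun h => ?_⟩ <;> rw [h] at h2 <;> nlinarith

lemma flatGauge_smul_point {t : ℝ} (ht : 1 ≤ t) (p : R3) (k l : Fin 3) :
    flatGauge ((t • p) k) ((t • p) l) = t * flatGauge (p k) (p l) :=
  flatGauge_smul (by linarith) _ _

lemma fin3_cases (k l : Fin 3) : l = k ∨ l = k + 1 ∨ l = k + 2 := by revert k l; decide

/-- In its own flat piece the gauge of `t • p` is `t`. Another flat piece meets this plane in a
coordinate axis, on which it ends at distance `1` in the direction where the curved side reaches
farther. The band of the same index stays strictly inside the circle of radius `4/3`; the other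
bands meet this plane only in straight edges, where the gauge is `1`. -/
lemma eq_one_of_smul_planarBd_mem_piece {k : Fin 3} {p : R3} (h : p ∈ planarBd k) {t : ℝ}
    (ht : 1 ≤ t) {i : Fin 3 ⊕ Fin 3} (hi : t • p ∈ piece i) : t = 1 := by
  have hax1 := planarBd_axis_fst h
  have hax2 := planarBd_axis_snd h
  obtain ⟨h1, h2, h3⟩ := h
  have h0 : (t • p) (k + 2) = 0 := by simp [h1]
  have hg := flatGauge_smul_point ht p k (k + 1)
  rw [h2, mul_one] at hg
  rcases i with l | l
  · rw [mem_piece_inl] at hi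
    obtain ⟨h4, h5⟩ := hi
    rcases fin3_cases k l with rfl | rfl | rfl
    · linarith
    · rw [fin3_12] at h4
      rw [fin3_11, h0] at h5
      have := flatGauge_axis_fst h5
      simp only [PiLp.smul_apply, smul_eq_mul] at h4 this
      have := hax2 (by rcases mul_eq_zero.1 h4 with h | h <;> linarith)
      nlinarith
    · rw [fin3_22] at h4
      rw [fin3_21, h0] at h5
      have := flatGauge_axis_snd h5
      simp only [PiLp.smul_apply, smul_eq_mul] at h4 this
      have := hax1 (by rcases mul_eq_zero.1 h4 with h | h <;> linarith)
      nlinarith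
  · rw [mem_piece_inr] at hi
    obtain ⟨h4, h5, h6⟩ := hi
    rcases fin3_cases k l with rfl | rfl | rfl
    · exfalso
      have h7 : ((t • p) l - 1) ^ 2 + ((t • p) (l + 1) + 1) ^ 2 ≤ (4 / 3 : ℝ) ^ 2 := by
        rw [h5]; norm_num
      rw [← one_le_max_abs_iff h7] at h6
      obtain ⟨h8, h9⟩ := outer_sector h7 h6
      have h10 : flatGauge ((t • p) l) ((t • p) (l + 1)) ≤ 1 :=
        flatGauge_le_one.2 (Or.inr (Or.inl ⟨by rw [h5]; norm_num, h7, h6⟩))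
      have h11 : flatGauge ((t • p) l) ((t • p) (l + 1)) = 1 :=
        le_antisymm h10 (by rw [hg]; exact ht)
      have h12 := (outerBridge_iff_flatGauge.2 ⟨h8, h9, h11⟩).1
      rw [h5] at h12
      norm_num at h12
    · rw [fin3_12] at h4
      rw [fin3_11, h0] at h5
      have h7 : (t • p) (k + 1) = 1 := by nlinarith
      rw [h7, (flatCoord_top h4).2] at hg
      exact hg.symm
    · rw [fin3_22] at h4
      rw [fin3_21, h0] at h5
      have h7 : (t • p) k = -1 := by nlinarith
      rw [h7, (flatCoord_left h4).2] at hg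
      exact hg.symm

/-- In its own band the height becomes `t / 3`, which forces `t = 1`. A flat piece can only contain
the ray at an end of the bridge, a point of one of its straight edges, where the gauge is `1`. For
another band, `p` would have to be such an end too, and a coordinate of absolute value `t ≥ 1` would
play the role of a height. -/
lemma eq_one_of_smul_sideBd_mem_piece {k : Fin 3} {p : R3} (h : p ∈ sideBd k) {t : ℝ}
    (ht : 1 ≤ t) {i : Fin 3 ⊕ Fin 3} (hi : t • p ∈ piece i) : t = 1 := by
  obtain ⟨b1, b2, b3, b4⟩ := sideBd_bounds h
  obtain ⟨h1, h2, h3⟩ := h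
  have h1' : |(t • p) (k + 2)| = t * (1 / 3) := by
    rw [PiLp.smul_apply, smul_eq_mul, abs_mul, h1, abs_of_pos (by linarith)]
  have hz : p (k + 2) ≠ 0 := by intro h; rw [h] at h1; norm_num at h1
  rcases i with l | l
  · rw [mem_piece_inl] at hi
    obtain ⟨h4, h5⟩ := hi
    rw [flatGauge_smul_point ht] at h5
    simp only [PiLp.smul_apply, smul_eq_mul, mul_eq_zero, show t ≠ 0 by linarith, false_or] at h4
    rcases fin3_cases k l with rfl | rfl | rfl
    · exact (hz h4).elim
    · rw [fin3_12] at h4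
      rw [fin3_11, b3 h4, (flatCoord_left h1.le).2] at h5
      linarith
    · rw [fin3_22] at h4
      rw [fin3_21, b4 h4, (flatCoord_top h1.le).2] at h5
      linarith
  · rw [mem_piece_inr] at hi
    obtain ⟨h4, h5, -⟩ := hi
    rcases fin3_cases k l with rfl | rfl | rfl
    · linarith
    · exfalso
      rw [fin3_12] at h4
      rw [fin3_11] at h5
      simp only [PiLp.smul_apply, smul_eq_mul] at h4 h5
      have h6 : 0 ≤ t * p (k + 1) := by nlinarith [sq_nonneg (t * p (k + 2) + 1)]
      rw [b4 (by nlinarith), abs_of_pos (by linarith)] at h4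
      linarith
    · exfalso
      rw [fin3_22] at h4
      rw [fin3_21] at h5
      simp only [PiLp.smul_apply, smul_eq_mul] at h4 h5
      have h6 : t * p k ≤ 0 := by nlinarith [sq_nonneg (t * p (k + 2) - 1)]
      rw [b3 (by nlinarith), abs_of_neg (by linarith)] at h4
      linarith

lemma eq_one_of_smul_bdM_mem_M {p : R3} (h : p ∈ bdM) {t : ℝ} (ht : 1 ≤ t) (hM : t • p ∈ M) :
    t = 1 := by
  rw [M_eq_iUnion_piece, Set.mem_iUnion] at hM
  obtain ⟨i, hi⟩ := hM
  obtain ⟨k, h | h⟩ := mem_bdM.1 h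
  · exact eq_one_of_smul_planarBd_mem_piece h ht hi
  · exact eq_one_of_smul_sideBd_mem_piece h ht hi

lemma planarBd_subset_piece (k : Fin 3) : planarBd k ⊆ piece (Sum.inl k) := fun _ h =>
  mem_piece_inl.2 ⟨h.1, h.2.1.le⟩

lemma sideBd_subset_piece (k : Fin 3) : sideBd k ⊆ piece (Sum.inr k) := fun _ h =>
  mem_piece_inr.2 ⟨h.1.le, h.2⟩

lemma bdM_subset_M : bdM ⊆ M := by
  intro p hp
  rw [M_eq_iUnion_piece, Set.mem_iUnion]
  obtain ⟨k, h | h⟩ := mem_bdM.1 hp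
  · exact ⟨_, planarBd_subset_piece k h⟩
  · exact ⟨_, sideBd_subset_piece k h⟩

lemma ne_zero_of_mem_bdM {p : R3} (hp : p ∈ bdM) : p ≠ 0 := by
  rintro rfl
  have := eq_one_of_smul_bdM_mem_M hp (t := 2) (by norm_num) (by simpa using bdM_subset_M hp)
  norm_num at this

/-- Two points of `∂M` on the same ray from the origin agree. -/
lemma bdM_ray {p q : R3} (hp : p ∈ bdM) (hq : q ∈ bdM) {s t : ℝ} (hs : 0 < s) (ht : 0 < t)
    (h : s • p = t • q) : s = t ∧ p = q := by
  have key : ∀ {p q : R3} {s t : ℝ}, p ∈ bdM → q ∈ bdM → 0 < s → s ≤ t → s • p = t • q →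
      s = t := by
    intro p q s t hp hq hs hst h
    -- The inner point scaled up is the outer one, which lies in `M`, so the exit property of `bdM`
    -- applies.
    have h1 : p = (t / s) • q := by
      rw [div_eq_inv_mul, mul_smul, ← h, smul_smul, inv_mul_cancel₀ hs.ne', one_smul]
    have h2 := eq_one_of_smul_bdM_mem_M hq (t := t / s) ((one_le_div hs).2 hst)
      (h1 ▸ bdM_subset_M hp)
    rw [div_eq_one_iff_eq hs.ne'] at h2
    exact h2.symm
  have hst : s = t := by
    rcases le_total s t with h' | h'
    · exact key hp hq hs h' h
    · exact (key hq hp ht h' h.symm).symm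
  subst hst
  exact ⟨rfl, smul_right_injective _ hs.ne' h⟩

lemma coneFriendly_bdM : ConeFriendly bdM := by
  rintro u - p ⟨⟨s, hs, rfl⟩, hp⟩ q ⟨⟨t, ht, rfl⟩, hq⟩
  have hs' : 0 < s := hs.lt_of_ne (by rintro rfl; exact ne_zero_of_mem_bdM hp (zero_smul _ _))
  have ht' : 0 < t := ht.lt_of_ne (by rintro rfl; exact ne_zero_of_mem_bdM hq (zero_smul _ _))
  exact (bdM_ray hp hq ht' hs' (by rw [smul_smul, smul_smul, mul_comm])).2

lemma inS3_M_inter_P : inS3 M ∩ P = inS3 bdM := by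
  apply Set.Subset.antisymm
  · rintro _ ⟨⟨q, hq, rfl⟩, ⟨_, ⟨p, hp, t, ht, rfl⟩, h⟩ | h⟩
    · have h' : t • p = q := OnePoint.coe_injective h
      subst h'
      obtain rfl := eq_one_of_smul_bdM_mem_M hp ht hq
      exact ⟨p, hp, by simp⟩
    · exact (OnePoint.coe_ne_infty q h).elim
  · rintro _ ⟨p, hp, rfl⟩
    exact ⟨⟨p, bdM_subset_M hp, rfl⟩, Or.inl ⟨p, ⟨p, hp, 1, le_rfl, (one_smul _ _).symm⟩, rfl⟩⟩

/-! ### The boundary in the coordinates of the pieces -/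

lemma flat_snd_eq_iff {k : Fin 3} {p : R3} (hp : p ∈ piece (Sum.inl k)) :
    |(pieceCoord (Sum.inl k) p).2| = 1 ↔ p ∈ planarBd k := by
  rw [mem_piece_inl] at hp
  unfold pieceCoord planarBd
  dsimp only
  rw [flatCoord_snd_eq hp.2]
  unfold xi eta
  have e1 : 2 * |3 / 2 * (p k + p (k + 1))| ≤ 3 / 2 * (p (k + 1) - p k) ↔
      -p k ≤ 3 * p (k + 1) ∧ p (k + 1) ≤ -(3 * p k) := by
    rw [← le_div_iff₀' (by norm_num), abs_le]
    constructor <;> rintro ⟨h1, h2⟩ <;> constructor <;> linarith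
  have e2 : 2 * (3 / 2 * (p (k + 1) - p k)) ≤ |3 / 2 * (p k + p (k + 1))| ↔
      p (k + 1) ≤ 3 * p k ∨ 3 * p (k + 1) ≤ p k := by
    rw [le_abs]
    constructor
    · rintro (h | h)
      · left; linarith
      · right; linarith
    · rintro (h | h)
      · left; linarith
      · right; linarith
  rw [e1, e2]
  exact ⟨fun h => ⟨hp.1, h⟩, fun h => h.2⟩

lemma band_snd_eq_iff {k : Fin 3} {p : R3} (hp : p ∈ piece (Sum.inr k)) :
    |(pieceCoord (Sum.inr k) p).2| = 1 ↔ p ∈ sideBd k := by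
  rw [mem_piece_inr] at hp
  unfold pieceCoord sideBd
  dsimp only
  rw [abs_neg, abs_mul, abs_of_pos (by norm_num : (0 : ℝ) < 3)]
  constructor
  · intro h; exact ⟨by linarith, hp.2⟩
  · intro h; rw [h.1]; norm_num

/-- Together with `mem_sideBd_of_mem` this shows that no other sheet passes through `bdM` in its
interior, so the preimage of `bdM` is no larger than the boundary circle. -/
lemma mem_planarBd_of_mem {k : Fin 3} {p : R3} (hp : p ∈ piece (Sum.inl k)) (h : p ∈ bdM) :
    p ∈ planarBd k := by
  obtain ⟨l, h | h⟩ := mem_bdM.1 h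
  · have hax1 := planarBd_axis_fst h
    have hax2 := planarBd_axis_snd h
    rw [mem_piece_inl] at hp
    rcases fin3_cases l k with rfl | rfl | rfl
    · exact h
    · rw [fin3_12, fin3_11, h.1] at hp
      have := flatGauge_axis_fst hp.2
      linarith [hax2 hp.1]
    · rw [fin3_22, fin3_21, h.1] at hp
      have := flatGauge_axis_snd hp.2
      linarith [hax1 hp.1]
  · obtain ⟨b1, b2, b3, b4⟩ := sideBd_bounds h
    have h1 := h.1
    rw [← flat_snd_eq_iff hp]
    rcases fin3_cases l k with rfl | rfl | rfl
    · rw [mem_piece_inl] at hp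
      rw [hp.1] at h1; norm_num at h1
    · have h2 := (mem_piece_inl.1 hp).1
      rw [fin3_12] at h2
      simp only [pieceCoord, fin3_11, b3 h2, (flatCoord_left h1.le).1]
      rw [abs_mul, h1]; norm_num
    · have h2 := (mem_piece_inl.1 hp).1
      rw [fin3_22] at h2
      simp only [pieceCoord, fin3_21, b4 h2, (flatCoord_top h1.le).1]
      rw [abs_neg, abs_mul, h1]; norm_num

lemma band_unique {k l : Fin 3} {p : R3} (hk : p ∈ sideBd k) (hl : p ∈ piece (Sum.inr l)) :
    l = k := by
  obtain ⟨b1, b2, b3, b4⟩ := sideBd_bounds hk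
  rw [mem_piece_inr] at hl
  obtain ⟨h4, h5, -⟩ := hl
  rcases fin3_cases k l with rfl | rfl | rfl
  · rfl
  · exfalso
    rw [fin3_12] at h4
    rw [fin3_11] at h5
    have h6 : 0 ≤ p (k + 1) := by nlinarith [sq_nonneg (p (k + 2) + 1)]
    rw [b4 (le_antisymm b2 h6)] at h4
    norm_num at h4
  · exfalso
    rw [fin3_22] at h4
    rw [fin3_21] at h5
    have h6 : p k ≤ 0 := by nlinarith [sq_nonneg (p (k + 2) - 1)]
    rw [b3 (le_antisymm h6 b1)] at h4
    norm_num at h4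

lemma mem_sideBd_of_mem {k : Fin 3} {p : R3} (hp : p ∈ piece (Sum.inr k)) (h : p ∈ bdM) :
    p ∈ sideBd k := by
  obtain ⟨l, h | h⟩ := mem_bdM.1 h
  · rcases fin3_cases l k with rfl | rfl | rfl
    · exfalso
      rw [mem_piece_inr] at hp
      obtain ⟨h4, h5, h6⟩ := hp
      have h7 : (p k - 1) ^ 2 + (p (k + 1) + 1) ^ 2 ≤ (4 / 3 : ℝ) ^ 2 := by rw [h5]; norm_num
      rw [← one_le_max_abs_iff h7] at h6
      obtain ⟨h8, h9⟩ := outer_sector h7 h6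
      have h12 := (outerBridge_iff_flatGauge.2 ⟨h8, h9, h.2.1⟩).1
      rw [h5] at h12
      norm_num at h12
    · have hl := planarBd_subset_piece l h
      rw [← band_snd_eq_iff hp, (flat_coord_of_mem_band_succ hl hp).2]
      rw [← flat_snd_eq_iff hl, (flat_coord_of_mem_band_succ hl hp).1] at h
      exact h
    · have hl := planarBd_subset_piece l h
      rw [← band_snd_eq_iff hp, (flat_coord_of_mem_band_pred hl hp).2]
      rw [← flat_snd_eq_iff hl, (flat_coord_of_mem_band_pred hl hp).1] at h
      rw [abs_neg]
      exact h
  · obtain rfl := band_unique h hp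
    exact h

lemma mem_bdM_iff_of_mem_piece {i : Fin 3 ⊕ Fin 3} {p : R3} (hp : p ∈ piece i) :
    p ∈ bdM ↔ |(pieceCoord i p).2| = 1 := by
  rcases i with k | k
  · rw [flat_snd_eq_iff hp]
    exact ⟨mem_planarBd_of_mem hp, fun h => mem_bdM.2 ⟨k, Or.inl h⟩⟩
  · rw [band_snd_eq_iff hp]
    exact ⟨mem_sideBd_of_mem hp, fun h => mem_bdM.2 ⟨k, Or.inr h⟩⟩

lemma planarBd_unique {k l : Fin 3} {p : R3} (hk : p ∈ planarBd k) (hl : p ∈ planarBd l) :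
    l = k := by
  have hp := mem_piece_inl.1 (planarBd_subset_piece l hl)
  rcases fin3_cases k l with rfl | rfl | rfl
  · rfl
  · rw [fin3_12, fin3_11, hk.1] at hp
    have := flatGauge_axis_fst hp.2
    linarith [planarBd_axis_snd hk hp.1]
  · rw [fin3_22, fin3_21, hk.1] at hp
    have := flatGauge_axis_snd hp.2
    linarith [planarBd_axis_fst hk hp.1]

/-- Curved sides of different flat pieces are disjoint, and so are those of different bands. A flat
piece and a band sharing a boundary point have different indices, since heights `0` and `±1/3`
differ, and are therefore glued there. -/
lemma mapM_injOn_bd : Set.InjOn mapM (mapM ⁻¹' bdM) := by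
  have key : ∀ (k l : Fin 3) (p : R3) (h1 : p ∈ piece (Sum.inl k)) (h2 : p ∈ piece (Sum.inr l)),
      p ∈ bdM → (Quot.mk Glue ⟨Sum.inl k, p, h1⟩ : MStar) = Quot.mk Glue ⟨Sum.inr l, p, h2⟩ := by
    intro k l p h1 h2 hp
    refine Quot.sound ⟨⟨k, l, rfl, rfl, ?_⟩, rfl⟩
    rintro rfl
    have h3 := (mem_sideBd_of_mem h2 hp).1
    rw [(mem_piece_inl.1 h1).1] at h3
    norm_num at h3
  rintro ⟨⟨i, p, hi⟩⟩ hp ⟨⟨j, q, hj⟩⟩ - h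
  have hpq : p = q := h
  subst hpq
  have hp : p ∈ bdM := hp
  rcases i with k | k <;> rcases j with l | l
  · obtain rfl := planarBd_unique (mem_planarBd_of_mem hi hp) (mem_planarBd_of_mem hj hp)
    rfl
  · exact key _ _ _ _ _ hp
  · exact (key _ _ _ _ _ hp).symm
  · obtain rfl := band_unique (mem_sideBd_of_mem hi hp) hj
    rfl

lemma mobius_mk_mem_boundary {a : Set.Icc (0 : ℝ) 1 × Set.Icc (-1 : ℝ) 1} :
    (Quot.mk _ a : MobiusBand) ∈ MobiusBand.boundary ↔ |(a.2 : ℝ)| = 1 := by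
  constructor
  · rintro ⟨b, hb, h⟩
    have := congrArg (fun x => ‖mobiusWinding x‖) h
    change ‖winding b‖ = ‖winding a‖ at this
    rw [norm_winding, norm_winding] at this
    exact this ▸ hb
  · exact fun h => ⟨a, h, rfl⟩

lemma toMobius_mem_boundary {x : MStar} : toMobius x ∈ MobiusBand.boundary ↔ mapM x ∈ bdM := by
  obtain ⟨⟨i, p, hp⟩⟩ := x
  change (Quot.mk _ (toStrip ⟨i, p, hp⟩) : MobiusBand) ∈ _ ↔ p ∈ bdM
  rw [mobius_mk_mem_boundary, mem_bdM_iff_of_mem_piece hp]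
  unfold toStrip
  dsimp only
  rcases orient_cases i with e | e <;> rw [e] <;> simp

lemma mobiusHomeo_symm_image_boundary :
    mobiusHomeo.symm '' MobiusBand.boundary = mapM ⁻¹' bdM := by
  ext x
  rw [← Homeomorph.preimage_symm, Homeomorph.symm_symm]
  exact toMobius_mem_boundary

/-! ### Cones -/

/-- The point at height `s⁻¹` above `p` in the cone to infinity. -/
def conePoint (s : ℝ) (p : R3) : S3 := if s = 0 then OnePoint.infty else ((s⁻¹ • p : R3) : S3)

@[simp] lemma conePoint_zero (p : R3) : conePoint 0 p = OnePoint.infty := if_pos rfl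

@[simp] lemma conePoint_one (p : R3) : conePoint 1 p = (p : S3) := by simp [conePoint]

lemma conePoint_of_ne {s : ℝ} (hs : s ≠ 0) (p : R3) :
    conePoint s p = ((s⁻¹ • p : R3) : S3) := if_neg hs

/-- As `s` tends to `0`, the lower bound on the norm of `f` drives `s⁻¹ • f` out of every compact
set. So `f` may be discontinuous where `s` vanishes. -/
lemma continuous_conePoint {X : Type*} [TopologicalSpace X] {s : X → ℝ} {f : X → R3}
    (hs : Continuous s) (hs0 : ∀ x, 0 ≤ s x) (hf : ∀ x, s x ≠ 0 → ContinuousAt f x) {c : ℝ}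
    (hc : 0 < c) (hfc : ∀ x, s x ≠ 0 → c ≤ ‖f x‖) : Continuous fun x => conePoint (s x) (f x) := by
  rw [continuous_iff_continuousAt]
  intro x
  by_cases hx : s x = 0
  · rw [ContinuousAt, hx, conePoint_zero, OnePoint.hasBasis_nhds_infty.tendsto_right_iff]
    rintro K ⟨-, hK⟩
    obtain ⟨R, hR⟩ := hK.isBounded.exists_norm_le
    have hev : ∀ᶠ y in nhds x, s y * (|R| + 1) < c := by
      have h1 : ContinuousAt (fun y => s y * (|R| + 1)) x := by fun_prop
      exact h1.eventually_lt_const (by simpa [hx] using hc)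
    filter_upwards [hev] with y hy
    by_cases hy0 : s y = 0
    · rw [hy0, conePoint_zero]; exact Or.inr rfl
    · rw [conePoint_of_ne hy0]
      left
      refine ⟨_, fun hmem => ?_, rfl⟩
      have h1 := hR _ hmem
      have hpos : 0 < s y := (hs0 y).lt_of_ne' hy0
      rw [norm_smul, norm_inv, Real.norm_eq_abs, abs_of_pos hpos, inv_mul_le_iff₀ hpos] at h1
      have h2 := hfc y hy0
      nlinarith [le_abs_self R]
  · have h1 : (fun y => conePoint (s y) (f y)) =ᶠ[nhds x]
        fun y => (((s y)⁻¹ • f y : R3) : S3) := by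
      filter_upwards [hs.continuousAt.eventually_ne hx] with y hy
      exact conePoint_of_ne hy _
    refine ContinuousAt.congr ?_ h1.symm
    exact OnePoint.continuous_coe.continuousAt.comp
      ((hs.continuousAt.inv₀ hx).smul (hf x hx))

lemma mem_coneToInfinity {S : Set R3} {q : S3} :
    q ∈ coneToInfinity S ↔ q = OnePoint.infty ∨
      ∃ p ∈ S, ∃ s : ℝ, 0 < s ∧ s ≤ 1 ∧ q = conePoint s p := by
  unfold coneToInfinity
  constructor
  · rintro (⟨_, ⟨p, hp, t, ht, rfl⟩, rfl⟩ | h)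
    · have ht0 : 0 < t := by linarith
      refine Or.inr ⟨p, hp, t⁻¹, inv_pos.2 ht0, inv_le_one_of_one_le₀ ht, ?_⟩
      rw [conePoint_of_ne (inv_ne_zero ht0.ne'), inv_inv]
    · exact Or.inl h
  · rintro (h | ⟨p, hp, s, hs0, hs1, rfl⟩)
    · exact Or.inr h
    · rw [conePoint_of_ne hs0.ne']
      exact Or.inl ⟨_, ⟨p, hp, s⁻¹, (one_le_inv₀ hs0).2 hs1, rfl⟩, rfl⟩

/-- The cone over `∂M` is embedded. -/
lemma conePoint_inj {p q : R3} (hp : p ∈ bdM) (hq : q ∈ bdM) {s t : ℝ} (hs : 0 ≤ s) (ht : 0 ≤ t)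
    (h : conePoint s p = conePoint t q) : s = t ∧ (s = 0 ∨ p = q) := by
  by_cases hs0 : s = 0
  · by_cases ht0 : t = 0
    · exact ⟨hs0.trans ht0.symm, Or.inl hs0⟩
    · rw [hs0, conePoint_zero, conePoint_of_ne ht0] at h
      exact (OnePoint.infty_ne_coe _ h).elim
  · by_cases ht0 : t = 0
    · rw [ht0, conePoint_zero, conePoint_of_ne hs0] at h
      exact (OnePoint.coe_ne_infty _ h).elim
    · rw [conePoint_of_ne hs0, conePoint_of_ne ht0] at h
      obtain ⟨h1, h2⟩ := bdM_ray hp hq (inv_pos.2 (hs.lt_of_ne' hs0))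
        (inv_pos.2 (ht.lt_of_ne' ht0)) (OnePoint.coe_injective h)
      exact ⟨inv_injective h1, Or.inr h2⟩

/-! ### The pizza is a disk -/

/-- The boundary circle of `M*`. -/
abbrev BdStar : Type := ↥(mapM ⁻¹' bdM)

/-- The homeomorphism from the boundary of `M*` to the unit circle. -/
def bdWinding (x : MStar) : ℂ := mobiusWinding (toMobius x)

lemma continuous_bdWinding : Continuous bdWinding :=
  continuous_mobiusWinding.comp continuous_toMobius

lemma norm_bdWinding (x : BdStar) : ‖bdWinding x‖ = 1 := by
  have h : toMobius x ∈ MobiusBand.boundary := toMobius_mem_boundary.2 x.2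
  obtain ⟨a, ha, h⟩ := h
  rw [bdWinding, ← h]
  exact (norm_winding a).trans ha

lemma isClosed_bdStar : IsClosed (mapM ⁻¹' bdM) := by
  have : mapM ⁻¹' bdM = {x | ‖bdWinding x‖ = 1} := by
    ext x
    rw [Set.mem_preimage, ← toMobius_mem_boundary]
    obtain ⟨a, ha⟩ := Quot.exists_rep (toMobius x)
    change _ ↔ ‖mobiusWinding (toMobius x)‖ = 1
    rw [← ha, mobius_mk_mem_boundary, ← norm_winding]
    rfl
  rw [this]
  exact isClosed_eq continuous_bdWinding.norm continuous_const

instance : CompactSpace BdStar := isCompact_iff_compactSpace.1 isClosed_bdStar.isCompact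

lemma bdM_eq_image : bdM = mapM '' (mapM ⁻¹' bdM) := by
  rw [Set.image_preimage_eq_of_subset]
  rw [range_mapM]
  exact bdM_subset_M

lemma isCompact_bdM : IsCompact bdM := by
  rw [bdM_eq_image]
  exact isClosed_bdStar.isCompact.image continuous_mapM

lemma exists_norm_lower_bound : ∃ c : ℝ, 0 < c ∧ ∀ p ∈ bdM, c ≤ ‖p‖ := by
  have hne : bdM.Nonempty := by
    refine ⟨frame 0 !₂[-1, 1 / 3, 0], mem_bdM.2 ⟨0, Or.inl ⟨rfl, ?_, ?_⟩⟩⟩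
    · simpa using (flatCoord_left (y := 1 / 3) (by norm_num)).2
    · left; norm_num
  obtain ⟨p, hp, h⟩ := isCompact_bdM.exists_isMinOn hne continuous_norm.continuousOn
  exact ⟨‖p‖, norm_pos_iff.2 (ne_zero_of_mem_bdM hp), fun q hq => h hq⟩

/-- On the boundary `t = ±1`, so `core` is the square of `winding` and adds no information. -/
lemma bdWinding_injective : Function.Injective fun x : BdStar => bdWinding x := by
  intro x y h
  apply Subtype.ext
  apply toMobius_injective
  obtain ⟨a, ha, hax⟩ := toMobius_mem_boundary.2 x.2
  obtain ⟨b, hb, hby⟩ := toMobius_mem_boundary.2 y.2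
  dsimp only [bdWinding] at h
  rw [← hax, ← hby] at h ⊢
  have hsq : ∀ a : Set.Icc (0 : ℝ) 1 × Set.Icc (-1 : ℝ) 1, |(a.2 : ℝ)| = 1 →
      core a = winding a ^ 2 := by
    intro a ha
    unfold core winding
    rw [mul_pow, ← Complex.exp_nat_mul, ← Complex.ofReal_pow, ← sq_abs, ha]
    push_cast
    ring_nf
  have h' : winding a = winding b := h
  exact mobius_mk_eq_iff.2 (stripRel_of_winding_core h' (by rw [hsq a ha, hsq b hb, h']))

lemma bdWinding_surjective {z : ℂ} (hz : ‖z‖ = 1) : ∃ x : BdStar, bdWinding x = z := by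
  have hpi := Real.pi_pos
  obtain ⟨a, ha, haz⟩ : ∃ a : Set.Icc (0 : ℝ) 1 × Set.Icc (-1 : ℝ) 1,
      |(a.2 : ℝ)| = 1 ∧ winding a = z := by
    have hz' : z = Complex.exp (((Complex.arg z : ℝ) : ℂ) * Complex.I) := by
      conv_lhs => rw [← Complex.norm_mul_exp_arg_mul_I z, hz]
      simp
    have h1 := Complex.neg_pi_lt_arg z
    have h2 := Complex.arg_le_pi z
    -- The side `t = 1` covers the arguments in `[0, π]`. The side `t = -1` covers the negative
    -- ones, shifted by `π`.
    rcases le_or_gt 0 (Complex.arg z) with h | h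
    · refine ⟨(⟨Complex.arg z / Real.pi, by positivity, (div_le_one hpi).2 h2⟩,
        ⟨1, by norm_num⟩), by norm_num, ?_⟩
      unfold winding
      dsimp only
      rw [mul_div_cancel₀ _ hpi.ne', ← hz']
      simp
    · refine ⟨(⟨(Complex.arg z + Real.pi) / Real.pi, div_nonneg (by linarith) hpi.le,
        (div_le_one hpi).2 (by linarith)⟩, ⟨-1, by norm_num⟩), by norm_num, ?_⟩
      unfold winding
      dsimp only
      rw [mul_div_cancel₀ _ hpi.ne']
      push_cast
      rw [add_mul, Complex.exp_add, Complex.exp_pi_mul_I, ← hz']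
      ring
  obtain ⟨x, hx⟩ := toMobius_surjective (Quot.mk _ a)
  refine ⟨⟨x, toMobius_mem_boundary.1 (hx ▸ mobius_mk_mem_boundary.2 ha)⟩, ?_⟩
  rw [bdWinding, hx]
  exact haz

/-- Polar coordinates on the closed disk. -/
def polar : C(BdStar × Set.Icc (0 : ℝ) 1, Metric.closedBall (0 : ℂ) 1) where
  toFun w := ⟨((w.2 : ℝ) : ℂ) * bdWinding w.1, by
    rw [mem_closedBall_zero_iff, norm_mul, norm_bdWinding, mul_one, Complex.norm_real,
      Real.norm_eq_abs, abs_of_nonneg w.2.2.1]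
    exact w.2.2.2⟩
  continuous_toFun := by
    refine Continuous.subtype_mk ?_ _
    have := continuous_bdWinding
    fun_prop

lemma polar_surjective : Function.Surjective polar := by
  rintro ⟨z, hz⟩
  rw [mem_closedBall_zero_iff] at hz
  by_cases h0 : z = 0
  · obtain ⟨x, -⟩ := bdWinding_surjective (z := 1) (by simp)
    refine ⟨(x, ⟨0, by norm_num⟩), Subtype.ext ?_⟩
    simp [polar, h0]
  · have hn : ‖z‖ ≠ 0 := norm_ne_zero_iff.2 h0
    obtain ⟨x, hx⟩ := bdWinding_surjective (z := z / ‖z‖) (by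
      rw [norm_div, Complex.norm_real, norm_norm, div_self hn])
    refine ⟨(x, ⟨‖z‖, norm_nonneg _, hz⟩), Subtype.ext ?_⟩
    change ((‖z‖ : ℝ) : ℂ) * bdWinding x = z
    rw [hx, mul_div_cancel₀ _ (by exact_mod_cast hn)]

lemma polar_eq_iff {v w : BdStar × Set.Icc (0 : ℝ) 1} :
    polar v = polar w ↔ (v.2 : ℝ) = w.2 ∧ ((v.2 : ℝ) = 0 ∨ v.1 = w.1) := by
  obtain ⟨x, r, hr⟩ := v
  obtain ⟨y, s, hs⟩ := w
  rw [Subtype.ext_iff]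
  change (r : ℂ) * bdWinding x = (s : ℂ) * bdWinding y ↔ r = s ∧ (r = 0 ∨ x = y)
  constructor
  · intro h
    have h1 := congrArg norm h
    rw [norm_mul, norm_mul, norm_bdWinding, norm_bdWinding, Complex.norm_real, Complex.norm_real,
      Real.norm_eq_abs, Real.norm_eq_abs, abs_of_nonneg hr.1, abs_of_nonneg hs.1, mul_one,
      mul_one] at h1
    subst h1
    refine ⟨rfl, ?_⟩
    by_cases h0 : r = 0
    · exact Or.inl h0
    · exact Or.inr (bdWinding_injective (mul_left_cancel₀ (by exact_mod_cast h0) h))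
  · rintro ⟨rfl, rfl | rfl⟩ <;> simp

lemma isQuotientMap_polar : Topology.IsQuotientMap polar :=
  polar.continuous.isClosedMap.isQuotientMap polar.continuous polar_surjective

/-- The cone structure on the pizza. -/
def coneBd : C(BdStar × Set.Icc (0 : ℝ) 1, S3) where
  toFun w := conePoint w.2 (mapM w.1)
  continuous_toFun := by
    obtain ⟨c, hc, h⟩ := exists_norm_lower_bound
    have := continuous_mapM
    refine continuous_conePoint (by fun_prop) (fun w => w.2.2.1)
      (fun w _ => Continuous.continuousAt (by fun_prop)) hc fun w _ => h _ w.1.2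

/-- The fibres are exactly those of `polar`, a quotient map onto the disk. Hence the cone
parametrization descends to an injective continuous map on the disk. -/
lemma coneBd_eq_iff {v w : BdStar × Set.Icc (0 : ℝ) 1} :
    coneBd v = coneBd w ↔ (v.2 : ℝ) = w.2 ∧ ((v.2 : ℝ) = 0 ∨ v.1 = w.1) := by
  constructor
  · intro h
    obtain ⟨h1, h2⟩ := conePoint_inj v.1.2 w.1.2 v.2.2.1 w.2.2.1 h
    refine ⟨h1, h2.imp_right fun h => Subtype.ext (mapM_injOn_bd v.1.2 w.1.2 h)⟩
  · rintro ⟨h1, h2⟩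
    change conePoint v.2 (mapM v.1) = conePoint w.2 (mapM w.1)
    rcases h2 with h2 | h2
    · rw [← h1, h2]; simp
    · rw [h1, h2]

lemma coneBd_factors : Function.FactorsThrough coneBd polar := fun _ _ h =>
  coneBd_eq_iff.2 (polar_eq_iff.1 h)

/-- The parametrization of the pizza by the closed disk. -/
def diskMap : C(Metric.closedBall (0 : ℂ) 1, S3) :=
  isQuotientMap_polar.lift coneBd coneBd_factors

lemma diskMap_polar (w : BdStar × Set.Icc (0 : ℝ) 1) : diskMap (polar w) = coneBd w :=
  DFunLike.congr_fun (isQuotientMap_polar.lift_comp coneBd coneBd_factors) w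

lemma diskMap_injective : Function.Injective diskMap := by
  intro y z h
  obtain ⟨v, rfl⟩ := polar_surjective y
  obtain ⟨w, rfl⟩ := polar_surjective z
  rw [diskMap_polar, diskMap_polar, coneBd_eq_iff] at h
  exact polar_eq_iff.2 h

lemma range_diskMap : Set.range diskMap = P := by
  rw [← polar_surjective.range_comp diskMap]
  ext q
  unfold P
  rw [mem_coneToInfinity]
  constructor
  · rintro ⟨w, rfl⟩
    rw [Function.comp_apply, diskMap_polar]
    by_cases h0 : (w.2 : ℝ) = 0
    · left
      change conePoint w.2 (mapM w.1) = _
      rw [h0, conePoint_zero]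
    · exact Or.inr ⟨mapM w.1, w.1.2, w.2, w.2.2.1.lt_of_ne' h0, w.2.2.2, rfl⟩
  · rintro (rfl | ⟨p, hp, s, hs0, hs1, rfl⟩)
    · obtain ⟨x, -⟩ := bdWinding_surjective (z := 1) (by simp)
      refine ⟨(x, ⟨0, by norm_num⟩), ?_⟩
      rw [Function.comp_apply, diskMap_polar]
      exact conePoint_zero _
    · rw [bdM_eq_image] at hp
      obtain ⟨x, hx, rfl⟩ := hp
      refine ⟨(⟨x, hx⟩, ⟨s, hs0.le, hs1⟩), ?_⟩
      rw [Function.comp_apply, diskMap_polar]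
      rfl

lemma diskMap_bdWinding (x : BdStar) (h : bdWinding x ∈ Metric.closedBall (0 : ℂ) 1) :
    diskMap ⟨bdWinding x, h⟩ = (mapM x : S3) := by
  have h1 : (⟨bdWinding x, h⟩ : Metric.closedBall (0 : ℂ) 1) = polar (x, ⟨1, by norm_num⟩) := by
    apply Subtype.ext
    change bdWinding x = ((1 : ℝ) : ℂ) * bdWinding x
    simp
  rw [h1, diskMap_polar]
  exact conePoint_one _

lemma isEmbeddedDisk_P : IsEmbeddedDisk P (inS3 bdM) := by
  let φ := Complex.orthonormalBasisOneI.repr.symm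
  let ψ : Metric.closedBall (0 : EuclideanSpace ℝ (Fin 2)) 1 → Metric.closedBall (0 : ℂ) 1 :=
    fun x => ⟨φ x, by
      rw [mem_closedBall_zero_iff, LinearIsometryEquiv.norm_map]
      exact mem_closedBall_zero_iff.1 x.2⟩
  have hψc : Continuous ψ := Continuous.subtype_mk (φ.continuous.comp continuous_subtype_val) _
  have hψi : Function.Injective ψ := fun x y h =>
    Subtype.ext (φ.injective (Subtype.ext_iff.1 h))
  have hψs : Function.Surjective ψ := fun z => ⟨⟨φ.symm z, by
    rw [mem_closedBall_zero_iff, LinearIsometryEquiv.norm_map]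
    exact mem_closedBall_zero_iff.1 z.2⟩, Subtype.ext (φ.apply_symm_apply _)⟩
  refine ⟨diskMap ∘ ψ, ?_, ?_, ?_⟩
  · exact ((diskMap.continuous.comp hψc).isClosedEmbedding
      (diskMap_injective.comp hψi)).isEmbedding
  · rw [hψs.range_comp, range_diskMap]
  · ext q
    constructor
    · rintro ⟨x, hx, rfl⟩
      have hn : ‖φ x‖ = 1 := by rw [LinearIsometryEquiv.norm_map]; exact hx
      obtain ⟨y, hy⟩ := bdWinding_surjective hn
      refine ⟨mapM y, y.2, ?_⟩
      have : ψ x = ⟨bdWinding y, by rw [hy]; exact (ψ x).2⟩ := Subtype.ext hy.symm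
      rw [Function.comp_apply, this, diskMap_bdWinding]
    · rintro ⟨p, hp, rfl⟩
      rw [bdM_eq_image] at hp
      obtain ⟨x, hx, rfl⟩ := hp
      have hn := norm_bdWinding ⟨x, hx⟩
      obtain ⟨y, hy⟩ := hψs ⟨bdWinding x, by rw [mem_closedBall_zero_iff]; exact hn.le⟩
      refine ⟨y, ?_, ?_⟩
      · change ‖(y : EuclideanSpace ℝ (Fin 2))‖ = 1
        have h1 : ‖φ y‖ = ‖bdWinding x‖ := congrArg norm (Subtype.ext_iff.1 hy)
        rw [LinearIsometryEquiv.norm_map] at h1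
        exact h1.trans hn
      · rw [Function.comp_apply, hy]
        exact diskMap_bdWinding ⟨x, hx⟩ _

/-! ### The real projective plane -/

lemma sq_sum_of_mem_sphere (x : Metric.sphere (0 : R3) 1) :
    (x : R3) 0 ^ 2 + (x : R3) 1 ^ 2 + (x : R3) 2 ^ 2 = 1 := by
  have h := mem_sphere_zero_iff_norm.1 x.2
  rw [EuclideanSpace.norm_eq, Real.sqrt_eq_one, Fin.sum_univ_three] at h
  simpa using h

/-- The point of the unit sphere with the given coordinates. -/
def spherePoint (a b c : ℝ) (h : a ^ 2 + b ^ 2 + c ^ 2 = 1) : Metric.sphere (0 : R3) 1 :=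
  ⟨!₂[a, b, c], by
    rw [mem_sphere_zero_iff_norm, EuclideanSpace.norm_eq, Real.sqrt_eq_one, Fin.sum_univ_three]
    simpa using h⟩

/-- The Veronese map, separating the points of the projective plane. -/
def veronese : RP2 → Fin 3 → Fin 3 → ℝ :=
  Quot.lift (fun x i j => (x : R3) i * (x : R3) j) fun x y h => by
    ext i j; simp [h]

lemma continuous_veronese : Continuous veronese := by
  refine continuous_quot_lift _ ?_
  rw [continuous_pi_iff]; intro i
  rw [continuous_pi_iff]; intro j
  fun_prop

lemma eq_or_eq_neg_of_veronese {x y : Metric.sphere (0 : R3) 1}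
    (h : ∀ i j, (x : R3) i * (x : R3) j = (y : R3) i * (y : R3) j) :
    (y : R3) = x ∨ (y : R3) = -(x : R3) := by
  obtain ⟨i, hi⟩ : ∃ i, (x : R3) i ≠ 0 := by
    by_contra! h0
    have := sq_sum_of_mem_sphere x
    simp [h0] at this
  have hy : (y : R3) i ≠ 0 := by
    intro h0
    have := h i i
    rw [h0, mul_zero] at this
    exact hi (mul_self_eq_zero.1 this)
  rcases mul_self_eq_mul_self_iff.1 (h i i) with h1 | h1
  · left; ext j
    have := h i j
    rw [h1] at this
    exact (mul_left_cancel₀ hy this).symm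
  · right; ext j
    have := h i j
    rw [h1] at this
    have h2 : (y : R3) i * (-(x : R3) j) = (y : R3) i * (y : R3) j := by rw [← this]; ring
    exact (mul_left_cancel₀ hy h2).symm

lemma rp2_mk_eq_iff {x y : Metric.sphere (0 : R3) 1} :
    (Quot.mk _ x : RP2) = Quot.mk _ y ↔ (y : R3) = x ∨ (y : R3) = -(x : R3) := by
  constructor
  · intro h
    exact eq_or_eq_neg_of_veronese fun i j => congrFun (congrFun (congrArg veronese h) i) j
  · rintro (h | h)
    · rw [Subtype.ext h]
    · exact Quot.sound h

instance : T2Space RP2 := by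
  refine T2Space.of_injective_continuous (f := veronese) ?_ continuous_veronese
  rintro ⟨x⟩ ⟨y⟩ h
  exact rp2_mk_eq_iff.2 (eq_or_eq_neg_of_veronese fun i j => congrFun (congrFun h i) j)

lemma rp2_mk_spherePoint_eq_iff {a b c a' b' c' : ℝ} {h : a ^ 2 + b ^ 2 + c ^ 2 = 1}
    {h' : a' ^ 2 + b' ^ 2 + c' ^ 2 = 1} :
    (Quot.mk _ (spherePoint a b c h) : RP2) = Quot.mk _ (spherePoint a' b' c' h') ↔
      (a' = a ∧ b' = b ∧ c' = c) ∨ (a' = -a ∧ b' = -b ∧ c' = -c) := by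
  rw [rp2_mk_eq_iff]
  unfold spherePoint
  dsimp only
  refine or_congr ?_ ?_
  · constructor
    · intro h
      exact ⟨congrFun (congrArg WithLp.ofLp h) 0, congrFun (congrArg WithLp.ofLp h) 1,
        congrFun (congrArg WithLp.ofLp h) 2⟩
    · rintro ⟨rfl, rfl, rfl⟩; rfl
  · constructor
    · intro h
      exact ⟨congrFun (congrArg WithLp.ofLp h) 0, congrFun (congrArg WithLp.ofLp h) 1,
        congrFun (congrArg WithLp.ofLp h) 2⟩
    · rintro ⟨rfl, rfl, rfl⟩
      exact ext3 (by simp) (by simp) (by simp)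

lemma continuous_spherePoint {X : Type*} [TopologicalSpace X] {a b c : X → ℝ} (ha : Continuous a)
    (hb : Continuous b) (hc : Continuous c) (h : ∀ x, a x ^ 2 + b x ^ 2 + c x ^ 2 = 1) :
    Continuous fun x => spherePoint (a x) (b x) (c x) (h x) := by
  refine Continuous.subtype_mk ?_ _
  refine (PiLp.continuous_toLp 2 _).comp ?_
  rw [continuous_pi_iff]
  intro i
  fin_cases i <;> assumption

/-! ### The projective plane as an equatorial strip and a polar cap -/

/-- The radius of the parallel of the sphere at height `t / 2`. -/
def parallelRadius (t : ℝ) : ℝ := √(1 - t ^ 2 / 4)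

lemma parallelRadius_sq {t : ℝ} (ht : t ∈ Set.Icc (-1 : ℝ) 1) :
    parallelRadius t ^ 2 = 1 - t ^ 2 / 4 := by
  rw [Set.mem_Icc] at ht
  exact Real.sq_sqrt (by nlinarith)

lemma parallelRadius_pos {t : ℝ} (ht : t ∈ Set.Icc (-1 : ℝ) 1) : 0 < parallelRadius t := by
  rw [Set.mem_Icc] at ht
  exact Real.sqrt_pos.2 (by nlinarith)

lemma parallelRadius_neg (t : ℝ) : parallelRadius (-t) = parallelRadius t := by
  unfold parallelRadius; rw [neg_sq]

/-- The strip around the equator. -/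
def stripSphere (a : Set.Icc (0 : ℝ) 1 × Set.Icc (-1 : ℝ) 1) : Metric.sphere (0 : R3) 1 :=
  spherePoint (parallelRadius a.2 * Real.cos (Real.pi * a.1))
    (parallelRadius a.2 * Real.sin (Real.pi * a.1)) (a.2 / 2) (by
      have h1 := parallelRadius_sq a.2.2
      have h2 := Real.sin_sq_add_cos_sq (Real.pi * a.1)
      rw [mul_pow, mul_pow, h1]
      linear_combination (1 - (a.2 : ℝ) ^ 2 / 4) * h2)

lemma continuous_stripSphere : Continuous stripSphere := by
  unfold stripSphere
  refine continuous_spherePoint ?_ ?_ ?_ _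
  · unfold parallelRadius; fun_prop
  · unfold parallelRadius; fun_prop
  · fun_prop

/-- The strip covers half of the equatorial zone, from longitude `0` to `π`. Where the sine is
positive the antipode lies outside this half, so only the two ends are identified, with reversed
height. -/
lemma stripSphere_eq_iff {a b : Set.Icc (0 : ℝ) 1 × Set.Icc (-1 : ℝ) 1} :
    (Quot.mk _ (stripSphere a) : RP2) = Quot.mk _ (stripSphere b) ↔ StripRel a b := by
  obtain ⟨⟨s, hs⟩, ⟨t, ht⟩⟩ := a
  obtain ⟨⟨s', hs'⟩, ⟨t', ht'⟩⟩ := b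
  unfold stripSphere StripRel
  rw [rp2_mk_spherePoint_eq_iff]
  dsimp only
  have hpi := Real.pi_pos
  have hr := parallelRadius_pos ht
  have hang : ∀ {s : ℝ}, s ∈ Set.Icc (0 : ℝ) 1 → Real.pi * s ∈ Set.Icc 0 Real.pi := fun hs =>
    ⟨mul_nonneg hpi.le hs.1, by nlinarith [hs.2]⟩
  have hsin : ∀ {s : ℝ}, s ∈ Set.Icc (0 : ℝ) 1 → 0 ≤ Real.sin (Real.pi * s) := fun hs =>
    Real.sin_nonneg_of_mem_Icc (hang hs)
  have hinj : ∀ {s s' : ℝ}, s ∈ Set.Icc (0 : ℝ) 1 → s' ∈ Set.Icc (0 : ℝ) 1 →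
      Real.cos (Real.pi * s) = Real.cos (Real.pi * s') → s = s' := fun hs hs' h =>
    mul_left_cancel₀ hpi.ne' (Real.injOn_cos (hang hs) (hang hs') h)
  constructor
  · rintro (⟨h1, h2, h3⟩ | ⟨h1, h2, h3⟩)
    · obtain rfl : t' = t := by linarith
      obtain rfl : s' = s := hinj hs' hs (mul_left_cancel₀ hr.ne' h1)
      exact Or.inl rfl
    · right
      obtain rfl : t' = -t := by linarith
      rw [parallelRadius_neg, ← mul_neg] at h1 h2
      have e1 := mul_left_cancel₀ hr.ne' h1
      have e2 := mul_left_cancel₀ hr.ne' h2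
      have e3 := hsin hs
      have e4 := hsin hs'
      have e5 : Real.sin (Real.pi * s) = 0 := by linarith
      have e6 := Real.sin_sq_add_cos_sq (Real.pi * s)
      rw [e5] at e6
      rcases sq_eq_one_iff.1 (show Real.cos (Real.pi * s) ^ 2 = 1 by linarith) with e | e
      · left
        refine ⟨hinj hs (by norm_num) (by rw [e]; simp), hinj hs' (by norm_num) ?_, rfl⟩
        rw [e1, e]; simp
      · right
        refine ⟨hinj hs' (by norm_num) ?_, hinj hs (by norm_num) (by rw [e]; simp), by ring⟩
        rw [e1, e]; simp
  · rintro (h | ⟨rfl, rfl, h3⟩ | ⟨rfl, rfl, h3⟩)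
    · obtain ⟨h1, h2⟩ := Prod.mk.inj h
      obtain rfl := Subtype.mk.inj h1
      obtain rfl := Subtype.mk.inj h2
      exact Or.inl ⟨rfl, rfl, rfl⟩
    · right
      rw [h3, parallelRadius_neg]
      simp
      ring
    · right
      rw [h3, parallelRadius_neg]
      simp
      ring

/-- The radius of the parallel bounding the polar cap. -/
def capRadius : ℝ := √3 / 2

lemma capRadius_sq : capRadius ^ 2 = 3 / 4 := by
  unfold capRadius; rw [div_pow, Real.sq_sqrt] <;> norm_num

lemma capRadius_pos : 0 < capRadius := by unfold capRadius; positivity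

lemma parallelRadius_of_abs_eq {t : ℝ} (h : |t| = 1) : parallelRadius t = capRadius := by
  unfold parallelRadius
  rw [← sq_abs, h, show (1 : ℝ) - 1 ^ 2 / 4 = capRadius ^ 2 by rw [capRadius_sq]; norm_num,
    Real.sqrt_sq capRadius_pos.le]

lemma sq_re_add_sq_im (z : ℂ) : z.re ^ 2 + z.im ^ 2 = ‖z‖ ^ 2 := by
  rw [← Complex.normSq_eq_norm_sq, Complex.normSq_apply]; ring

lemma norm_sq_le_one (z : Metric.closedBall (0 : ℂ) 1) : ‖(z : ℂ)‖ ^ 2 ≤ 1 := by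
  have := mem_closedBall_zero_iff.1 z.2
  nlinarith [norm_nonneg (z : ℂ)]

/-- The polar cap. -/
def capSphere (z : Metric.closedBall (0 : ℂ) 1) : Metric.sphere (0 : R3) 1 :=
  spherePoint (capRadius * (z : ℂ).re) (capRadius * (z : ℂ).im) (√(1 - 3 / 4 * ‖(z : ℂ)‖ ^ 2)) (by
    have h := norm_sq_le_one z
    rw [mul_pow, mul_pow, capRadius_sq, Real.sq_sqrt (by linarith), ← sq_re_add_sq_im]
    ring)

lemma continuous_capSphere : Continuous capSphere := by
  unfold capSphere
  refine continuous_spherePoint ?_ ?_ ?_ _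
  · exact continuous_const.mul (Complex.continuous_re.comp continuous_subtype_val)
  · exact continuous_const.mul (Complex.continuous_im.comp continuous_subtype_val)
  · fun_prop

lemma half_le_cap_height (z : Metric.closedBall (0 : ℂ) 1) :
    1 / 2 ≤ √(1 - 3 / 4 * ‖(z : ℂ)‖ ^ 2) := by
  apply Real.le_sqrt_of_sq_le
  have := norm_sq_le_one z
  linarith

lemma capSphere_injective {y z : Metric.closedBall (0 : ℂ) 1}
    (h : (Quot.mk _ (capSphere y) : RP2) = Quot.mk _ (capSphere z)) : y = z := by
  unfold capSphere at h
  rw [rp2_mk_spherePoint_eq_iff] at h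
  have hy := half_le_cap_height y
  have hz := half_le_cap_height z
  rcases h with ⟨h1, h2, -⟩ | ⟨-, -, h3⟩
  · exact Subtype.ext (Complex.ext (mul_left_cancel₀ capRadius_pos.ne' h1).symm
      (mul_left_cancel₀ capRadius_pos.ne' h2).symm)
  · linarith

lemma winding_re_im (a : Set.Icc (0 : ℝ) 1 × Set.Icc (-1 : ℝ) 1) :
    (winding a).re = a.2 * Real.cos (Real.pi * a.1) ∧
      (winding a).im = a.2 * Real.sin (Real.pi * a.1) := by
  unfold winding
  rw [Complex.re_ofReal_mul, Complex.im_ofReal_mul, Complex.exp_ofReal_mul_I_re,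
    Complex.exp_ofReal_mul_I_im]
  exact ⟨rfl, rfl⟩

/-- The cap lies at height at least `1/2` and the strip at absolute height at most `1/2`, so they
meet at `t = ±1` only. For `t = -1` the antipodal map changes the sign of the horizontal
coordinates, as the factor `t` in `winding` does. -/
lemma stripSphere_eq_capSphere_iff {a : Set.Icc (0 : ℝ) 1 × Set.Icc (-1 : ℝ) 1}
    {z : Metric.closedBall (0 : ℂ) 1} :
    (Quot.mk _ (stripSphere a) : RP2) = Quot.mk _ (capSphere z) ↔
      |(a.2 : ℝ)| = 1 ∧ winding a = z := by
  obtain ⟨hre, him⟩ := winding_re_im a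
  unfold stripSphere capSphere
  rw [rp2_mk_spherePoint_eq_iff]
  have hz := half_le_cap_height z
  have ha := a.2.2
  rw [Set.mem_Icc] at ha
  have hc := capRadius_pos
  constructor
  · rintro (⟨h1, h2, h3⟩ | ⟨h1, h2, h3⟩)
    · have ht : (a.2 : ℝ) = 1 := by linarith
      refine ⟨by rw [ht]; norm_num, ?_⟩
      rw [parallelRadius_of_abs_eq (by rw [ht]; norm_num)] at h1 h2
      apply Complex.ext
      · rw [hre, ht, one_mul, mul_left_cancel₀ hc.ne' h1]
      · rw [him, ht, one_mul, mul_left_cancel₀ hc.ne' h2]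
    · have ht : (a.2 : ℝ) = -1 := by linarith
      refine ⟨by rw [ht]; norm_num, ?_⟩
      rw [parallelRadius_of_abs_eq (by rw [ht]; norm_num), ← mul_neg] at h1 h2
      apply Complex.ext
      · rw [hre, ht, mul_left_cancel₀ hc.ne' h1]; ring
      · rw [him, ht, mul_left_cancel₀ hc.ne' h2]; ring
  · rintro ⟨h1, h2⟩
    have hn : ‖(z : ℂ)‖ = 1 := by rw [← h2, norm_winding, h1]
    have hs : √(1 - 3 / 4 * ‖(z : ℂ)‖ ^ 2) = 1 / 2 := by
      rw [hn, show (1 : ℝ) - 3 / 4 * 1 ^ 2 = (1 / 2) ^ 2 by norm_num, Real.sqrt_sq (by norm_num)]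
    rw [hs, ← h2, hre, him, parallelRadius_of_abs_eq h1]
    rcases (abs_eq (by norm_num)).1 h1 with ht | ht
    · left; rw [ht]; refine ⟨?_, ?_, ?_⟩ <;> ring
    · right; rw [ht]; refine ⟨?_, ?_, ?_⟩ <;> ring

lemma strip_or_cap (x : RP2) :
    (∃ a, x = Quot.mk _ (stripSphere a)) ∨ ∃ z, x = Quot.mk _ (capSphere z) := by
  obtain ⟨v⟩ := x
  have hv := sq_sum_of_mem_sphere v
  have hmk : ∀ (w : Metric.sphere (0 : R3) 1) (ε : ℝ), ε = 1 ∨ ε = -1 →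
      (∀ i, (w : R3) i = ε * (v : R3) i) → (Quot.mk _ v : RP2) = Quot.mk _ w := by
    rintro w ε (rfl | rfl) h
    · exact rp2_mk_eq_iff.2 (Or.inl (by ext i; rw [h, one_mul]))
    · exact rp2_mk_eq_iff.2 (Or.inr (by ext i; rw [h]; simp))
  by_cases hc : |(v : R3) 2| ≤ 1 / 2
  · left
    -- Of the two antipodal representatives, choose the one in the half covered by the strip.
    obtain ⟨ε, hε, hε0⟩ : ∃ ε : ℝ, (ε = 1 ∨ ε = -1) ∧ 0 ≤ ε * (v : R3) 1 := by
      rcases le_total 0 ((v : R3) 1) with h | h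
      · exact ⟨1, Or.inl rfl, by linarith⟩
      · exact ⟨-1, Or.inr rfl, by linarith⟩
    have hε2 : ε ^ 2 = 1 := by rcases hε with rfl | rfl <;> norm_num
    have ht : 2 * (ε * (v : R3) 2) ∈ Set.Icc (-1 : ℝ) 1 := by
      rw [abs_le] at hc
      rw [Set.mem_Icc]
      rcases hε with rfl | rfl <;> constructor <;> linarith
    have hr := parallelRadius_pos ht
    have hr2 := parallelRadius_sq ht
    obtain ⟨r, hrdef⟩ : ∃ r, r = parallelRadius (2 * (ε * (v : R3) 2)) := ⟨_, rfl⟩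
    rw [← hrdef] at hr hr2
    have hr3 : r ^ 2 = (v : R3) 0 ^ 2 + (v : R3) 1 ^ 2 := by
      rw [hr2]; linear_combination -hv - (v : R3) 2 ^ 2 * hε2
    have hx : |ε * (v : R3) 0 / r| ≤ 1 := by
      rw [abs_div, abs_of_pos hr, div_le_one hr]
      apply abs_le_of_sq_le_sq _ hr.le
      rw [hr3, mul_pow, hε2]
      nlinarith [sq_nonneg ((v : R3) 1)]
    rw [abs_le] at hx
    have hpi := Real.pi_pos
    refine ⟨(⟨Real.arccos (ε * (v : R3) 0 / r) / Real.pi,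
      div_nonneg (Real.arccos_nonneg _) hpi.le, (div_le_one hpi).2 (Real.arccos_le_pi _)⟩,
      ⟨2 * (ε * (v : R3) 2), ht⟩), hmk _ ε hε ?_⟩
    have hpc : Real.pi * (Real.arccos (ε * (v : R3) 0 / r) / Real.pi) =
      Real.arccos (ε * (v : R3) 0 / r) := mul_div_cancel₀ _ hpi.ne'
    intro i
    unfold stripSphere spherePoint
    dsimp only
    rw [hpc, ← hrdef, Real.cos_arccos hx.1 hx.2, Real.sin_arccos]
    fin_cases i
    · change r * (ε * (v : R3) 0 / r) = _
      exact mul_div_cancel₀ _ hr.ne'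
    · change r * √(1 - (ε * (v : R3) 0 / r) ^ 2) = ε * (v : R3) 1
      have : 1 - (ε * (v : R3) 0 / r) ^ 2 = (ε * (v : R3) 1 / r) ^ 2 := by
        field_simp
        linear_combination hr3 + ((v : R3) 0 ^ 2 + (v : R3) 1 ^ 2) * (-hε2)
      rw [this, Real.sqrt_sq (div_nonneg hε0 hr.le)]
      exact mul_div_cancel₀ _ hr.ne'
    · change 2 * (ε * (v : R3) 2) / 2 = ε * (v : R3) 2
      ring
  · right
    push Not at hc
    obtain ⟨ε, hε, hε0⟩ : ∃ ε : ℝ, (ε = 1 ∨ ε = -1) ∧ 1 / 2 < ε * (v : R3) 2 := by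
      rcases lt_abs.1 hc with h | h
      · exact ⟨1, Or.inl rfl, by linarith⟩
      · exact ⟨-1, Or.inr rfl, by linarith⟩
    have hε2 : ε ^ 2 = 1 := by rcases hε with rfl | rfl <;> norm_num
    have hc := capRadius_pos
    obtain ⟨z, hz⟩ : ∃ z : ℂ, z = ⟨ε * (v : R3) 0 / capRadius, ε * (v : R3) 1 / capRadius⟩ :=
      ⟨_, rfl⟩
    have hn : 3 / 4 * ‖z‖ ^ 2 = 1 - (ε * (v : R3) 2) ^ 2 := by
      rw [← sq_re_add_sq_im, hz, div_pow, div_pow, capRadius_sq]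
      linear_combination ε ^ 2 * hv + hε2
    have hz1 : ‖z‖ ≤ 1 := by
      rw [← sq_le_one_iff₀ (norm_nonneg _)]
      nlinarith
    refine ⟨⟨z, mem_closedBall_zero_iff.2 hz1⟩, hmk _ ε hε ?_⟩
    intro i
    unfold capSphere spherePoint
    dsimp only
    rw [hn, sub_sub_cancel, Real.sqrt_sq (by linarith), hz]
    fin_cases i
    · exact mul_div_cancel₀ _ hc.ne'
    · exact mul_div_cancel₀ _ hc.ne'
    · rfl

/-! ### The abstract surface is the projective plane -/

/-- The pizza is homeomorphic to the closed disk. -/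
def diskHomeo : Metric.closedBall (0 : ℂ) 1 ≃ₜ P :=
  Continuous.homeoOfEquivCompactToT2
    (f := Equiv.ofBijective (fun z => (⟨diskMap z, range_diskMap ▸ Set.mem_range_self z⟩ : P))
      ⟨fun _ _ h => diskMap_injective (Subtype.ext_iff.1 h), fun q => by
        obtain ⟨z, hz⟩ : (q : S3) ∈ Set.range diskMap := by rw [range_diskMap]; exact q.2
        exact ⟨z, Subtype.ext hz⟩⟩)
    (Continuous.subtype_mk diskMap.continuous _)

instance : CompactSpace P := diskHomeo.compactSpace

/-- The embedding of the Möbius band into the projective plane. -/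
def mobiusToRP2 : MobiusBand → RP2 :=
  Quot.lift (fun a => Quot.mk _ (stripSphere a)) fun _ _ h => stripSphere_eq_iff.2 (Or.inr (Or.inl h))

/-- Both `diskMap` on the unit circle and the position of the strip's boundary on the rim of the cap
are given by `winding`, so the two gluings coincide. -/
lemma attach_iff {x : MStar} {z : Metric.closedBall (0 : ℂ) 1} :
    Attach (Sum.inl x) (Sum.inr (diskHomeo z)) ↔
      mobiusToRP2 (toMobius x) = Quot.mk _ (capSphere z) := by
  obtain ⟨a, ha⟩ := Quot.exists_rep (toMobius x)
  have hw : bdWinding x = winding a := by unfold bdWinding; rw [← ha]; rfl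
  rw [← ha]
  change mapM x ∈ bdM ∧ (mapM x : S3) = diskMap z ↔
    (Quot.mk _ (stripSphere a) : RP2) = Quot.mk _ (capSphere z)
  rw [stripSphere_eq_capSphere_iff, ← toMobius_mem_boundary, ← ha, mobius_mk_mem_boundary]
  refine and_congr_right fun h => ?_
  have hx : mapM x ∈ bdM := by
    rw [← toMobius_mem_boundary, ← ha, mobius_mk_mem_boundary]; exact h
  have hb : bdWinding x ∈ Metric.closedBall (0 : ℂ) 1 :=
    mem_closedBall_zero_iff.2 (norm_bdWinding ⟨x, hx⟩).le
  rw [← diskMap_bdWinding ⟨x, hx⟩ hb, diskMap_injective.eq_iff, Subtype.ext_iff, ← hw]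

/-- The identification of the abstract surface with the projective plane. -/
def toRP2 : BoyStar → RP2 :=
  Quot.lift (Sum.elim (fun x => mobiusToRP2 (toMobius x))
    (fun q => Quot.mk _ (capSphere (diskHomeo.symm q)))) (by
    rintro (x | q) (y | r) h
    · exact h.elim
    · rw [← diskHomeo.apply_symm_apply r] at h
      exact attach_iff.1 h
    · exact h.elim
    · exact h.elim)

lemma continuous_toRP2 : Continuous toRP2 := by
  refine continuous_quot_lift _ (Continuous.sumElim ?_ ?_)
  · exact (continuous_quot_lift _ (continuous_quot_mk.comp continuous_stripSphere)).comp
      continuous_toMobius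
  · exact continuous_quot_mk.comp (continuous_capSphere.comp diskHomeo.symm.continuous)

lemma mobiusToRP2_injective : Function.Injective mobiusToRP2 := by
  rintro ⟨a⟩ ⟨b⟩ h
  exact mobius_mk_eq_iff.2 (stripSphere_eq_iff.1 h)

lemma toRP2_injective : Function.Injective toRP2 := by
  have key : ∀ (x : MStar) (q : P), mobiusToRP2 (toMobius x) =
      Quot.mk _ (capSphere (diskHomeo.symm q)) →
      (Quot.mk Attach (Sum.inl x) : BoyStar) = Quot.mk Attach (Sum.inr q) := by
    intro x q h
    refine Quot.sound ?_
    rw [← diskHomeo.apply_symm_apply q]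
    exact attach_iff.2 h
  rintro ⟨x | q⟩ ⟨y | r⟩ h
  · rw [toMobius_injective (mobiusToRP2_injective h)]
  · exact key x r h
  · exact (key y q h.symm).symm
  · rw [diskHomeo.symm.injective (capSphere_injective h)]

lemma toRP2_surjective : Function.Surjective toRP2 := by
  intro v
  rcases strip_or_cap v with ⟨a, rfl⟩ | ⟨z, rfl⟩
  · obtain ⟨x, hx⟩ := toMobius_surjective (Quot.mk _ a)
    refine ⟨Quot.mk _ (Sum.inl x), ?_⟩
    change mobiusToRP2 (toMobius x) = _
    rw [hx]; rfl
  · refine ⟨Quot.mk _ (Sum.inr (diskHomeo z)), ?_⟩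
    change (Quot.mk _ (capSphere (diskHomeo.symm (diskHomeo z))) : RP2) = _
    rw [diskHomeo.symm_apply_apply]

/-- The abstract surface is homeomorphic to the real projective plane. -/
def boyHomeo : BoyStar ≃ₜ RP2 :=
  Continuous.homeoOfEquivCompactToT2
    (f := Equiv.ofBijective toRP2 ⟨toRP2_injective, toRP2_surjective⟩) continuous_toRP2

instance : T2Space BoyStar := boyHomeo.isEmbedding.t2Space

lemma continuous_boyMap : Continuous boyMap :=
  continuous_quot_lift _ (Continuous.sumElim (OnePoint.continuous_coe.comp continuous_mapM)
    continuous_subtype_val)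

lemma range_boyMap : Set.range boyMap = inS3 M ∪ P := by
  ext q
  constructor
  · rintro ⟨⟨x | q⟩, rfl⟩
    · exact Or.inl ⟨mapM x, range_mapM ▸ Set.mem_range_self x, rfl⟩
    · exact Or.inr q.2
  · rintro (⟨p, hp, rfl⟩ | hq)
    · rw [← range_mapM] at hp
      obtain ⟨x, rfl⟩ := hp
      exact ⟨Quot.mk _ (Sum.inl x), rfl⟩
    · exact ⟨Quot.mk _ (Sum.inr ⟨q, hq⟩), rfl⟩

/-- The image of `M*` in the abstract surface. -/
def ofMStar (x : MStar) : BoyStar := Quot.mk _ (Sum.inl x)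

lemma continuous_ofMStar : Continuous ofMStar := continuous_quot_mk.comp continuous_inl

lemma ofMStar_injective : Function.Injective ofMStar := fun _ _ h =>
  toMobius_injective (mobiusToRP2_injective (congrArg toRP2 h))

/-- The only identifications made by `boyMap` are those made by `mapM`. -/
lemma boyMap_eq {u v : BoyStar} (h : boyMap u = boyMap v) :
    u = v ∨ ∃ x y, u = ofMStar x ∧ v = ofMStar y ∧ mapM x = mapM y := by
  have key : ∀ (x : MStar) (q : P), (mapM x : S3) = q → ofMStar x = Quot.mk _ (Sum.inr q) := by
    intro x q h
    refine Quot.sound ⟨?_, h⟩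
    have h1 : (mapM x : S3) ∈ inS3 M ∩ P :=
      ⟨⟨mapM x, range_mapM ▸ Set.mem_range_self x, rfl⟩, h ▸ q.2⟩
    rw [inS3_M_inter_P] at h1
    obtain ⟨p, hp, h2⟩ := h1
    rwa [← OnePoint.coe_injective h2]
  obtain ⟨x | q⟩ := u <;> obtain ⟨y | r⟩ := v
  · exact Or.inr ⟨x, y, rfl, rfl, OnePoint.coe_injective h⟩
  · exact Or.inl (key x r h)
  · exact Or.inl (key y q h.symm).symm
  · left
    rw [Subtype.ext (show (q : S3) = r from h)]

/-- By `boyMap_eq` the pizza creates no new coincidences. So at a point of `MStar` it suffices to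
remove the part of `MStar` outside a neighbourhood on which `mapM` is injective; off `MStar` its
whole compact image can be removed. -/
lemma boyMap_locally_injective (u : BoyStar) : ∃ U ∈ nhds u, Set.InjOn boyMap U := by
  by_cases hu : ∃ x, u = ofMStar x
  · obtain ⟨x, rfl⟩ := hu
    obtain ⟨N, hN, hinj⟩ := mapM_locally_injective x
    have hcl : IsClosed (ofMStar '' (interior N)ᶜ) :=
      (isOpen_interior.isClosed_compl.isCompact.image continuous_ofMStar).isClosed
    refine ⟨(ofMStar '' (interior N)ᶜ)ᶜ, hcl.isOpen_compl.mem_nhds ?_, ?_⟩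
    · rintro ⟨y, hy, h⟩
      rw [ofMStar_injective h] at hy
      exact hy (mem_interior_iff_mem_nhds.2 hN)
    · intro v hv w hw h
      rcases boyMap_eq h with h | ⟨y, z, rfl, rfl, hyz⟩
      · exact h
      · have hy : y ∈ N := by
          by_contra hy
          exact hv ⟨y, fun h => hy (interior_subset h), rfl⟩
        have hz : z ∈ N := by
          by_contra hz
          exact hw ⟨z, fun h => hz (interior_subset h), rfl⟩
        rw [hinj hy hz hyz]
  · have hcl : IsClosed (Set.range ofMStar) := (isCompact_range continuous_ofMStar).isClosed
    refine ⟨(Set.range ofMStar)ᶜ, hcl.isOpen_compl.mem_nhds ?_, ?_⟩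
    · rintro ⟨x, rfl⟩; exact hu ⟨x, rfl⟩
    · intro v hv w hw h
      rcases boyMap_eq h with h | ⟨y, z, rfl, rfl, h⟩
      · exact h
      · exact (hv ⟨y, rfl⟩).elim

lemma exists_immersed_RP2 : ∃ h : RP2 ≃ₜ BoyStar,
    IsTopologicalImmersion (boyMap ∘ h) ∧ Set.range (boyMap ∘ h) = inS3 M ∪ P := by
  have : CompactSpace RP2 := boyHomeo.compactSpace
  refine ⟨boyHomeo.symm, isTopologicalImmersion_of_locally_injective
    (continuous_boyMap.comp boyHomeo.symm.continuous) fun x => ?_, ?_⟩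
  · obtain ⟨U, hU, hinj⟩ := boyMap_locally_injective (boyHomeo.symm x)
    refine ⟨boyHomeo.symm ⁻¹' U, boyHomeo.symm.continuous.continuousAt hU, ?_⟩
    exact hinj.comp boyHomeo.symm.injective.injOn fun _ h => h
  · rw [boyHomeo.symm.surjective.range_comp, range_boyMap]

/-! ### Symmetries -/

/-- The reflection `(X,Y,Z) ↦ (-Y,-X,-Z)`. -/
def flipXY (p : R3) : R3 := !₂[-p 1, -p 0, -p 2]

@[simp] lemma flipXY_zero (p : R3) : flipXY p 0 = -p 1 := rfl
@[simp] lemma flipXY_one (p : R3) : flipXY p 1 = -p 0 := rfl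
@[simp] lemma flipXY_two (p : R3) : flipXY p 2 = -p 2 := rfl

/-- The reflection conjugates each rotation of the coordinates into its inverse, so it permutes the
cyclic images of any set it preserves. -/
lemma frame_flipXY (k : Fin 3) (p : R3) : frame k (flipXY p) = flipXY (frame (-k) p) := by
  fin_cases k <;> rfl

/-- The union of the cyclic images of a set. -/
def cyclicUnion (A : Set R3) : Set R3 := ⋃ k : Fin 3, cycled k A

lemma mem_cyclicUnion {A : Set R3} {p : R3} : p ∈ cyclicUnion A ↔ ∃ k, frame k p ∈ A := by
  unfold cyclicUnion; rw [Set.mem_iUnion]; rfl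

lemma frame_mem_cyclicUnion {A : Set R3} {j : Fin 3} {p : R3} :
    frame j p ∈ cyclicUnion A ↔ p ∈ cyclicUnion A := by
  simp only [mem_cyclicUnion, frame_frame]
  constructor
  · rintro ⟨k, h⟩; exact ⟨_, h⟩
  · rintro ⟨k, h⟩; exact ⟨-j + k, by rwa [add_neg_cancel_left]⟩

lemma flipXY_mem_cyclicUnion {A : Set R3} (hA : ∀ p, flipXY p ∈ A ↔ p ∈ A) {p : R3} :
    flipXY p ∈ cyclicUnion A ↔ p ∈ cyclicUnion A := by
  simp only [mem_cyclicUnion, frame_flipXY, hA]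
  constructor
  · rintro ⟨k, h⟩; exact ⟨_, h⟩
  · rintro ⟨k, h⟩; exact ⟨-k, by rwa [neg_neg]⟩

lemma symmetry_mem_cyclicUnion {A : Set R3} (hA : ∀ p, flipXY p ∈ A ↔ p ∈ A) {g : R3 ≃ₗᵢ[ℝ] R3}
    (hg : g ∈ symmetryGenerators) (p : R3) : g p ∈ cyclicUnion A ↔ p ∈ cyclicUnion A := by
  rcases hg with h | h | h | h
  · rw [h, show !₂[p 1, p 2, p 0] = frame 1 p from rfl, frame_mem_cyclicUnion]
  · rw [h, show !₂[-p 1, -p 0, -p 2] = flipXY p from rfl, flipXY_mem_cyclicUnion hA]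
  · rw [h, show !₂[-p 0, -p 2, -p 1] = frame 1 (flipXY p) from rfl, frame_mem_cyclicUnion,
      flipXY_mem_cyclicUnion hA]
  · rw [h, show !₂[-p 2, -p 1, -p 0] = frame 2 (flipXY p) from rfl, frame_mem_cyclicUnion,
      flipXY_mem_cyclicUnion hA]

lemma M_eq_cyclicUnion : M = cyclicUnion (flatPiece ∪ bandPiece) := by
  rw [M_eq_iUnion_piece]
  ext p
  rw [Set.mem_iUnion, mem_cyclicUnion]
  constructor
  · rintro ⟨k | k, h⟩
    · exact ⟨k, Or.inl h⟩
    · exact ⟨k, Or.inr h⟩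
  · rintro ⟨k, h | h⟩
    · exact ⟨Sum.inl k, h⟩
    · exact ⟨Sum.inr k, h⟩

lemma flipXY_mem_pieces (p : R3) : flipXY p ∈ flatPiece ∪ bandPiece ↔ p ∈ flatPiece ∪ bandPiece := by
  have hd : (-p 1 - 1) ^ 2 + (-p 0 + 1) ^ 2 = (p 0 - 1) ^ 2 + (p 1 + 1) ^ 2 := by ring
  refine or_congr ?_ ?_
  · rw [mem_flatPiece, mem_flatPiece, flatGauge_le_one, flatGauge_le_one]
    simp only [flipXY_zero, flipXY_one, flipXY_two, hd, abs_neg, neg_eq_zero, max_comm |p 1|,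
      add_comm ((|p 1| - 1) ^ 2)]
    tauto
  · rw [mem_bandPiece, mem_bandPiece]
    simp only [flipXY_zero, flipXY_one, flipXY_two, hd, abs_neg]
    rw [le_neg, neg_le_neg_iff, or_comm]

/-- The six kinds of boundary arcs. -/
def arc : Fin 6 → Set R3 :=
  ![road 1 1, sideBridge 1, road (-1) 1, sideBridge (-1), road (-1) (-1), outerBridge]

lemma boundary_arcs_eq :
    boundaryRoads ∪ boundaryBridges = {e | ∃ k : Fin 3, ∃ j : Fin 6, e = cycled k (arc j)} := by
  ext e
  constructor
  · rintro (⟨k, s, hs, t, ht, hst, rfl⟩ | ⟨k, rfl | ⟨s, hs, rfl⟩⟩)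
    · rcases hs with rfl | rfl <;> rcases ht with rfl | rfl
      · exact ⟨k, 0, rfl⟩
      · exact (hst ⟨rfl, rfl⟩).elim
      · exact ⟨k, 2, rfl⟩
      · exact ⟨k, 4, rfl⟩
    · exact ⟨k, 5, rfl⟩
    · rcases hs with rfl | rfl
      · exact ⟨k, 1, rfl⟩
      · exact ⟨k, 3, rfl⟩
  · rintro ⟨k, j, rfl⟩
    have h1 := one_mem_signs
    have h2 := neg_one_mem_signs
    fin_cases j
    · exact Or.inl ⟨k, 1, h1, 1, h1, by norm_num, rfl⟩
    · exact Or.inr ⟨k, Or.inr ⟨1, h1, rfl⟩⟩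
    · exact Or.inl ⟨k, -1, h2, 1, h1, by norm_num, rfl⟩
    · exact Or.inr ⟨k, Or.inr ⟨-1, h2, rfl⟩⟩
    · exact Or.inl ⟨k, -1, h2, -1, h2, by norm_num, rfl⟩
    · exact Or.inr ⟨k, Or.inl rfl⟩

lemma bdM_eq_cyclicUnion : bdM = cyclicUnion (⋃ j, arc j) := by
  unfold bdM
  rw [boundary_arcs_eq]
  ext p
  rw [mem_cyclicUnion]
  simp only [Set.mem_sUnion, Set.mem_iUnion]
  constructor
  · rintro ⟨_, ⟨k, j, rfl⟩, h⟩; exact ⟨k, j, h⟩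
  · rintro ⟨k, j, h⟩; exact ⟨_, ⟨k, j, rfl⟩, h⟩

lemma flipXY_mem_road {s t : ℝ} {p : R3} : flipXY p ∈ road s t ↔ p ∈ road (-t) (-s) := by
  unfold road
  simp only [Set.mem_ofPred_eq, flipXY_zero, flipXY_one, flipXY_two, abs_neg, neg_eq_zero]
  rw [show (-p 1 - s) ^ 2 + (-p 0 - t) ^ 2 = (p 0 - -t) ^ 2 + (p 1 - -s) ^ 2 by ring]
  tauto

lemma flipXY_mem_sideBridge {s : ℝ} {p : R3} : flipXY p ∈ sideBridge s ↔ p ∈ sideBridge (-s) := by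
  rw [mem_sideBridge, mem_sideBridge]
  simp only [flipXY_zero, flipXY_one, flipXY_two]
  rw [show (-p 1 - 1) ^ 2 + (-p 0 + 1) ^ 2 = (p 0 - 1) ^ 2 + (p 1 + 1) ^ 2 by ring, le_neg,
    neg_le_neg_iff, or_comm, neg_div, neg_eq_iff_eq_neg]

lemma flipXY_mem_outerBridge {p : R3} : flipXY p ∈ outerBridge ↔ p ∈ outerBridge := by
  unfold outerBridge outside
  simp only [Set.mem_inter_iff, Set.mem_ofPred_eq, flipXY_zero, flipXY_one, flipXY_two, abs_neg,
    neg_eq_zero, max_comm |p 1|]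
  rw [show (-p 1 - 1) ^ 2 + (-p 0 + 1) ^ 2 = (p 0 - 1) ^ 2 + (p 1 + 1) ^ 2 by ring]

lemma flipXY_mem_arcs (p : R3) : flipXY p ∈ ⋃ j, arc j ↔ p ∈ ⋃ j, arc j := by
  have key : ∀ p, flipXY p ∈ ⋃ j, arc j → p ∈ ⋃ j, arc j := by
    intro p h
    rw [Set.mem_iUnion] at h ⊢
    obtain ⟨j, h⟩ := h
    fin_cases j
    · exact ⟨4, by simpa [arc] using flipXY_mem_road.1 h⟩
    · exact ⟨3, by simpa [arc] using flipXY_mem_sideBridge.1 h⟩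
    · exact ⟨2, by simpa [arc] using flipXY_mem_road.1 h⟩
    · exact ⟨1, by simpa [arc] using flipXY_mem_sideBridge.1 h⟩
    · exact ⟨0, by simpa [arc] using flipXY_mem_road.1 h⟩
    · exact ⟨5, flipXY_mem_outerBridge.1 h⟩
  have hinv : flipXY (flipXY p) = p := ext3 (by simp) (by simp) (by simp)
  exact ⟨key p, fun h => key _ (by rwa [hinv])⟩

lemma mem_iff_of_mem_closure {A : Set R3}
    (hA : ∀ g ∈ symmetryGenerators, ∀ p, g p ∈ A ↔ p ∈ A) {g : R3 ≃ₗᵢ[ℝ] R3}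
    (hg : g ∈ Subgroup.closure symmetryGenerators) : ∀ p, g p ∈ A ↔ p ∈ A := by
  induction hg using Subgroup.closure_induction with
  | mem g hg => exact hA g hg
  | one => exact fun p => Iff.rfl
  | mul g h _ _ hg hh => exact fun p => (hg _).trans (hh p)
  | inv g _ hg =>
    intro p
    rw [← hg (g⁻¹ p)]
    exact iff_of_eq (congrArg (· ∈ A) (g.apply_symm_apply p))

lemma image_eq_of_mem_closure {A : Set R3}
    (hA : ∀ g ∈ symmetryGenerators, ∀ p, g p ∈ A ↔ p ∈ A) {g : R3 ≃ₗᵢ[ℝ] R3}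
    (hg : g ∈ Subgroup.closure symmetryGenerators) : g '' A = A := by
  have h := mem_iff_of_mem_closure hA hg
  ext q
  constructor
  · rintro ⟨p, hp, rfl⟩; exact (h p).2 hp
  · intro hq
    exact ⟨g.symm q, (h _).1 (by rwa [g.apply_symm_apply]), g.apply_symm_apply q⟩

lemma map_image_coneToInfinity (g : R3 ≃ₗᵢ[ℝ] R3) (S : Set R3) :
    OnePoint.map g '' coneToInfinity S = coneToInfinity (g '' S) := by
  ext q
  constructor
  · rintro ⟨_, ⟨_, ⟨p, hp, t, ht, rfl⟩, rfl⟩ | rfl, rfl⟩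
    · exact Or.inl ⟨_, ⟨g p, ⟨p, hp, rfl⟩, t, ht, rfl⟩, by simp⟩
    · exact Or.inr rfl
  · rintro (⟨_, ⟨_, ⟨p, hp, rfl⟩, t, ht, rfl⟩, rfl⟩ | rfl)
    · exact ⟨_, Or.inl ⟨_, ⟨p, hp, t, ht, rfl⟩, rfl⟩, by simp⟩
    · exact ⟨OnePoint.infty, Or.inr rfl, rfl⟩

lemma map_image_inS3 (g : R3 ≃ₗᵢ[ℝ] R3) (S : Set R3) :
    OnePoint.map g '' inS3 S = inS3 (g '' S) := by
  unfold inS3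
  rw [Set.image_image, Set.image_image]
  rfl

lemma symmetry_image {g : R3 ≃ₗᵢ[ℝ] R3} (hg : g ∈ Subgroup.closure symmetryGenerators) :
    g '' M = M ∧ OnePoint.map g '' P = P ∧ OnePoint.map g '' (inS3 M ∪ P) = inS3 M ∪ P := by
  have hM : g '' M = M := image_eq_of_mem_closure (fun g hg p => by
    rw [M_eq_cyclicUnion]; exact symmetry_mem_cyclicUnion flipXY_mem_pieces hg p) hg
  have hb : g '' bdM = bdM := image_eq_of_mem_closure (fun g hg p => by
    rw [bdM_eq_cyclicUnion]; exact symmetry_mem_cyclicUnion flipXY_mem_arcs hg p) hg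
  have hP : OnePoint.map g '' P = P := by
    unfold P; rw [map_image_coneToInfinity, hb]
  exact ⟨hM, hP, by rw [Set.image_union, map_image_inS3, hM, hP]⟩

/-! ### The symmetry group as the symmetric group on three letters -/

/-- The isometry permuting the coordinates and multiplying them by the sign of the permutation. -/
def signedPermFun (σ : Equiv.Perm (Fin 3)) (p : R3) : R3 :=
  WithLp.toLp 2 fun i => ((Equiv.Perm.sign σ : ℤ) : ℝ) * p (σ⁻¹ i)

@[simp] lemma signedPermFun_apply (σ : Equiv.Perm (Fin 3)) (p : R3) (i : Fin 3) :
    signedPermFun σ p i = ((Equiv.Perm.sign σ : ℤ) : ℝ) * p (σ⁻¹ i) := rfl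

lemma signedPermFun_mul (σ τ : Equiv.Perm (Fin 3)) (p : R3) :
    signedPermFun (σ * τ) p = signedPermFun σ (signedPermFun τ p) := by
  ext i
  simp [mul_assoc]
  rfl

lemma signedPermFun_one (p : R3) : signedPermFun 1 p = p := by
  ext i
  simp
  rfl

lemma sign_mul_self_real (σ : Equiv.Perm (Fin 3)) :
    ((Equiv.Perm.sign σ : ℤ) : ℝ) ^ 2 = 1 := by
  rcases Int.units_eq_one_or (Equiv.Perm.sign σ) with h | h <;> rw [h] <;> norm_num

/-- The action of the symmetric group on `ℝ³` by signed permutations. -/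
def signedPerm : Equiv.Perm (Fin 3) →* (R3 ≃ₗᵢ[ℝ] R3) where
  toFun σ :=
    { toFun := signedPermFun σ
      invFun := signedPermFun σ⁻¹
      map_add' := fun p q => by ext i; simp [mul_add]
      map_smul' := fun c p => by ext i; simp [mul_left_comm]
      left_inv := fun p => by rw [← signedPermFun_mul, inv_mul_cancel, signedPermFun_one]
      right_inv := fun p => by rw [← signedPermFun_mul, mul_inv_cancel, signedPermFun_one]
      norm_map' := fun p => by
        change ‖signedPermFun σ p‖ = ‖p‖
        rw [EuclideanSpace.norm_eq, EuclideanSpace.norm_eq]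
        congr 1
        rw [← Equiv.sum_comp σ⁻¹ fun i => ‖p i‖ ^ 2]
        refine Finset.sum_congr rfl fun i _ => ?_
        rw [Real.norm_eq_abs, Real.norm_eq_abs, sq_abs, sq_abs, signedPermFun_apply, mul_pow,
          sign_mul_self_real, one_mul] }
  map_one' := by ext p; exact congrFun (congrArg _ (signedPermFun_one p)) _
  map_mul' σ τ := by ext p; exact congrFun (congrArg _ (signedPermFun_mul σ τ p)) _

lemma signedPerm_apply (σ : Equiv.Perm (Fin 3)) (p : R3) : signedPerm σ p = signedPermFun σ p := rfl

/-- Squaring coordinates removes the sign, and the basis vectors then reveal the permutation. -/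
lemma signedPerm_injective : Function.Injective signedPerm := by
  rw [injective_iff_map_eq_one]
  intro σ h
  have h' : ∀ p, signedPermFun σ p = p := fun p => by rw [← signedPerm_apply, h]; rfl
  have key : ∀ i, σ⁻¹ i = i := by
    intro i
    have h1 := congrArg (fun q : R3 => q i ^ 2) (h' (EuclideanSpace.single i 1))
    simp only [signedPermFun_apply, mul_pow, sign_mul_self_real, one_mul] at h1
    simpa using h1
  exact inv_injective (Equiv.ext key)

lemma signedPerm_swap_mem {i j : Fin 3} (h : i ≠ j) :
    signedPerm (Equiv.swap i j) ∈ symmetryGenerators := by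
  have hs : Equiv.Perm.sign (Equiv.swap i j) = -1 := Equiv.Perm.sign_swap h
  have h0 : ∀ p : R3, signedPerm (Equiv.swap i j) p =
      !₂[-p (Equiv.swap i j 0), -p (Equiv.swap i j 1), -p (Equiv.swap i j 2)] := by
    intro p
    ext l
    rw [signedPerm_apply, signedPermFun_apply, hs, Equiv.swap_inv]
    fin_cases l <;> simp
  right
  fin_cases i <;> fin_cases j
  · exact (h rfl).elim
  · left; exact h0
  · right; right; exact h0
  · left; exact h0
  · exact (h rfl).elim
  · right; left; exact h0
  · right; right; exact h0
  · right; left; exact h0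
  · exact (h rfl).elim

/-- The generators are one 3-cycle, of sign `1`, and the three transpositions, of sign `-1`;
transpositions already generate. -/
lemma closure_symmetryGenerators :
    Subgroup.closure symmetryGenerators = signedPerm.range := by
  apply le_antisymm
  · rw [Subgroup.closure_le]
    intro g hg
    have key : ∀ σ : Equiv.Perm (Fin 3), (∀ p, g p = signedPermFun σ p) → g ∈ signedPerm.range :=
      fun σ h => ⟨σ, by ext p; rw [h]; rfl⟩
    rcases hg with h | h | h | h
    · refine key (finRotate 3)⁻¹ fun p => (h p).trans ?_
      ext l
      have : Equiv.Perm.sign (finRotate 3)⁻¹ = 1 := by decide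
      rw [signedPermFun_apply, this]
      fin_cases l <;> simp <;> rfl
    · refine key (Equiv.swap 0 1) fun p => (h p).trans ?_
      ext l
      rw [signedPermFun_apply, Equiv.Perm.sign_swap (by decide), Equiv.swap_inv]
      fin_cases l <;> simp [Equiv.swap_apply_def]
    · refine key (Equiv.swap 1 2) fun p => (h p).trans ?_
      ext l
      rw [signedPermFun_apply, Equiv.Perm.sign_swap (by decide), Equiv.swap_inv]
      fin_cases l <;> simp [Equiv.swap_apply_def]
    · refine key (Equiv.swap 0 2) fun p => (h p).trans ?_
      ext l
      rw [signedPermFun_apply, Equiv.Perm.sign_swap (by decide), Equiv.swap_inv]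
      fin_cases l <;> simp [Equiv.swap_apply_def]
  · rw [MonoidHom.range_eq_map, ← Equiv.Perm.closure_isSwap, MonoidHom.map_closure]
    apply Subgroup.closure_mono
    rintro _ ⟨σ, ⟨i, j, hij, rfl⟩, rfl⟩
    exact signedPerm_swap_mem hij

lemma card_closure_symmetryGenerators : Nat.card (Subgroup.closure symmetryGenerators) = 6 := by
  rw [closure_symmetryGenerators,
    ← Nat.card_congr (MonoidHom.ofInjective signedPerm_injective).toEquiv, Nat.card_eq_fintype_card,
    Fintype.card_perm]
  rfl

/-! ### Incidence of the boundary arcs -/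

/-- Linear constraints satisfied by the points of each kind of boundary arc. -/
def ArcBounds (x y z : ℝ) : Fin 6 → Prop
  | 0 => z = 0 ∧ 1 ≤ 3 * x ∧ x ≤ 1 ∧ 1 ≤ 3 * y ∧ y ≤ 1 ∧ x ≤ 3 * y ∧ y ≤ 3 * x
  | 1 => 3 * z = 1 ∧ 0 ≤ x ∧ y ≤ 0 ∧ (x = 0 → y = -1) ∧ (y = 0 → x = 1)
  | 2 => z = 0 ∧ 3 * x ≤ -1 ∧ -1 ≤ x ∧ 1 ≤ 3 * y ∧ y ≤ 1 ∧ -x ≤ 3 * y ∧ y ≤ -(3 * x)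
  | 3 => 3 * z = -1 ∧ 0 ≤ x ∧ y ≤ 0 ∧ (x = 0 → y = -1) ∧ (y = 0 → x = 1)
  | 4 => z = 0 ∧ 3 * x ≤ -1 ∧ -1 ≤ x ∧ 3 * y ≤ -1 ∧ -1 ≤ y ∧ 3 * x ≤ y ∧ 3 * y ≤ x
  | 5 => z = 0 ∧ 3 * y ≤ 1 ∧ -1 ≤ 3 * x ∧ 3 * y ≤ x ∧ y ≤ 3 * x ∧ (1 ≤ x ∨ y ≤ -1)

/-- The first vertex of each kind of boundary arc. -/
def startVertex : Fin 6 → R3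
  | 0 => !₂[1, 1 / 3, 0]
  | 1 => !₂[1, 0, 1 / 3]
  | 2 => !₂[-1, 1 / 3, 0]
  | 3 => !₂[1, 0, -1 / 3]
  | 4 => !₂[-1, -1 / 3, 0]
  | 5 => !₂[-1 / 3, -1, 0]

/-- The last vertex of each kind of boundary arc. -/
def stopVertex : Fin 6 → R3
  | 0 => !₂[1 / 3, 1, 0]
  | 1 => !₂[0, -1, 1 / 3]
  | 2 => !₂[-1 / 3, 1, 0]
  | 3 => !₂[0, -1, -1 / 3]
  | 4 => !₂[-1 / 3, -1, 0]
  | 5 => !₂[1, 1 / 3, 0]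

/-- The rotation of the frame from each boundary arc to the next one. -/
def turn : Fin 6 → Fin 3 := ![1, 1, 1, 1, 0, 0]

-- A common point of an arc in one frame and an arc in the next frame satisfies the bounds of both
-- after rotating the coordinates. These inequalities are contradictory except for the four
-- transitions that turn the frame, where they leave only the common vertex.
set_option maxHeartbeats 1000000 in
lemma arcBounds_rotated (j j' : Fin 6) {x y z : ℝ} (h : ArcBounds x y z j)
    (h' : ArcBounds y z x j') :
    j' = j + 1 ∧ turn j = 1 ∧ !₂[x, y, z] = stopVertex j := by
  match j, j' with
  | 0, 1 | 1, 2 | 2, 3 | 3, 4 =>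
    simp only [ArcBounds] at h h'
    refine ⟨rfl, rfl, ext3 ?_ ?_ ?_⟩ <;> simp [stopVertex] <;> grind
  | 0, 0 | 0, 2 | 0, 3 | 0, 4 | 0, 5 | 1, 0 | 1, 1 | 1, 3 | 1, 4 | 1, 5 | 2, 0 | 2, 1 | 2, 2 | 2, 4
  | 2, 5 | 3, 0 | 3, 1 | 3, 2 | 3, 3 | 3, 5 | 4, 0 | 4, 1 | 4, 2 | 4, 3 | 4, 4 | 4, 5 | 5, 0 | 5, 1
  | 5, 2 | 5, 3 | 5, 4 | 5, 5 =>
    simp only [ArcBounds] at h h'; grind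

set_option maxHeartbeats 1000000 in
lemma arcBounds_of_lt (j j' : Fin 6) {x y z : ℝ} (h : ArcBounds x y z j)
    (h' : ArcBounds x y z j') (hj : j < j') :
    (j' = j + 1 ∧ turn j = 0 ∧ !₂[x, y, z] = stopVertex j) ∨
    (j = j' + 1 ∧ turn j' = 0 ∧ !₂[x, y, z] = stopVertex j') := by
  match j, j', hj with
  | 4, 5, _ =>
    simp only [ArcBounds] at h h'
    refine Or.inl ⟨rfl, rfl, ext3 ?_ ?_ ?_⟩ <;> simp [stopVertex] <;> grind
  | 0, 5, _ =>
    simp only [ArcBounds] at h h'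
    refine Or.inr ⟨rfl, rfl, ext3 ?_ ?_ ?_⟩ <;> simp [stopVertex] <;> grind
  | 0, 1, _ | 0, 2, _ | 0, 3, _ | 0, 4, _ | 1, 2, _ | 1, 3, _ | 1, 4, _ | 1, 5, _ | 2, 3, _
  | 2, 4, _ | 2, 5, _ | 3, 4, _ | 3, 5, _ =>
    simp only [ArcBounds] at h h'; grind
  | 5, j', hj => omega

lemma road_coord_bounds {s x y : ℝ} (hs : s ∈ ({1, -1} : Set ℝ)) (hx : |x| ≤ 1)
    (h : (x - s) ^ 2 + y ^ 2 = (2 / 3 : ℝ) ^ 2) : 1 ≤ 3 * (s * x) ∧ s * x ≤ 1 := by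
  rw [abs_le] at hx
  rcases hs with rfl | rfl <;> constructor <;> nlinarith [sq_nonneg y]

lemma road_bounds {s t : ℝ} (hs : s ∈ ({1, -1} : Set ℝ)) (ht : t ∈ ({1, -1} : Set ℝ))
    (hst : ¬ (s = 1 ∧ t = -1)) {p : R3} (hp : p ∈ road s t) : p 2 = 0 ∧ 1 ≤ 3 * (s * p 0) ∧
      s * p 0 ≤ 1 ∧ 1 ≤ 3 * (t * p 1) ∧ t * p 1 ≤ 1 ∧ s * p 0 ≤ 3 * (t * p 1) ∧
      t * p 1 ≤ 3 * (s * p 0) := by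
  obtain ⟨h1, h2, h3, -⟩ := (mem_road hs ht hst).1 hp
  obtain ⟨h4, h5, -, h6⟩ := hp
  obtain ⟨h7, h8⟩ := road_coord_bounds hs h4 h6
  obtain ⟨h9, h10⟩ := road_coord_bounds ht h5 ((add_comm _ _).trans h6)
  exact ⟨h1, h7, h8, h9, h10, h2, h3⟩

lemma sideBridge_bounds {s : ℝ} {p : R3} (hp : p ∈ sideBridge s) : 3 * p 2 = s ∧ 0 ≤ p 0 ∧
    p 1 ≤ 0 ∧ (p 0 = 0 → p 1 = -1) ∧ (p 1 = 0 → p 0 = 1) := by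
  obtain ⟨h1, h2, -⟩ := mem_sideBridge.1 hp
  refine ⟨by linarith, by nlinarith [sq_nonneg (p 1 + 1)], by nlinarith [sq_nonneg (p 0 - 1)],
    fun h => ?_, fun h => ?_⟩
  · have : (p 1 + 1) ^ 2 = 0 := by rw [h] at h2; linarith
    nlinarith [pow_eq_zero_iff (two_ne_zero) |>.1 this]
  · have : (p 0 - 1) ^ 2 = 0 := by rw [h] at h2; linarith
    nlinarith [pow_eq_zero_iff (two_ne_zero) |>.1 this]

lemma outerBridge_bounds {p : R3} (hp : p ∈ outerBridge) : p 2 = 0 ∧ 3 * p 1 ≤ 1 ∧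
    -1 ≤ 3 * p 0 ∧ 3 * p 1 ≤ p 0 ∧ p 1 ≤ 3 * p 0 ∧ (1 ≤ p 0 ∨ p 1 ≤ -1) := by
  obtain ⟨h1, h2, h3, -⟩ := mem_outerBridge.1 hp
  obtain ⟨⟨-, h4⟩, h5⟩ := hp
  have h6 := (one_le_max_abs_iff (x := p 0) (y := p 1) h4.le).1 h5
  exact ⟨h1, by nlinarith [sq_nonneg (p 0 - 1)], by nlinarith [sq_nonneg (p 1 + 1)], h2, h3, h6⟩

lemma arcBounds_of_mem {j : Fin 6} {p : R3} (hp : p ∈ arc j) : ArcBounds (p 0) (p 1) (p 2) j := by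
  have h1 := one_mem_signs
  have h2 := neg_one_mem_signs
  match j with
  | 0 => simpa [ArcBounds] using road_bounds h1 h1 (by norm_num) hp
  | 1 => exact sideBridge_bounds hp
  | 2 =>
    obtain ⟨a, b, c, d, e, f, g⟩ := road_bounds h2 h1 (by norm_num) hp
    exact ⟨a, by linarith, by linarith, by linarith, by linarith, by linarith, by linarith⟩
  | 3 => exact sideBridge_bounds hp
  | 4 =>
    obtain ⟨a, b, c, d, e, f, g⟩ := road_bounds h2 h2 (by norm_num) hp
    exact ⟨a, by linarith, by linarith, by linarith, by linarith, by linarith, by linarith⟩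
  | 5 => exact outerBridge_bounds hp

/-- Two frames agree or differ by one rotation in one direction or the other, so `arcBounds_of_lt`
and `arcBounds_rotated` cover all pairs of arcs. -/
lemma arcs_inter {k k' : Fin 3} {j j' : Fin 6} {p : R3} (h : p ∈ cycled k (arc j))
    (h' : p ∈ cycled k' (arc j')) : (k' = k ∧ j' = j) ∨
      (k' = k + turn j ∧ j' = j + 1 ∧ p = frame (-k) (stopVertex j)) ∨
      (k = k' + turn j' ∧ j = j' + 1 ∧ p = frame (-k') (stopVertex j')) := by
  have key : ∀ (k : Fin 3) (j j' : Fin 6), p ∈ cycled k (arc j) → p ∈ cycled (k + 1) (arc j') →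
      k + 1 = k + turn j ∧ j' = j + 1 ∧ p = frame (-k) (stopVertex j) := by
    intro k j j' h h'
    have h1 := arcBounds_of_mem (mem_cycled.1 h)
    have h2 := arcBounds_of_mem (mem_cycled.1 h')
    simp only [frame_zero_apply, frame_one_apply, frame_two_apply, fin3_11, fin3_12] at h1 h2
    obtain ⟨a, b, c⟩ := arcBounds_rotated j j' h1 h2
    exact ⟨by rw [b], a, by rw [← c]; exact (frame_neg_frame k p).symm⟩
  have key0 : ∀ j j' : Fin 6, j < j' → p ∈ cycled k (arc j) → p ∈ cycled k (arc j') →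
      (k = k + turn j ∧ j' = j + 1 ∧ p = frame (-k) (stopVertex j)) ∨
      (k = k + turn j' ∧ j = j' + 1 ∧ p = frame (-k) (stopVertex j')) := by
    intro j j' hj h h'
    have h1 := arcBounds_of_mem (mem_cycled.1 h)
    have h2 := arcBounds_of_mem (mem_cycled.1 h')
    rcases arcBounds_of_lt j j' h1 h2 hj with ⟨a, b, c⟩ | ⟨a, b, c⟩
    · exact Or.inl ⟨by rw [b, add_zero], a, by rw [← c]; exact (frame_neg_frame k p).symm⟩
    · exact Or.inr ⟨by rw [b, add_zero], a, by rw [← c]; exact (frame_neg_frame k p).symm⟩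
  rcases fin3_cases k k' with rfl | rfl | rfl
  · rcases lt_trichotomy j j' with hj | rfl | hj
    · exact Or.inr (key0 _ _ hj h h')
    · exact Or.inl ⟨rfl, rfl⟩
    · exact Or.inr (key0 _ _ hj h' h).symm
  · exact Or.inr (Or.inl (key k j j' h h'))
  · have h3 : k + 2 + 1 = k := by rw [add_assoc]; exact add_zero k
    have := key (k + 2) j' j h' (by rwa [h3])
    rw [h3] at this
    exact Or.inr (Or.inr this)

/-! ### Parametrizing the boundary arcs -/

/-- `E` is an arc from `v` to `w`. -/
def IsArc (E : Set R3) (v w : R3) : Prop :=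
  ∃ γ : ℝ → R3, Continuous γ ∧ Set.InjOn γ (Set.Icc 0 1) ∧ γ '' Set.Icc 0 1 = E ∧ γ 0 = v ∧ γ 1 = w

lemma IsArc.left_mem {E : Set R3} {v w : R3} (h : IsArc E v w) : v ∈ E := by
  obtain ⟨γ, -, -, rfl, rfl, -⟩ := h
  exact ⟨0, by simp, rfl⟩

lemma IsArc.right_mem {E : Set R3} {v w : R3} (h : IsArc E v w) : w ∈ E := by
  obtain ⟨γ, -, -, rfl, -, rfl⟩ := h
  exact ⟨1, by simp, rfl⟩

lemma IsArc.ne {E : Set R3} {v w : R3} (h : IsArc E v w) : v ≠ w := by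
  obtain ⟨γ, -, hi, rfl, rfl, rfl⟩ := h
  intro h
  exact zero_ne_one (hi (by simp) (by simp) h)

lemma IsArc.cycled {E : Set R3} {v w : R3} (h : IsArc E v w) (k : Fin 3) :
    IsArc (cycled k E) (frame (-k) v) (frame (-k) w) := by
  obtain ⟨γ, hc, hi, rfl, rfl, rfl⟩ := h
  refine ⟨fun τ => frame (-k) (γ τ), (continuous_frame _).comp hc,
    fun a ha b hb hab => hi ha hb (frame_injective _ hab), ?_, rfl, rfl⟩
  ext p
  rw [mem_cycled]
  constructor
  · rintro ⟨τ, hτ, rfl⟩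
    exact ⟨τ, hτ, (frame_frame_neg k _).symm⟩
  · rintro ⟨τ, hτ, h⟩
    exact ⟨τ, hτ, by dsimp only; rw [h, frame_neg_frame]⟩

/-- An arc of the flat gauge circle in the sector spanned by two independent vectors. -/
lemma isArc_of_sector {E : Set R3} {v w : R3} {D : ℝ} (hD : D = v 0 * w 1 - v 1 * w 0)
    (hD0 : D ≠ 0) (hE : ∀ p : R3, p ∈ E ↔ p 2 = 0 ∧ 0 ≤ D * (p 0 * w 1 - p 1 * w 0) ∧
      0 ≤ D * (v 0 * p 1 - v 1 * p 0) ∧ flatGauge (p 0) (p 1) = 1)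
    (hv : v ∈ E) (hw : w ∈ E) : IsArc E v w := by
  obtain ⟨hv2, -, -, hvg⟩ := (hE v).1 hv
  obtain ⟨hw2, -, -, hwg⟩ := (hE w).1 hw
  -- The segment from `v` to `w` is projected radially to the gauge circle; by independence it
  -- avoids the origin and meets each ray once. The factors `D` in the sector conditions make them
  -- independent of orientation.
  let x : ℝ → ℝ := fun τ => (1 - τ) * v 0 + τ * w 0
  let y : ℝ → ℝ := fun τ => (1 - τ) * v 1 + τ * w 1
  have hcross : ∀ τ τ', x τ * y τ' - y τ * x τ' = (τ' - τ) * D := by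
    intro τ τ'; simp only [x, y, hD]; ring
  have hpos : ∀ τ, 0 < flatGauge (x τ) (y τ) := by
    intro τ
    refine flatGauge_pos fun h => hD0 ?_
    have := hcross τ (τ + 1)
    rw [h.1, h.2] at this
    linarith
  have hcont : Continuous fun τ => flatGauge (x τ) (y τ) :=
    continuous_flatGauge.comp (by fun_prop : Continuous fun τ => (x τ, y τ))
  let γ : ℝ → R3 := fun τ => !₂[x τ / flatGauge (x τ) (y τ), y τ / flatGauge (x τ) (y τ), 0]
  have hγ : Continuous γ := by
    have h1 : Continuous fun τ => x τ / flatGauge (x τ) (y τ) :=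
      Continuous.div (by fun_prop) hcont fun τ => (hpos τ).ne'
    have h2 : Continuous fun τ => y τ / flatGauge (x τ) (y τ) :=
      Continuous.div (by fun_prop) hcont fun τ => (hpos τ).ne'
    fun_prop
  refine ⟨γ, hγ, ?_, ?_, ?_, ?_⟩
  · intro a _ b _ hab
    have h0 : x a / flatGauge (x a) (y a) = x b / flatGauge (x b) (y b) :=
      congrArg (fun p : R3 => p 0) hab
    have h1 : y a / flatGauge (x a) (y a) = y b / flatGauge (x b) (y b) :=
      congrArg (fun p : R3 => p 1) hab
    have ha := (hpos a).ne'
    have hb := (hpos b).ne'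
    rw [div_eq_div_iff ha hb] at h0 h1
    have h2 : (b - a) * D * flatGauge (x a) (y a) = 0 := by
      rw [← hcross]
      linear_combination y a * h0 - x a * h1
    have h3 : b - a = 0 := by
      rcases mul_eq_zero.1 h2 with h | h
      · exact (mul_eq_zero.1 h).resolve_right hD0
      · exact absurd h ha
    linarith
  · ext p
    rw [hE]
    constructor
    · rintro ⟨τ, hτ, rfl⟩
      have hg := hpos τ
      refine ⟨rfl, ?_, ?_, ?_⟩
      · change 0 ≤ D * (x τ / _ * w 1 - y τ / _ * w 0)
        rw [show D * (x τ / flatGauge (x τ) (y τ) * w 1 - y τ / flatGauge (x τ) (y τ) * w 0) =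
          D ^ 2 * (1 - τ) / flatGauge (x τ) (y τ) by
            rw [show D ^ 2 * (1 - τ) = D * (x τ * w 1 - y τ * w 0) by
              simp only [x, y]; rw [hD]; ring]
            ring]
        exact div_nonneg (mul_nonneg (sq_nonneg _) (by linarith [hτ.2])) hg.le
      · change 0 ≤ D * (v 0 * (y τ / _) - v 1 * (x τ / _))
        rw [show D * (v 0 * (y τ / flatGauge (x τ) (y τ)) - v 1 * (x τ / flatGauge (x τ) (y τ))) =
          D ^ 2 * τ / flatGauge (x τ) (y τ) by
            rw [show D ^ 2 * τ = D * (v 0 * y τ - v 1 * x τ) by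
              simp only [x, y]; rw [hD]; ring]
            ring]
        exact div_nonneg (mul_nonneg (sq_nonneg _) hτ.1) hg.le
      · change flatGauge (x τ / _) (y τ / _) = 1
        rw [div_eq_inv_mul, div_eq_inv_mul, flatGauge_smul (inv_nonneg.2 hg.le),
          inv_mul_cancel₀ hg.ne']
    · rintro ⟨h2, ha, hb, hg⟩
      -- By Cramer's rule `D p = a v + b w`, so the ray through `p` meets the segment at parameter
      -- `b / (a + b)`.
      set a := p 0 * w 1 - p 1 * w 0 with ha'
      set b := v 0 * p 1 - v 1 * p 0 with hb'
      have e0 : D * p 0 = a * v 0 + b * w 0 := by rw [ha', hb', hD]; ring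
      have e1 : D * p 1 = a * v 1 + b * w 1 := by rw [ha', hb', hD]; ring
      have hDD : 0 < D * D := mul_self_pos.2 hD0
      have hab : 0 < D * (a + b) := by
        refine lt_of_le_of_ne (by linarith) fun h => ?_
        have ha0 : a = 0 := by
          have : D * a = 0 := by linarith
          exact (mul_eq_zero.1 this).resolve_left hD0
        have hb0 : b = 0 := by
          have : D * b = 0 := by linarith
          exact (mul_eq_zero.1 this).resolve_left hD0
        rw [ha0, hb0] at e0 e1
        have p0 : p 0 = 0 := (mul_eq_zero.1 (by linarith : D * p 0 = 0)).resolve_left hD0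
        have p1 : p 1 = 0 := (mul_eq_zero.1 (by linarith : D * p 1 = 0)).resolve_left hD0
        have := flatGauge_smul le_rfl 1 1
        rw [p0, p1] at hg
        simp [hg] at this
      have hs : a + b ≠ 0 := fun h => by rw [h] at hab; simp at hab
      have hτ : b / (a + b) = D * b / (D * (a + b)) := by rw [mul_div_mul_left _ _ hD0]
      have hx : x (b / (a + b)) = D / (a + b) * p 0 := by
        simp only [x]
        field_simp
        linear_combination -e0
      have hy : y (b / (a + b)) = D / (a + b) * p 1 := by
        simp only [y]
        field_simp
        linear_combination -e1
      have hc : 0 < D / (a + b) := by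
        rw [show D / (a + b) = D * D / (D * (a + b)) by rw [mul_div_mul_left _ _ hD0]]
        positivity
      refine ⟨b / (a + b), ⟨?_, ?_⟩, ?_⟩
      · rw [hτ]; positivity
      · rw [hτ, div_le_one hab]; linarith
      · have hgg : flatGauge (x (b / (a + b))) (y (b / (a + b))) = D / (a + b) := by
          rw [hx, hy, flatGauge_smul hc.le, hg, mul_one]
        refine ext3 ?_ ?_ h2.symm
        · change x _ / flatGauge _ _ = _
          rw [hgg, hx, mul_div_cancel_left₀ _ hc.ne']
        · change y _ / flatGauge _ _ = _
          rw [hgg, hy, mul_div_cancel_left₀ _ hc.ne']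
  · refine ext3 ?_ ?_ hv2.symm
    · change x 0 / flatGauge (x 0) (y 0) = _
      simp [x, y, hvg]
    · change y 0 / flatGauge (x 0) (y 0) = _
      simp [x, y, hvg]
  · refine ext3 ?_ ?_ hw2.symm
    · change x 1 / flatGauge (x 1) (y 1) = _
      simp [x, y, hwg]
    · change y 1 / flatGauge (x 1) (y 1) = _
      simp [x, y, hwg]

lemma isArc_sideBridge (s : ℝ) : IsArc (sideBridge s) !₂[1, 0, s / 3] !₂[0, -1, s / 3] := by
  refine ⟨fun τ => !₂[1 + arcU (3 - 5 * τ), -1 + arcV (3 - 5 * τ), s / 3], ?_, ?_, ?_, ?_, ?_⟩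
  · have h1 := continuous_arcU
    have h2 := continuous_arcV
    fun_prop
  · intro a _ b _ h
    have h0 : 1 + arcU (3 - 5 * a) = 1 + arcU (3 - 5 * b) := congrArg (fun p : R3 => p 0) h
    have h1 : -1 + arcV (3 - 5 * a) = -1 + arcV (3 - 5 * b) := congrArg (fun p : R3 => p 1) h
    have h2 := arcParam_arc (3 - 5 * a)
    rw [h0, h1, arcParam_arc] at h2
    linarith
  · ext p
    rw [mem_sideBridge]
    constructor
    · rintro ⟨τ, hτ, rfl⟩
      refine ⟨rfl, ?_, (arc_outside_iff _).2 ⟨by linarith [hτ.2], by linarith [hτ.1]⟩⟩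
      simpa using arc_circle (3 - 5 * τ)
    · rintro ⟨h1, h2, h3⟩
      obtain ⟨h4, h5⟩ := arcParam_mem h2 h3
      obtain ⟨h6, h7⟩ := arc_arcParam h2 h3
      refine ⟨(3 - arcParam (p 0) (p 1)) / 5, ⟨by linarith, by linarith⟩, ?_⟩
      have h8 : 3 - 5 * ((3 - arcParam (p 0) (p 1)) / 5) = arcParam (p 0) (p 1) := by ring
      dsimp only
      rw [h8, h6, h7, ← h1]
      exact ext3 rfl rfl rfl
  · norm_num
  · norm_num

lemma isArc_arc (j : Fin 6) : IsArc (arc j) (startVertex j) (stopVertex j) := by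
  have h1 := one_mem_signs
  have h2 := neg_one_mem_signs
  match j with
  | 0 =>
    refine isArc_of_sector (D := 8 / 9) ?_ (by norm_num) (fun p => ?_) ?_ ?_
    · norm_num [startVertex, stopVertex]
    · change p ∈ road 1 1 ↔ _
      rw [mem_road h1 h1 (by norm_num)]
      simp only [startVertex, stopVertex, Matrix.cons_val]
      constructor <;> rintro ⟨a, b, c, d⟩ <;> exact ⟨a, by linarith, by linarith, d⟩
    · refine ⟨?_, ?_, rfl, ?_⟩ <;> norm_num [startVertex, abs_le]
    · refine ⟨?_, ?_, rfl, ?_⟩ <;> norm_num [stopVertex, abs_le]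
  | 1 => exact isArc_sideBridge 1
  | 2 =>
    refine isArc_of_sector (D := -8 / 9) ?_ (by norm_num) (fun p => ?_) ?_ ?_
    · norm_num [startVertex, stopVertex]
    · change p ∈ road (-1) 1 ↔ _
      rw [mem_road h2 h1 (by norm_num)]
      simp only [startVertex, stopVertex, Matrix.cons_val]
      constructor <;> rintro ⟨a, b, c, d⟩ <;> exact ⟨a, by linarith, by linarith, d⟩
    · refine ⟨?_, ?_, rfl, ?_⟩ <;> norm_num [startVertex, abs_le]
    · refine ⟨?_, ?_, rfl, ?_⟩ <;> norm_num [stopVertex, abs_le]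
  | 3 => exact isArc_sideBridge (-1)
  | 4 =>
    refine isArc_of_sector (D := 8 / 9) ?_ (by norm_num) (fun p => ?_) ?_ ?_
    · norm_num [startVertex, stopVertex]
    · change p ∈ road (-1) (-1) ↔ _
      rw [mem_road h2 h2 (by norm_num)]
      simp only [startVertex, stopVertex, Matrix.cons_val]
      constructor <;> rintro ⟨a, b, c, d⟩ <;> exact ⟨a, by linarith, by linarith, d⟩
    · refine ⟨?_, ?_, rfl, ?_⟩ <;> norm_num [startVertex, abs_le]
    · refine ⟨?_, ?_, rfl, ?_⟩ <;> norm_num [stopVertex, abs_le]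
  | 5 =>
    refine isArc_of_sector (D := 8 / 9) ?_ (by norm_num) (fun p => ?_) ?_ ?_
    · norm_num [startVertex, stopVertex]
    · change p ∈ outerBridge ↔ _
      rw [mem_outerBridge]
      simp only [startVertex, stopVertex, Matrix.cons_val]
      constructor <;> rintro ⟨a, b, c, d⟩ <;> exact ⟨a, by linarith, by linarith, d⟩
    · refine ⟨⟨rfl, ?_⟩, ?_⟩ <;> norm_num [outside, startVertex]
    · refine ⟨⟨rfl, ?_⟩, ?_⟩ <;> norm_num [outside, stopVertex]

/-! ### Cones over arcs -/

/-- By `conePoint_inj`, a common finite point determines its base point on `bdM`, which therefore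
lies on both arcs. -/
lemma coneToInfinity_inter {E F : Set R3} (hE : E ⊆ bdM) (hF : F ⊆ bdM) :
    coneToInfinity E ∩ coneToInfinity F = coneToInfinity (E ∩ F) := by
  ext q
  simp only [Set.mem_inter_iff, mem_coneToInfinity]
  constructor
  · rintro ⟨rfl | ⟨p, hp, s, hs, hs1, rfl⟩, h⟩
    · exact Or.inl rfl
    · rcases h with h | ⟨p', hp', t, ht, ht1, h⟩
      · exact Or.inl h
      · obtain ⟨-, h1 | rfl⟩ := conePoint_inj (hE hp) (hF hp') hs.le ht.le h
        · exact absurd h1 hs.ne'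
        · exact Or.inr ⟨p, ⟨hp, hp'⟩, s, hs, hs1, rfl⟩
  · rintro (rfl | ⟨p, ⟨hp, hp'⟩, s, hs, hs1, rfl⟩)
    · exact ⟨Or.inl rfl, Or.inl rfl⟩
    · exact ⟨Or.inr ⟨p, hp, s, hs, hs1, rfl⟩, Or.inr ⟨p, hp', s, hs, hs1, rfl⟩⟩

lemma coneToInfinity_empty : coneToInfinity ∅ = {OnePoint.infty} := by
  ext q
  simp [mem_coneToInfinity]

lemma coneToInfinity_iUnion {ι : Type*} [Nonempty ι] (E : ι → Set R3) :
    coneToInfinity (⋃ i, E i) = ⋃ i, coneToInfinity (E i) := by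
  ext q
  simp only [Set.mem_iUnion, mem_coneToInfinity]
  constructor
  · rintro (rfl | ⟨p, ⟨i, hp⟩, h⟩)
    · exact ⟨Classical.arbitrary ι, Or.inl rfl⟩
    · exact ⟨i, Or.inr ⟨p, hp, h⟩⟩
  · rintro ⟨i, rfl | ⟨p, hp, h⟩⟩
    · exact Or.inl rfl
    · exact Or.inr ⟨p, ⟨i, hp⟩, h⟩

lemma coneToInfinity_subset_iff {E C : Set R3} (hC : ∀ p ∈ C, ∀ t : ℝ, 1 ≤ t → t • p ∈ C) :
    coneToInfinity E ⊆ inS3 C ∪ {OnePoint.infty} ↔ E ⊆ C := by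
  constructor
  · intro h p hp
    rcases h (Or.inl ⟨p, ⟨p, hp, 1, le_rfl, (one_smul ℝ p).symm⟩, rfl⟩) with ⟨q, hq, h⟩ | h
    · rwa [← OnePoint.coe_injective h]
    · exact absurd h (OnePoint.coe_ne_infty p)
  · rintro h _ (⟨_, ⟨p, hp, t, ht, rfl⟩, rfl⟩ | h')
    · exact Or.inl ⟨_, hC p (h hp) t ht, rfl⟩
    · exact Or.inr h'

/-- A triangle is the cone from vertex `0` over the opposite side: `s` is the distance parameter and
`r` the position along that side. `r` is discontinuous only at the apex, where
`continuous_conePoint` does not need it. -/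
lemma IsArc.isTopologicalTriangle {E : Set R3} {v w : R3} (h : IsArc E v w) (hE : E ⊆ bdM) :
    IsTopologicalTriangle (coneToInfinity E) ![OnePoint.infty, (v : S3), (w : S3)]
      ![inS3 E, coneToInfinity {w}, coneToInfinity {v}] := by
  obtain ⟨γ, hc, hi, rfl, rfl, rfl⟩ := h
  obtain ⟨c, hc0, hcb⟩ := exists_norm_lower_bound
  have hnn : ∀ (x : stdSimplex ℝ (Fin 3)) j, 0 ≤ x.1 j := fun x => x.2.1
  have hsum : ∀ x : stdSimplex ℝ (Fin 3), x.1 0 + x.1 1 + x.1 2 = 1 := fun x => by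
    have := x.2.2; rwa [Fin.sum_univ_three] at this
  let s : stdSimplex ℝ (Fin 3) → ℝ := fun x => x.1 1 + x.1 2
  let r : stdSimplex ℝ (Fin 3) → ℝ := fun x => x.1 2 / s x
  have hs0 : ∀ x, 0 ≤ s x := fun x => add_nonneg (hnn x 1) (hnn x 2)
  have hs1 : ∀ x, s x ≤ 1 := fun x => by have := hnn x 0; have := hsum x; simp only [s]; linarith
  have hr : ∀ x, r x ∈ Set.Icc (0 : ℝ) 1 := fun x =>
    ⟨div_nonneg (hnn x 2) (hs0 x), div_le_one_of_le₀ (by simp only [s]; linarith [hnn x 1]) (hs0 x)⟩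
  have hxc : ∀ j, Continuous fun x : stdSimplex ℝ (Fin 3) => x.1 j := fun j =>
    (continuous_apply j).comp continuous_subtype_val
  have hsc : Continuous s := (hxc 1).add (hxc 2)
  have hmem : ∀ x, γ (r x) ∈ bdM := fun x => hE ⟨r x, hr x, rfl⟩
  let φ : stdSimplex ℝ (Fin 3) → S3 := fun x => conePoint (s x) (γ (r x))
  have hφ : Continuous φ := by
    refine continuous_conePoint hsc hs0 (fun x hx => ?_) hc0 fun x _ => hcb _ (hmem x)
    exact hc.continuousAt.comp ((hxc 2).continuousAt.div hsc.continuousAt hx)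
  have hmk : ∀ a ∈ Set.Icc (0 : ℝ) 1, ∀ b ∈ Set.Icc (0 : ℝ) 1,
      ![1 - a, a * (1 - b), a * b] ∈ stdSimplex ℝ (Fin 3) := by
    rintro a ⟨ha0, ha1⟩ b ⟨hb0, hb1⟩
    refine ⟨fun j => ?_, ?_⟩
    · fin_cases j
      · exact sub_nonneg.2 ha1
      · exact mul_nonneg ha0 (sub_nonneg.2 hb1)
      · exact mul_nonneg ha0 hb0
    · rw [Fin.sum_univ_three]
      simp only [Matrix.cons_val]
      ring
  have hφmk : ∀ a (ha : a ∈ Set.Icc (0 : ℝ) 1) b (hb : b ∈ Set.Icc (0 : ℝ) 1),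
      φ ⟨_, hmk a ha b hb⟩ = conePoint a (γ b) := by
    intro a ha b hb
    have h1 : s ⟨_, hmk a ha b hb⟩ = a := by
      simp only [s, Matrix.cons_val]; ring
    simp only [φ, r, h1]
    by_cases h0 : a = 0
    · rw [h0, conePoint_zero, conePoint_zero]
    · simp only [Matrix.cons_val]
      rw [mul_div_cancel_left₀ _ h0]
  refine ⟨φ, (hφ.isClosedEmbedding ?_).isEmbedding, ?_, ?_, ?_⟩
  · intro x y hxy
    obtain ⟨h1, h2⟩ := conePoint_inj (hmem x) (hmem y) (hs0 x) (hs0 y) hxy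
    have h3 : x.1 2 = y.1 2 := by
      rcases h2 with h2 | h2
      · have := hnn x 1; have := hnn x 2; have := hnn y 1; have := hnn y 2
        rw [h2] at h1
        simp only [s] at h1 h2
        linarith
      · have h4 := hi (hr x) (hr y) h2
        by_cases h0 : s x = 0
        · have h0' := h1.symm.trans h0
          have := hnn x 1; have := hnn x 2; have := hnn y 1; have := hnn y 2
          simp only [s] at h0 h0'
          linarith
        · simp only [r, ← h1] at h4
          exact (div_left_inj' h0).1 h4
    have h4 : x.1 1 = y.1 1 := by simp only [s] at h1; linarith
    have h5 : x.1 0 = y.1 0 := by linarith [hsum x, hsum y]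
    apply Subtype.ext
    funext j
    fin_cases j <;> assumption
  · ext q
    rw [mem_coneToInfinity]
    constructor
    · rintro ⟨x, rfl⟩
      by_cases h0 : s x = 0
      · left; simp only [φ, h0, conePoint_zero]
      · exact Or.inr ⟨_, ⟨r x, hr x, rfl⟩, s x, (hs0 x).lt_of_ne' h0, hs1 x, rfl⟩
    · rintro (rfl | ⟨_, ⟨b, hb, rfl⟩, a, ha, ha1, rfl⟩)
      · exact ⟨_, (hφmk 0 (by simp) 0 (by simp)).trans (conePoint_zero _)⟩
      · exact ⟨_, hφmk a ⟨ha.le, ha1⟩ b hb⟩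
  · intro x j hj
    have h0 := hnn x 0
    have h1 := hnn x 1
    have h2 := hnn x 2
    have h3 := hsum x
    fin_cases j
    · have h4 : x.1 0 = 1 := hj
      have h5 : s x = 0 := by simp only [s]; linarith
      simp [φ, h5]
    · have h4 : x.1 1 = 1 := hj
      have h5 : s x = 1 := by simp only [s]; linarith
      have h6 : x.1 2 = 0 := by linarith
      simp [φ, r, h5, h6]
    · have h4 : x.1 2 = 1 := hj
      have h5 : s x = 1 := by simp only [s]; linarith
      simp [φ, r, h5, h4]
  · have hside : ∀ b ∈ Set.Icc (0 : ℝ) 1, ∀ j : Fin 3,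
        (∀ x : stdSimplex ℝ (Fin 3), x.1 j = 0 → s x = 0 ∨ r x = b) →
        (∀ a, ![1 - a, a * (1 - b), a * b] j = 0) →
        φ '' {x | x.1 j = 0} = coneToInfinity {γ b} := by
      intro b hb j hj hj'
      ext q
      rw [mem_coneToInfinity]
      constructor
      · rintro ⟨x, hx, rfl⟩
        by_cases h0 : s x = 0
        · left; simp only [φ, h0, conePoint_zero]
        · have h1 := (hj x hx).resolve_left h0
          exact Or.inr ⟨_, rfl, s x, (hs0 x).lt_of_ne' h0, hs1 x, by simp only [φ, h1]⟩
      · rintro (rfl | ⟨_, rfl, a, ha, ha1, rfl⟩)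
        · exact ⟨_, hj' 0, (hφmk 0 (by simp) b hb).trans (conePoint_zero _)⟩
        · exact ⟨_, hj' a, hφmk a ⟨ha.le, ha1⟩ b hb⟩
    intro j
    fin_cases j
    · ext q
      constructor
      · rintro ⟨x, hx, rfl⟩
        have h1 : s x = 1 := by
          have h0 : x.1 0 = 0 := hx
          have := hsum x
          simp only [s]; linarith
        exact ⟨γ (r x), ⟨r x, hr x, rfl⟩, by simp [φ, h1]⟩
      · rintro ⟨_, ⟨b, hb, rfl⟩, rfl⟩
        refine ⟨⟨_, hmk 1 (by simp) b hb⟩, ?_, (hφmk 1 (by simp) b hb).trans (conePoint_one _)⟩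
        exact sub_self 1
    · refine hside 1 (by simp) 1 (fun x hx => ?_) fun a => by simp
      have h1 : s x = x.1 2 := by simp only [s, hx, zero_add]
      by_cases h0 : s x = 0
      · exact Or.inl h0
      · right; simp only [r]; rw [← h1, div_self h0]
    · refine hside 0 (by simp) 2 (fun x hx => Or.inr ?_) fun a => by simp
      simp only [r, hx, zero_div]

/-! ### The cyclic labelling of the boundary arcs -/

/-- The kind of the `i`-th edge of the boundary. -/
def edgeKind (i : ZMod 18) : Fin 6 := Fin.ofNat 6 i.val

/-- The frame of the `i`-th edge of the boundary. -/
def edgeFrame (i : ZMod 18) : Fin 3 :=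
  Fin.ofNat 3 (i.val / 6) + ![0, 1, 2, 0, 1, 1] (edgeKind i)

/-- The edges of the boundary. -/
def edge (i : ZMod 18) : Set R3 := cycled (edgeFrame i) (arc (edgeKind i))

/-- The vertices of the boundary. -/
def vertex (i : ZMod 18) : R3 := frame (-edgeFrame i) (startVertex (edgeKind i))

lemma edgeKind_succ : ∀ i, edgeKind (i + 1) = edgeKind i + 1 := by decide

/-- The table in `edgeFrame` lists the partial sums of `turn` modulo `3`. Six edges turn the frame
by `4 ≡ 1`, which is why the boundary closes up only after `18` edges. -/
lemma edgeFrame_succ : ∀ i, edgeFrame (i + 1) = edgeFrame i + turn (edgeKind i) := by decide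

lemma exists_edge : ∀ k j, ∃ i, edgeFrame i = k ∧ edgeKind i = j := by decide

lemma edge_index_injective :
    ∀ i i', edgeFrame i' = edgeFrame i → edgeKind i' = edgeKind i → i' = i := by decide

lemma frame_neg_turn_startVertex (j : Fin 6) :
    frame (-turn j) (startVertex (j + 1)) = stopVertex j := by
  match j with
  | 0 | 1 | 2 | 3 | 4 | 5 => exact ext3 rfl rfl rfl

lemma vertex_succ (i : ZMod 18) :
    vertex (i + 1) = frame (-edgeFrame i) (stopVertex (edgeKind i)) := by
  unfold vertex
  rw [edgeKind_succ, edgeFrame_succ, neg_add_rev, ← frame_neg_turn_startVertex, frame_frame]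

lemma range_edge : Set.range edge = boundaryRoads ∪ boundaryBridges := by
  rw [boundary_arcs_eq]
  ext E
  constructor
  · rintro ⟨i, rfl⟩; exact ⟨_, _, rfl⟩
  · rintro ⟨k, j, rfl⟩
    obtain ⟨i, rfl, rfl⟩ := exists_edge k j
    exact ⟨i, rfl⟩

lemma edge_subset_bdM (i : ZMod 18) : edge i ⊆ bdM :=
  Set.subset_sUnion_of_mem (range_edge ▸ Set.mem_range_self i)

lemma isArc_edge (i : ZMod 18) : IsArc (edge i) (vertex i) (vertex (i + 1)) := by
  rw [vertex_succ]
  exact (isArc_arc _).cycled _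

lemma edge_inter_cases {i i' : ZMod 18} {p : R3} (h : p ∈ edge i) (h' : p ∈ edge i') :
    i' = i ∨ (i' = i + 1 ∧ p = vertex (i + 1)) ∨ (i = i' + 1 ∧ p = vertex (i' + 1)) := by
  have key : ∀ i i', edgeFrame i' = edgeFrame i + turn (edgeKind i) →
      edgeKind i' = edgeKind i + 1 → i' = i + 1 := fun i i' h1 h2 =>
    edge_index_injective _ _ (h1.trans (edgeFrame_succ i).symm) (h2.trans (edgeKind_succ i).symm)
  rcases arcs_inter h h' with ⟨h1, h2⟩ | ⟨h1, h2, h3⟩ | ⟨h1, h2, h3⟩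
  · exact Or.inl (edge_index_injective _ _ h1 h2)
  · exact Or.inr (Or.inl ⟨key _ _ h1 h2, by rw [vertex_succ, h3]⟩)
  · exact Or.inr (Or.inr ⟨key _ _ h1 h2, by rw [vertex_succ, h3]⟩)

lemma succ_ne_self : ∀ i : ZMod 18, i + 1 ≠ i := by decide

lemma edge_inter_succ (i : ZMod 18) : edge i ∩ edge (i + 1) = {vertex (i + 1)} := by
  have hne : ∀ i : ZMod 18, i ≠ i + 1 + 1 := by decide
  ext p
  constructor
  · rintro ⟨h, h'⟩
    rcases edge_inter_cases h h' with h1 | ⟨-, h1⟩ | ⟨h1, -⟩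
    · exact absurd h1 (succ_ne_self i)
    · exact h1
    · exact absurd h1 (hne i)
  · rintro rfl
    exact ⟨(isArc_edge i).right_mem, (isArc_edge (i + 1)).left_mem⟩

lemma edge_inter_eq_empty {i j : ZMod 18} (h1 : j ≠ i) (h2 : j ≠ i + 1) (h3 : i ≠ j + 1) :
    edge i ∩ edge j = ∅ := by
  rw [Set.eq_empty_iff_forall_notMem]
  rintro p ⟨h, h'⟩
  rcases edge_inter_cases h h' with h | ⟨h, -⟩ | ⟨h, -⟩
  · exact h1 h
  · exact h2 h
  · exact h3 h

/-- Edges with different indices share at most one vertex, whereas an edge has two distinct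
endpoints. -/
lemma edge_injective : Function.Injective edge := by
  intro i i' h
  have hv := (isArc_edge i).left_mem
  have hw := (isArc_edge i).right_mem
  have hne := (isArc_edge i).ne
  rcases edge_inter_cases hv (h ▸ hv) with h1 | h1 | h1
  · exact h1.symm
  · exact absurd h1.2 hne
  · rcases edge_inter_cases hw (h ▸ hw) with h2 | h2 | h2
    · exact h2.symm
    · rw [h1.1] at h2
      exact absurd h2.1 ((by decide : ∀ i : ZMod 18, i ≠ i + 1 + 1) i')
    · exact absurd (h1.2.trans h2.2.symm) hne

lemma edge_mem (i : ZMod 18) :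
    (Even i.val → edge i ∈ boundaryRoads) ∧ (Odd i.val → edge i ∈ boundaryBridges) := by
  have h1 := one_mem_signs
  have h2 := neg_one_mem_signs
  have hev : ∀ i : ZMod 18, Even i.val → edgeKind i = 0 ∨ edgeKind i = 2 ∨ edgeKind i = 4 := by
    decide
  have hod : ∀ i : ZMod 18, Odd i.val → edgeKind i = 1 ∨ edgeKind i = 3 ∨ edgeKind i = 5 := by
    decide
  unfold edge
  constructor
  · intro h
    rcases hev i h with h | h | h <;> rw [h]
    · exact ⟨_, 1, h1, 1, h1, by norm_num, rfl⟩
    · exact ⟨_, -1, h2, 1, h1, by norm_num, rfl⟩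
    · exact ⟨_, -1, h2, -1, h2, by norm_num, rfl⟩
  · intro h
    rcases hod i h with h | h | h <;> rw [h]
    · exact ⟨_, Or.inr ⟨1, h1, rfl⟩⟩
    · exact ⟨_, Or.inr ⟨-1, h2, rfl⟩⟩
    · exact ⟨_, Or.inl rfl⟩

lemma P_eq_iUnion : P = ⋃ i, coneToInfinity (edge i) := by
  rw [← coneToInfinity_iUnion]
  unfold P bdM
  rw [← range_edge, Set.sUnion_range]

/-! ### Planar and elliptical slices -/

lemma inCoordinatePlane_coneToInfinity {E : Set R3} :
    InCoordinatePlane (coneToInfinity E) ↔ ∃ l, ∀ p ∈ E, p l = 0 := by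
  unfold InCoordinatePlane
  refine exists_congr fun l => coneToInfinity_subset_iff fun p hp t _ => ?_
  change t * p l = 0
  rw [show p l = 0 from hp, mul_zero]

lemma not_inCoordinatePlane_sideBridge (k : Fin 3) (s : ℝ) (hs : s ≠ 0) :
    ¬ InCoordinatePlane (coneToInfinity (cycled k (sideBridge s))) := by
  rw [inCoordinatePlane_coneToInfinity]
  rintro ⟨l, h⟩
  -- A point of the circle with no vanishing coordinate.
  have h1 : frame (-k) !₂[1, -2, s / 3] ∈ cycled k (sideBridge s) := by
    rw [mem_cycled, frame_frame_neg, mem_sideBridge]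
    exact ⟨rfl, by norm_num, by norm_num⟩
  have h2 := h _ h1
  rw [frame_apply] at h2
  generalize -k + l = m at h2
  fin_cases m
  · simp at h2
  · simp at h2
  · simp [hs] at h2

lemma arc_apply_two {j : Fin 6} (h1 : j ≠ 1) (h3 : j ≠ 3) {p : R3} (hp : p ∈ arc j) : p 2 = 0 := by
  have h := arcBounds_of_mem hp
  match j with
  | 1 => exact absurd rfl h1
  | 3 => exact absurd rfl h3
  | 0 | 2 | 4 | 5 => exact h.1

lemma inCoordinatePlane_edge_iff (i : ZMod 18) :
    InCoordinatePlane (coneToInfinity (edge i)) ↔ ¬ (edgeKind i = 1 ∨ edgeKind i = 3) := by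
  constructor
  · rintro h (h' | h') <;> unfold edge at h <;> rw [h'] at h
    · exact not_inCoordinatePlane_sideBridge _ 1 one_ne_zero h
    · exact not_inCoordinatePlane_sideBridge _ (-1) (neg_ne_zero.2 one_ne_zero) h
  · intro h
    rw [not_or] at h
    rw [inCoordinatePlane_coneToInfinity]
    exact ⟨edgeFrame i + 2, fun p hp => arc_apply_two h.1 h.2 (mem_cycled.1 hp)⟩

lemma ncard_inCoordinatePlane :
    {i | InCoordinatePlane (coneToInfinity (edge i))}.ncard = 12 := by
  simp only [inCoordinatePlane_edge_iff]
  rw [Set.ncard_eq_toFinset_card']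
  decide

lemma ncard_not_inCoordinatePlane :
    {i | ¬ InCoordinatePlane (coneToInfinity (edge i))}.ncard = 6 := by
  simp only [inCoordinatePlane_edge_iff, not_not]
  rw [Set.ncard_eq_toFinset_card']
  decide

/-- The coordinate change taking the elliptical cone over a side bridge to the round cone. -/
def sideEquiv (k : Fin 3) (s : ℤˣ) : R3 ≃ₗ[ℝ] R3 where
  toFun p := !₂[p k - 3 * (s : ℤ) * p (k + 2), p (k + 1) + 3 * (s : ℤ) * p (k + 2),
    3 * (s : ℤ) * p (k + 2)]
  invFun q := frame (-k) !₂[q 0 + q 2, q 1 - q 2, (s : ℤ) * q 2 / 3]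
  map_add' p q := by apply ext3 <;> simp <;> ring
  map_smul' c p := by apply ext3 <;> simp <;> ring
  left_inv p := by
    have hs : ((s : ℤ) : ℝ) * (s : ℤ) = 1 := by exact_mod_cast Int.units_coe_mul_self s
    apply frame_injective k
    rw [frame_frame_neg]
    apply ext3
    · simp
    · simp
    · simp only [Matrix.cons_val, frame_two_apply]
      linear_combination p (k + 2) * hs
  right_inv q := by
    have hs : ((s : ℤ) : ℝ) * (s : ℤ) = 1 := by exact_mod_cast Int.units_coe_mul_self s
    have hk1 : -k + (k + 1) = 1 := neg_add_cancel_left k 1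
    have hk2 : -k + (k + 2) = 2 := neg_add_cancel_left k 2
    apply ext3
    · simp only [frame_apply, neg_add_cancel, hk2, Matrix.cons_val]
      linear_combination -q 2 * hs
    · simp only [frame_apply, hk1, hk2, Matrix.cons_val]
      linear_combination q 2 * hs
    · simp only [frame_apply, hk2, Matrix.cons_val]
      linear_combination q 2 * hs

/-- The elliptical cone over a side bridge. -/
def sideCone (k : Fin 3) (s : ℤˣ) : Set R3 :=
  {p | sideEquiv k s p 0 ^ 2 + sideEquiv k s p 1 ^ 2 = sideEquiv k s p 2 ^ 2 ∧
    0 ≤ sideEquiv k s p 2}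

lemma isEllipticalCone_sideCone (k : Fin 3) (s : ℤˣ) : IsEllipticalCone (sideCone k s) := ⟨_, rfl⟩

lemma mem_sideCone {k : Fin 3} {s : ℤˣ} {p : R3} : p ∈ sideCone k s ↔
    (p k - 3 * (s : ℤ) * p (k + 2)) ^ 2 + (p (k + 1) + 3 * (s : ℤ) * p (k + 2)) ^ 2 =
      (3 * (s : ℤ) * p (k + 2)) ^ 2 ∧ 0 ≤ 3 * (s : ℤ) * p (k + 2) := Iff.rfl

/-- The signs of the octant containing the elliptical cone over a side bridge. -/
def sideSigns (k : Fin 3) (s : ℤˣ) (l : Fin 3) : ℤˣ :=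
  if l = k then 1 else if l = k + 1 then -1 else s

/-- With `w = 3 s z ≥ 0`, the equation `(x - w)² + (y + w)² = w²` forces `(x - w)² ≤ w²` and `(y +
w)² ≤ w²`, hence `x ≥ 0 ≥ -y - w + w` read as `x ≥ 0` and `y ≤ 0`. -/
lemma sideCone_subset_orthant (k : Fin 3) (s : ℤˣ) : sideCone k s ⊆ orthant (sideSigns k s) := by
  intro p hp l
  obtain ⟨h1, h2⟩ := mem_sideCone.1 hp
  have hk1 : k + 1 ≠ k := (by decide : ∀ k : Fin 3, k + 1 ≠ k) k
  have hk2 : k + 2 ≠ k := (by decide : ∀ k : Fin 3, k + 2 ≠ k) k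
  have hk3 : k + 2 ≠ k + 1 := (by decide : ∀ k : Fin 3, k + 2 ≠ k + 1) k
  rcases fin3_cases k l with rfl | rfl | rfl
  · rw [sideSigns, if_pos rfl]
    have : 0 ≤ p l := by
      by_contra! h
      nlinarith [sq_nonneg (p (l + 1) + 3 * (s : ℤ) * p (l + 2))]
    simpa using this
  · rw [sideSigns, if_neg hk1, if_pos rfl]
    have : p (k + 1) ≤ 0 := by
      by_contra! h
      nlinarith [sq_nonneg (p k - 3 * (s : ℤ) * p (k + 2))]
    simpa using this
  · rw [sideSigns, if_neg hk2, if_neg hk3]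
    linarith

lemma smul_mem_sideCone {k : Fin 3} {s : ℤˣ} {p : R3} (hp : p ∈ sideCone k s) {t : ℝ}
    (ht : 0 ≤ t) : t • p ∈ sideCone k s := by
  obtain ⟨h1, h2⟩ := mem_sideCone.1 hp
  rw [mem_sideCone]
  simp only [PiLp.smul_apply, smul_eq_mul]
  constructor
  · linear_combination t ^ 2 * h1
  · rw [mul_left_comm]; positivity

/-- On the bridge `3 s z = 1`, and the equation of the cone is the circle equation homogenized with
`3 s z`. -/
lemma sideBridge_subset_sideCone (k : Fin 3) (s : ℤˣ) :
    cycled k (sideBridge ((s : ℤ) : ℝ)) ⊆ sideCone k s := by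
  intro p hp
  have hs : ((s : ℤ) : ℝ) * (s : ℤ) = 1 := by exact_mod_cast Int.units_coe_mul_self s
  obtain ⟨h1, h2, -⟩ := mem_sideBridge.1 (mem_cycled.1 hp)
  simp only [frame_zero_apply, frame_one_apply, frame_two_apply] at h1 h2
  have h3 : 3 * ((s : ℤ) : ℝ) * p (k + 2) = 1 := by rw [h1]; linear_combination hs
  rw [mem_sideCone, h3]
  exact ⟨by linarith, zero_le_one⟩

/-- The height sign of each kind of side bridge. -/
def kindSign (j : Fin 6) : ℤˣ := if j = 3 then -1 else 1

lemma edge_subset_sideCone {i : ZMod 18} (h : edgeKind i = 1 ∨ edgeKind i = 3) :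
    edge i ⊆ sideCone (edgeFrame i) (kindSign (edgeKind i)) := by
  unfold edge
  rcases h with h | h <;> rw [h]
  · have := sideBridge_subset_sideCone (edgeFrame i) 1
    rwa [Units.val_one, Int.cast_one] at this
  · have := sideBridge_subset_sideCone (edgeFrame i) (-1)
    rwa [Units.val_neg, Units.val_one, Int.cast_neg, Int.cast_one] at this

/-- The patterns are the cyclic rotations of `(+, -, ±)`: all sign patterns except the two constant
ones. -/
lemma sideSigns_injOn : ∀ i i', (edgeKind i = 1 ∨ edgeKind i = 3) →
    (edgeKind i' = 1 ∨ edgeKind i' = 3) →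
    (∀ l, sideSigns (edgeFrame i) (kindSign (edgeKind i)) l =
      sideSigns (edgeFrame i') (kindSign (edgeKind i')) l) → i = i' := by
  decide

lemma exists_slices : ∃ (e : ZMod 18 → Set R3) (v : ZMod 18 → R3),
    Function.Injective e ∧
    Set.range e = boundaryRoads ∪ boundaryBridges ∧
    (∀ i : ZMod 18, (Even i.val → e i ∈ boundaryRoads) ∧ (Odd i.val → e i ∈ boundaryBridges)) ∧
    P = ⋃ i, coneToInfinity (e i) ∧
    (∀ i, IsTopologicalTriangle (coneToInfinity (e i))
      ![OnePoint.infty, (v i : S3), (v (i + 1) : S3)]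
      ![inS3 (e i), coneToInfinity {v (i + 1)}, coneToInfinity {v i}]) ∧
    (∀ i, coneToInfinity (e i) ∩ coneToInfinity (e (i + 1)) = coneToInfinity {v (i + 1)}) ∧
    (∀ i j, j ≠ i → j ≠ i + 1 → i ≠ j + 1 →
      coneToInfinity (e i) ∩ coneToInfinity (e j) = {OnePoint.infty}) ∧
    {i | InCoordinatePlane (coneToInfinity (e i))}.ncard = 12 ∧
    {i | ¬ InCoordinatePlane (coneToInfinity (e i))}.ncard = 6 ∧
    ∃ (C : ZMod 18 → Set R3) (σ : ZMod 18 → Fin 3 → ℤˣ),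
      Set.InjOn σ {i | ¬ InCoordinatePlane (coneToInfinity (e i))} ∧
      ∀ i, ¬ InCoordinatePlane (coneToInfinity (e i)) →
        IsEllipticalCone (C i) ∧ C i ⊆ orthant (σ i) ∧
        coneToInfinity (e i) ⊆ inS3 (C i) ∪ {OnePoint.infty} := by
  refine ⟨edge, vertex, edge_injective, range_edge, edge_mem, P_eq_iUnion,
    fun i => (isArc_edge i).isTopologicalTriangle (edge_subset_bdM i), fun i => ?_,
    fun i j h1 h2 h3 => ?_, ncard_inCoordinatePlane, ncard_not_inCoordinatePlane,
    fun i => sideCone (edgeFrame i) (kindSign (edgeKind i)),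
    fun i => sideSigns (edgeFrame i) (kindSign (edgeKind i)), ?_, fun i hi => ?_⟩
  · rw [coneToInfinity_inter (edge_subset_bdM _) (edge_subset_bdM _), edge_inter_succ]
  · rw [coneToInfinity_inter (edge_subset_bdM _) (edge_subset_bdM _), edge_inter_eq_empty h1 h2 h3,
      coneToInfinity_empty]
  · simp only [inCoordinatePlane_edge_iff, not_not]
    exact fun i hi i' hi' h => sideSigns_injOn i i' hi hi' (congrFun h)
  · rw [inCoordinatePlane_edge_iff, not_not] at hi
    refine ⟨isEllipticalCone_sideCone _ _, sideCone_subset_orthant _ _, ?_⟩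
    rw [coneToInfinity_subset_iff fun p hp t ht => smul_mem_sideCone hp (by linarith)]
    exact edge_subset_sideCone hi

end Boy

end

/-! ### The theorem -/

theorem mainTheorem2 :
    -- `M` is an immersed Möbius band, and `∂M` is the injective image of its boundary
    (∃ h : Boy.MobiusBand ≃ₜ Boy.MStar,
      h '' Boy.MobiusBand.boundary = Boy.mapM ⁻¹' Boy.bdM ∧
      Set.InjOn Boy.mapM (Boy.mapM ⁻¹' Boy.bdM)) ∧
    Boy.IsTopologicalImmersion Boy.mapM ∧
    Set.range Boy.mapM = Boy.M ∧
    -- cone-friendliness; the pizza is an embedded disk meeting `M` exactly in `∂M`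
    Boy.ConeFriendly Boy.bdM ∧
    Boy.IsEmbeddedDisk Boy.P (Boy.inS3 Boy.bdM) ∧
    Boy.inS3 Boy.M ∩ Boy.P = Boy.inS3 Boy.bdM ∧
    -- the 18 slices, over the edges `e i` from `v i` to `v (i + 1)` of the 18-gon `∂M`
    (∃ (e : ZMod 18 → Set Boy.R3) (v : ZMod 18 → Boy.R3),
      Function.Injective e ∧
      Set.range e = Boy.boundaryRoads ∪ Boy.boundaryBridges ∧
      (∀ i : ZMod 18, (Even i.val → e i ∈ Boy.boundaryRoads) ∧
        (Odd i.val → e i ∈ Boy.boundaryBridges)) ∧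
      Boy.P = ⋃ i, Boy.coneToInfinity (e i) ∧
      (∀ i, Boy.IsTopologicalTriangle (Boy.coneToInfinity (e i))
        ![OnePoint.infty, (v i : Boy.S3), (v (i + 1) : Boy.S3)]
        ![Boy.inS3 (e i), Boy.coneToInfinity {v (i + 1)}, Boy.coneToInfinity {v i}]) ∧
      (∀ i, Boy.coneToInfinity (e i) ∩ Boy.coneToInfinity (e (i + 1)) =
        Boy.coneToInfinity {v (i + 1)}) ∧
      (∀ i j, j ≠ i → j ≠ i + 1 → i ≠ j + 1 →
        Boy.coneToInfinity (e i) ∩ Boy.coneToInfinity (e j) = {OnePoint.infty}) ∧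
      {i | Boy.InCoordinatePlane (Boy.coneToInfinity (e i))}.ncard = 12 ∧
      {i | ¬ Boy.InCoordinatePlane (Boy.coneToInfinity (e i))}.ncard = 6 ∧
      ∃ (C : ZMod 18 → Set Boy.R3) (σ : ZMod 18 → Fin 3 → ℤˣ),
        Set.InjOn σ {i | ¬ Boy.InCoordinatePlane (Boy.coneToInfinity (e i))} ∧
        ∀ i, ¬ Boy.InCoordinatePlane (Boy.coneToInfinity (e i)) →
          Boy.IsEllipticalCone (C i) ∧ C i ⊆ Boy.orthant (σ i) ∧
          Boy.coneToInfinity (e i) ⊆ Boy.inS3 (C i) ∪ {OnePoint.infty}) ∧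
    -- `M ∪ P` is an immersed projective plane
    (∃ h : Boy.RP2 ≃ₜ Boy.BoyStar,
      Boy.IsTopologicalImmersion (Boy.boyMap ∘ h) ∧
      Set.range (Boy.boyMap ∘ h) = Boy.inS3 Boy.M ∪ Boy.P) ∧
    -- the 6-fold symmetry
    Nat.card (Subgroup.closure Boy.symmetryGenerators) = 6 ∧
    (∀ g ∈ Subgroup.closure Boy.symmetryGenerators,
      g '' Boy.M = Boy.M ∧ OnePoint.map g '' Boy.P = Boy.P ∧
      OnePoint.map g '' (Boy.inS3 Boy.M ∪ Boy.P) = Boy.inS3 Boy.M ∪ Boy.P) := by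
  exact ⟨⟨Boy.mobiusHomeo.symm, Boy.mobiusHomeo_symm_image_boundary, Boy.mapM_injOn_bd⟩,
    Boy.mapM_immersion, Boy.range_mapM, Boy.coneFriendly_bdM, Boy.isEmbeddedDisk_P,
    Boy.inS3_M_inter_P, Boy.exists_slices, Boy.exists_immersed_RP2,
    Boy.card_closure_symmetryGenerators, fun g hg => Boy.symmetry_image hg⟩
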